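/- **Proposition 3.5.** Let $n\ge 1$. Identify $T^*S^n$ with $\{(q,p)\in\mathbb R^{n+1}\times\mathbb R^{n+1} : |q|=1,\ \langle q,p\rangle=0\}$, with Liouville form $\lambda=p\,dq$, let $P=ST^*S^n=\{|p|=1\}$ with contact form $\lambda_P=\lambda|_P$, and put $t=\log|p|$ off the zero section. Choose a smooth non-increasing function $f:\mathbb R\to\mathbb R$ with $f=\pi$ on $(-\infty,\varepsilon]$ for some $\varepsilon>0$ and $f=0$ on $[1-\delta,\infty)$ for some $\delta>0$. The right-handed Dehn twist $\tau$ on the page $W=\{|p|<e\}\subset T^*S^n$ is the normalized geodesic flow at time $f(t)$, extended over the zero section by the antipodal map $(q,p)\mapsto(-q,-p)$; it satisfies $\tau^*\lambda=\lambda-dU$ with $U=C-\int_0^t f'(s)e^s\,ds$, where $C>0$ is a constant ($U=C$ on the zero section). Let $U_c$ be the constant value of $U$ for $1-\delta\le t\leq 1$. The left-handed stabilization of the standard contact sphere is the contact open book $\mathrm{OB}(T^*S^n,\tau^{-1})$ obtained by gluing $P\times\{z\in\mathbb C:|z|<r_0+\delta\}$, with $r_0>0$ and with contact form $h_1(r)\lambda_P+h_2(r)\,d\theta$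 ($z=re^{i\theta}$), to the mapping torus $W\times\mathbb R/\big((x,\phi)\sim(\tau(x),\phi+U(x))\big)$, with contact form $d\phi+\lambda$, along $$(p;re^{i\theta})\longmapsto\Big[e^{1+r_0-r}p,\ \tfrac{U_c\theta}{2\pi}\Big],\qquad r_0<r<r_0+\delta .$$ Here $h_1(r)$ and $h_2(r)/r^2$ are smooth functions of $r^2$ with $h_1>0$, which satisfy the contact condition (that is, $h_1h_2'-h_2h_1'>0$ for $r>0$ and $\lim_{r\to0}h_2(r)/r^2>0$) and agree with $e^{1+r_0-r}$ and $U_c/2\pi$, respectively, for $r_0<r<r_0+\delta$. For every such choice of $f,\delta,C,r_0,h_1,h_2$, there are a diffeomorphism $\Phi:\mathrm{OB}(T^*S^n,\tau^{-1})\to S^{2n+1}$ onto the total space of the Hopf circle bundle $\pi:S^{2n+1}\to\mathbb{CP}^n$ and a contact form $\alpha$ on $S^{2n+1}$, invariant under the circle action of the Hopf bundle, such that $\Phi^*\alpha$ defines the cooriented contact structure of the open book. However, the almost dividing set $$\Gamma=\{x\in\mathbb{CP}^n : \alpha_z(X_z)=0\ \text{ for } z\in\pi^{-1}(x)\},\qquad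 X_z=\tfrac{d}{ds}\big|_{s=0}e^{is}z,$$ is nonempty, and it is an embedded submanifold of $\mathbb{CP}^n$ which, with the contact structure induced by $\alpha$ (the one-form on $\Gamma$ given by $d\pi(w)\mapsto\alpha(w)$), is contactomorphic to the unit cotangent bundle $(ST^*\mathbb{RP}^n,\lambda_{can})$ of $\mathbb{RP}^n=S^n/\pm1$. -/

import Mathlib

open scoped Manifold ContDiff InnerProductSpace Topology

noncomputable section

namespace LeftStabilization

open Module

/-! ### Regular level sets as manifolds -/

section LevelSets
variable {V F : Type*} [NormedAddCommGroup V] [NormedSpace ℝ V] [FiniteDimensional ℝ V]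
  [NormedAddCommGroup F] [NormedSpace ℝ F] [FiniteDimensional ℝ F]

/-- `S` is the zero set, inside the open set `Ω`, of a smooth map `f` which has `0` as a regular
value, and `d` is the expected dimension. -/
structure IsRegularLevel (S Ω : Set V) (f : V → F) (d : ℕ) : Prop where
  isOpen : IsOpen Ω
  mem_iff : ∀ x, x ∈ S ↔ x ∈ Ω ∧ f x = 0
  contDiff : ContDiff ℝ ∞ f
  surj : ∀ x ∈ S, Function.Surjective (fderiv ℝ f x)
  dim : ∀ x ∈ S, finrank ℝ V = finrank ℝ F + d

theorem exists_linear_complement (A : V →L[ℝ] F) (hA : Function.Surjective A) (d : ℕ)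
    (hd : finrank ℝ V = finrank ℝ F + d) :
    ∃ B : V →L[ℝ] EuclideanSpace ℝ (Fin d), ∃ e : V ≃L[ℝ] F × EuclideanSpace ℝ (Fin d),
      (e : V →L[ℝ] F × EuclideanSpace ℝ (Fin d)) = A.prod B := by
  have hk : finrank ℝ (LinearMap.ker (A : V →ₗ[ℝ] F)) = finrank ℝ (EuclideanSpace ℝ (Fin d)) := by
    have h := LinearMap.finrank_range_add_finrank_ker (A : V →ₗ[ℝ] F)
    rw [LinearMap.range_eq_top.2 hA, finrank_top] at h
    rw [finrank_euclideanSpace_fin]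
    omega
  let e0 := LinearEquiv.ofFinrankEq _ _ hk
  obtain ⟨p, hp⟩ := (LinearMap.ker (A : V →ₗ[ℝ] F)).exists_isCompl
  let P := Submodule.projectionOnto _ _ hp
  let B : V →ₗ[ℝ] EuclideanSpace ℝ (Fin d) := e0.toLinearMap.comp P
  let T : V →ₗ[ℝ] F × EuclideanSpace ℝ (Fin d) := (A : V →ₗ[ℝ] F).prod B
  have hinj : Function.Injective T := by
    rw [← LinearMap.ker_eq_bot, LinearMap.ker_eq_bot']
    intro v hv
    have h1 : A v = 0 := congrArg Prod.fst hv
    have h2 : P v = 0 := e0.injective ((congrArg Prod.snd hv).trans (map_zero e0).symm)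
    have h3 : P v = ⟨v, h1⟩ := Submodule.projectionOnto_apply_left hp ⟨v, h1⟩
    rw [h3] at h2
    exact congrArg Subtype.val h2
  have hfr : finrank ℝ V = finrank ℝ (F × EuclideanSpace ℝ (Fin d)) := by
    rw [finrank_prod, finrank_euclideanSpace_fin, hd]
  refine ⟨LinearMap.toContinuousLinearMap B,
    (LinearEquiv.ofInjectiveOfFinrankEq T hinj hfr).toContinuousLinearEquiv, ?_⟩
  ext v <;> rfl

/-- The chart of a regular level set around the point `x₀`: the restriction of a linear map `B`
to a neighbourhood on which `(f, B)` is a diffeomorphism onto an open set. -/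
theorem IsRegularLevel.exists_chart {S Ω : Set V} {f : V → F} {d : ℕ}
    (hS : IsRegularLevel S Ω f d) (x₀ : S) :
    ∃ (B : V →L[ℝ] EuclideanSpace ℝ (Fin d))
      (φ : OpenPartialHomeomorph V (F × EuclideanSpace ℝ (Fin d))),
      (x₀ : V) ∈ φ.source ∧ φ.source ⊆ Ω ∧ (∀ x, φ x = (f x, B x)) ∧
      ∀ x ∈ φ.source, ∃ e : V ≃L[ℝ] F × EuclideanSpace ℝ (Fin d),
        HasFDerivAt φ (e : V →L[ℝ] F × EuclideanSpace ℝ (Fin d)) x := by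
  obtain ⟨B, e, he⟩ := exists_linear_complement (fderiv ℝ f x₀) (hS.surj x₀ x₀.2) d
    (hS.dim x₀ x₀.2)
  have hf1 : ∀ x, HasFDerivAt (fun x => (f x, B x)) ((fderiv ℝ f x).prod B) x := fun x =>
    ((hS.contDiff.differentiable (by simp)) x).hasFDerivAt.prodMk B.hasFDerivAt
  have hc : ContDiff ℝ ∞ (fun x => (f x, B x)) := hS.contDiff.prodMk B.contDiff
  let φ := hc.contDiffAt.toOpenPartialHomeomorph (fun x => (f x, B x)) (a := (x₀ : V))
    (he ▸ hf1 x₀) (by simp)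
  let W : Set V := Ω ∩ {x | (fderiv ℝ f x).prod B ∈
    Set.range ((↑) : (V ≃L[ℝ] F × EuclideanSpace ℝ (Fin d)) → (V →L[ℝ] F × EuclideanSpace ℝ (Fin d)))}
  have hW : IsOpen W := by
    refine hS.isOpen.inter (ContinuousLinearEquiv.isOpen.preimage ?_)
    have h := hc.continuous_fderiv (by simp)
    have h2 : fderiv ℝ (fun x => (f x, B x)) = fun x => (fderiv ℝ f x).prod B :=
      funext fun x => (hf1 x).fderiv
    rwa [h2] at h
  refine ⟨B, φ.restrOpen W hW, ?_, ?_, fun x => rfl, ?_⟩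
  · refine ⟨hc.contDiffAt.mem_toOpenPartialHomeomorph_source _ _, ((hS.mem_iff _).1 x₀.2).1, e, he⟩
  · exact fun x hx => hx.2.1
  · rintro x ⟨-, -, e', he'⟩
    exact ⟨e', he' ▸ hf1 x⟩

/-- The chart of `S` obtained from a straightening `φ = (f, B)` of the ambient space. -/
def levelChart {S Ω : Set V} {f : V → F} {d : ℕ} (hS : IsRegularLevel S Ω f d) (x₀ : S) :
    OpenPartialHomeomorph S (EuclideanSpace ℝ (Fin d)) :=
  let B := (hS.exists_chart x₀).choose
  let φ := (hS.exists_chart x₀).choose_spec.choose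
  have h := (hS.exists_chart x₀).choose_spec.choose_spec
  have hmem : ∀ u, ((0 : F), u) ∈ φ.target → φ.symm (0, u) ∈ S := fun u hu => by
    refine (hS.mem_iff _).2 ⟨h.2.1 (φ.map_target hu), ?_⟩
    have := h.2.2.1 (φ.symm (0, u))
    rw [φ.right_inv hu] at this
    exact (congrArg Prod.fst this).symm
  have hval : ∀ x : S, φ x = (0, B x) := fun x => by
    rw [h.2.2.1, ((hS.mem_iff _).1 x.2).2]
  { toFun := fun x => B x
    invFun := fun u => by
      classical exact if hu : ((0 : F), u) ∈ φ.target then ⟨φ.symm (0, u), hmem u hu⟩ else x₀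
    source := {x | (x : V) ∈ φ.source}
    target := {u | ((0 : F), u) ∈ φ.target}
    map_source' := fun x hx => by
      have := φ.map_source hx
      rwa [hval] at this
    map_target' := fun u hu => by
      have hu' : ((0 : F), u) ∈ φ.target := hu
      simp [hu', φ.map_target hu']
    left_inv' := fun x hx => by
      have hx' := φ.map_source hx
      rw [hval] at hx'
      have h3 := φ.left_inv hx
      rw [hval] at h3
      simp [hx', h3]
    right_inv' := fun u hu => by
      have hu' : ((0 : F), u) ∈ φ.target := hu
      have h3 := h.2.2.1 (φ.symm (0, u))
      rw [φ.right_inv hu'] at h3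
      simpa [hu'] using (congrArg Prod.snd h3).symm
    open_source := φ.open_source.preimage continuous_subtype_val
    open_target := φ.open_target.preimage (by fun_prop)
    continuousOn_toFun := by fun_prop
    continuousOn_invFun := by
      rw [Topology.IsInducing.subtypeVal.continuousOn_iff]
      refine (φ.continuousOn_symm.comp (f := fun u => ((0 : F), u)) (by fun_prop)
        (fun u hu => hu)).congr ?_
      intro u hu
      have hu' : ((0 : F), u) ∈ φ.target := hu
      simp [hu'] }

/-- The manifold structure of a regular level set. -/
abbrev levelChartedSpace {S Ω : Set V} {f : V → F} {d : ℕ} (hS : IsRegularLevel S Ω f d) :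
    ChartedSpace (EuclideanSpace ℝ (Fin d)) S where
  atlas := Set.range (levelChart hS)
  chartAt := levelChart hS
  mem_chart_source x := (hS.exists_chart x).choose_spec.choose_spec.1
  chart_mem_atlas x := ⟨x, rfl⟩

theorem levelIsManifold {S Ω : Set V} {f : V → F} {d : ℕ} (hS : IsRegularLevel S Ω f d) :
    @IsManifold ℝ _ _ _ _ _ _ (𝓡 d) ∞ S _ (levelChartedSpace hS) := by
  let := levelChartedSpace hS
  apply isManifold_of_contDiffOn
  rintro _ _ ⟨x, rfl⟩ ⟨y, rfl⟩
  have h := (hS.exists_chart x).choose_spec.choose_spec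
  have hc : ContDiff ℝ ∞ (hS.exists_chart x).choose_spec.choose := by
    have : ((hS.exists_chart x).choose_spec.choose : V → _) =
      fun z => (f z, (hS.exists_chart x).choose z) := funext h.2.2.1
    rw [this]
    exact hS.contDiff.prodMk (ContinuousLinearMap.contDiff _)
  intro u hu
  have hu1 : ((0 : F), u) ∈ (hS.exists_chart x).choose_spec.choose.target := by
    exact hu.1.1
  obtain ⟨e, he⟩ := h.2.2.2 _ ((hS.exists_chart x).choose_spec.choose.map_target hu1)
  have key := (hS.exists_chart x).choose_spec.choose.contDiffAt_symm hu1 he hc.contDiffAt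
  have key2 : ContDiffAt ℝ ∞ (fun u => (hS.exists_chart y).choose
      ((hS.exists_chart x).choose_spec.choose.symm ((0 : F), u))) u :=
    (ContinuousLinearMap.contDiff _).contDiffAt.comp u
      (key.comp u (contDiffAt_const.prodMk contDiffAt_id))
  refine key2.contDiffWithinAt.congr_of_mem ?_ hu
  intro v hv
  have hv1 : ((0 : F), v) ∈ (hS.exists_chart x).choose_spec.choose.target := by
    exact hv.1.1
  simp only [levelChart, OpenPartialHomeomorph.coe_trans, Function.comp_apply]
  simp [hv1]

end LevelSets

/-- The Euclidean space `ℝⁿ⁺¹` containing the unit sphere `Sⁿ`. -/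
abbrev Euc (n : ℕ) := EuclideanSpace ℝ (Fin (n + 1))

section Equations
variable {n : ℕ} {V : Type*} [NormedAddCommGroup V] [NormedSpace ℝ V]

theorem inner_self_sub_one (x : Euc n) : ⟪x, x⟫_ℝ - 1 = 0 ↔ ‖x‖ = 1 := by
  rw [real_inner_self_eq_norm_sq, sub_eq_zero]
  constructor
  · intro h
    nlinarith [norm_nonneg x]
  · intro h
    rw [h, one_pow]

theorem hasFDerivAt_inner_clm (Q P : V →L[ℝ] Euc n) (x : V) :
    HasFDerivAt (fun x => ⟪Q x, P x⟫_ℝ)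
      ((innerSL ℝ (Q x)).comp P + (innerSL ℝ (P x)).comp Q) x := by
  refine (Q.hasFDerivAt.inner ℝ P.hasFDerivAt).congr_fderiv ?_
  ext v
  simp [real_inner_comm]

theorem stiefel_surj (Q P : V →L[ℝ] Euc n) (hQP : Function.Surjective fun v => (Q v, P v))
    (x : V) (h1 : ‖Q x‖ = 1) (h2 : ‖P x‖ = 1) (h3 : ⟪Q x, P x⟫_ℝ = 0) :
    Function.Surjective (fderiv ℝ (fun x => (⟪Q x, Q x⟫_ℝ - 1, ⟪P x, P x⟫_ℝ - 1, ⟪Q x, P x⟫_ℝ)) x) := by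
  have hd := ((hasFDerivAt_inner_clm Q Q x).sub_const 1).prodMk
    (((hasFDerivAt_inner_clm P P x).sub_const 1).prodMk (hasFDerivAt_inner_clm Q P x))
  rw [hd.fderiv]
  rintro ⟨a, b, c⟩
  obtain ⟨v, hv⟩ := hQP ((a / 2) • Q x + c • P x, (b / 2) • P x)
  have hv1 : Q v = (a / 2) • Q x + c • P x := congrArg Prod.fst hv
  have hv2 : P v = (b / 2) • P x := congrArg Prod.snd hv
  refine ⟨v, ?_⟩
  have h3' : ⟪P x, Q x⟫_ℝ = 0 := by rw [real_inner_comm]; exact h3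
  simp [hv1, hv2, inner_add_right, inner_smul_right, h1, h2, h3, h3']

theorem cotangent_surj (Q P : V →L[ℝ] Euc n) (hQP : Function.Surjective fun v => (Q v, P v))
    (x : V) (h1 : ‖Q x‖ = 1) (h3 : ⟪Q x, P x⟫_ℝ = 0) :
    Function.Surjective (fderiv ℝ (fun x => (⟪Q x, Q x⟫_ℝ - 1, ⟪Q x, P x⟫_ℝ)) x) := by
  have hd := ((hasFDerivAt_inner_clm Q Q x).sub_const 1).prodMk (hasFDerivAt_inner_clm Q P x)
  rw [hd.fderiv]
  rintro ⟨a, c⟩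
  obtain ⟨v, hv⟩ := hQP ((a / 2) • Q x, c • Q x - (a / 2) • P x)
  have hv1 : Q v = (a / 2) • Q x := congrArg Prod.fst hv
  have hv2 : P v = c • Q x - (a / 2) • P x := congrArg Prod.snd hv
  refine ⟨v, ?_⟩
  have h3' : ⟪P x, Q x⟫_ℝ = 0 := by rw [real_inner_comm]; exact h3
  simp [hv1, hv2, inner_sub_right, inner_smul_right, h1, h3, h3']

end Equations

/-! ### The unit cotangent bundles of `Sⁿ` and `ℝPⁿ` -/

/-- The unit cotangent bundle `ST*Sⁿ` of the round sphere: pairs `(q, p)` with `q ∈ Sⁿ` and `p` a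
unit covector at `q`, identified by the round metric with a unit vector orthogonal to `q`. -/
def unitCotangentSphere (n : ℕ) : Set (Euc n × Euc n) :=
  {x | ‖x.1‖ = 1 ∧ ‖x.2‖ = 1 ∧ ⟪x.1, x.2⟫_ℝ = 0}

theorem unitCotangentSphere_regular (n : ℕ) :
    IsRegularLevel (unitCotangentSphere n) Set.univ
      (fun x : Euc n × Euc n => (⟪x.1, x.1⟫_ℝ - 1, ⟪x.2, x.2⟫_ℝ - 1, ⟪x.1, x.2⟫_ℝ))
      (2 * n - 1) := by
  have hs : ∀ x ∈ unitCotangentSphere n, Function.Surjective (fderiv ℝ (fun x : Euc n × Euc n =>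
      (⟪x.1, x.1⟫_ℝ - 1, ⟪x.2, x.2⟫_ℝ - 1, ⟪x.1, x.2⟫_ℝ)) x) := fun x hx =>
    stiefel_surj (ContinuousLinearMap.fst ℝ (Euc n) (Euc n)) (ContinuousLinearMap.snd ℝ (Euc n) (Euc n))
      (fun v => ⟨v, rfl⟩) x hx.1 hx.2.1 hx.2.2
  refine ⟨isOpen_univ, ?_, ?_, hs, ?_⟩
  · intro x
    simp only [unitCotangentSphere, Set.mem_ofPred_eq, Set.mem_univ, true_and, Prod.mk_eq_zero,
      inner_self_sub_one]
  · exact ((contDiff_fst.inner ℝ contDiff_fst).sub contDiff_const).prodMk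
      (((contDiff_snd.inner ℝ contDiff_snd).sub contDiff_const).prodMk
        (contDiff_fst.inner ℝ contDiff_snd))
  · intro x hx
    have h := LinearMap.finrank_le_finrank_of_surjective (hs x hx)
    simp [finrank_prod] at h ⊢
    omega

instance (n : ℕ) : ChartedSpace (EuclideanSpace ℝ (Fin (2 * n - 1))) (unitCotangentSphere n) :=
  levelChartedSpace (unitCotangentSphere_regular n)

instance (n : ℕ) : IsManifold (𝓡 (2 * n - 1)) ∞ (unitCotangentSphere n) :=
  levelIsManifold (unitCotangentSphere_regular n)

instance (n : ℕ) : LocallyCompactSpace (unitCotangentSphere n) :=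
  ChartedSpace.locallyCompactSpace (EuclideanSpace ℝ (Fin (2 * n - 1))) _

/-- The action of `ℤ/2 = {1, -1}` on `ST*Sⁿ` induced by the antipodal map of `Sⁿ`. -/
instance (n : ℕ) : MulAction ℤˣ (unitCotangentSphere n) where
  smul u x := ⟨(((u : ℤ) : ℝ) • x.1.1, ((u : ℤ) : ℝ) • x.1.2), by
    have hx := x.2
    rcases Int.units_eq_one_or u with rfl | rfl <;>
      simpa [unitCotangentSphere] using hx⟩
  one_smul x := Subtype.ext <| by
    change ((((1 : ℤˣ) : ℤ) : ℝ) • x.1.1, (((1 : ℤˣ) : ℤ) : ℝ) • x.1.2) = x.1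
    simp
  mul_smul u v x := Subtype.ext <| by
    change ((((u * v : ℤˣ) : ℤ) : ℝ) • x.1.1, (((u * v : ℤˣ) : ℤ) : ℝ) • x.1.2) =
      (((u : ℤ) : ℝ) • ((v : ℤ) : ℝ) • x.1.1, ((u : ℤ) : ℝ) • ((v : ℤ) : ℝ) • x.1.2)
    simp [mul_smul]

theorem coe_units_smul {n : ℕ} (u : ℤˣ) (x : unitCotangentSphere n) :
    ((u • x : unitCotangentSphere n) : Euc n × Euc n) =
      (((u : ℤ) : ℝ) • x.1.1, ((u : ℤ) : ℝ) • x.1.2) := rfl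

instance (n : ℕ) : ContinuousConstSMul ℤˣ (unitCotangentSphere n) where
  continuous_const_smul u := by
    refine Continuous.subtype_mk ?_ _
    fun_prop

instance (n : ℕ) : IsCancelSMul ℤˣ (unitCotangentSphere n) where
  left_cancel' u x y h := (MulAction.injective u) h
  right_cancel' u v x h := by
    have h1 : ((u : ℤ) : ℝ) • x.1.1 = ((v : ℤ) : ℝ) • x.1.1 := congrArg (fun y => y.1.1) h
    have h2 : x.1.1 ≠ 0 := by
      intro h0
      have := x.2.1
      rw [h0] at this
      simp at this
    have h3 := smul_left_injective ℝ h2 h1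
    exact Units.ext (by exact_mod_cast h3)

/-- The unit cotangent bundle `ST*ℝPⁿ` of `ℝPⁿ = Sⁿ/±1` with its round metric, as the quotient of
`ST*Sⁿ` by the antipodal map. -/
abbrev UnitCotangentRP (n : ℕ) := MulAction.orbitRel.Quotient ℤˣ (unitCotangentSphere n)

/-- The projection `ST*Sⁿ → ST*ℝPⁿ`. -/
def toUnitCotangentRP {n : ℕ} (x : unitCotangentSphere n) : UnitCotangentRP n := Quotient.mk _ x

/-! ### The Hopf fibration -/

/-- The unit sphere `S²ⁿ⁺¹` in `ℂⁿ⁺¹`. -/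
abbrev OddSphere (n : ℕ) := Metric.sphere (0 : EuclideanSpace ℂ (Fin (n + 1))) 1

instance (n : ℕ) : Fact (finrank ℝ (EuclideanSpace ℂ (Fin (n + 1))) = 2 * n + 1 + 1) :=
  ⟨by rw [finrank_real_of_complex, finrank_euclideanSpace_fin]; ring⟩

instance (n : ℕ) : MulAction Circle (OddSphere n) where
  smul g z := ⟨(g : ℂ) • (z : EuclideanSpace ℂ (Fin (n + 1))), by
    have hz := z.2
    simp only [mem_sphere_zero_iff_norm] at hz ⊢
    rw [norm_smul, Circle.norm_coe, one_mul, hz]⟩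
  one_smul z := Subtype.ext <| one_smul ℂ (z : EuclideanSpace ℂ (Fin (n + 1)))
  mul_smul g h z := Subtype.ext <| mul_smul (g : ℂ) (h : ℂ) (z : EuclideanSpace ℂ (Fin (n + 1)))

theorem coe_circle_smul {n : ℕ} (g : Circle) (z : OddSphere n) :
    ((g • z : OddSphere n) : EuclideanSpace ℂ (Fin (n + 1))) =
      (g : ℂ) • (z : EuclideanSpace ℂ (Fin (n + 1))) := rfl

/-- Complex projective space `ℂPⁿ = S²ⁿ⁺¹/S¹`. -/
abbrev CP (n : ℕ) := MulAction.orbitRel.Quotient Circle (OddSphere n)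

/-- The Hopf fibration `S²ⁿ⁺¹ → ℂPⁿ`. -/
def hopf {n : ℕ} (z : OddSphere n) : CP n := Quotient.mk _ z

theorem hopf_eq_iff {n : ℕ} {z w : OddSphere n} : hopf z = hopf w ↔ ∃ g : Circle, g • w = z := by
  rw [hopf, hopf, Quotient.eq]
  exact Iff.rfl

/-- The affine coordinates `(z_j / z_i)_{j ≠ i}`. -/
def affineCoord {n : ℕ} (i : Fin (n + 1)) (z : EuclideanSpace ℂ (Fin (n + 1))) :
    EuclideanSpace ℂ (Fin n) :=
  WithLp.toLp 2 fun j => z (i.succAbove j) / z i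

/-- The vector with `i`-th coordinate `1` and remaining coordinates `w`. -/
def affineVec {n : ℕ} (i : Fin (n + 1)) (w : EuclideanSpace ℂ (Fin n)) :
    EuclideanSpace ℂ (Fin (n + 1)) :=
  WithLp.toLp 2 (i.insertNth (1 : ℂ) (fun j => w j) : Fin (n + 1) → ℂ)

theorem affineVec_self {n : ℕ} (i : Fin (n + 1)) (w : EuclideanSpace ℂ (Fin n)) :
    affineVec i w i = 1 := by simp [affineVec]

theorem affineVec_succAbove {n : ℕ} (i : Fin (n + 1)) (w : EuclideanSpace ℂ (Fin n)) (j : Fin n) :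
    affineVec i w (i.succAbove j) = w j := by simp [affineVec]

theorem affineVec_ne {n : ℕ} (i : Fin (n + 1)) (w : EuclideanSpace ℂ (Fin n)) :
    affineVec i w ≠ 0 := fun h => by
  have := affineVec_self i w
  rw [h] at this
  simp at this

/-- The point of the sphere on the line with affine coordinates `w`. -/
def affinePoint {n : ℕ} (i : Fin (n + 1)) (w : EuclideanSpace ℂ (Fin n)) : OddSphere n :=
  ⟨((‖affineVec i w‖⁻¹ : ℝ) : ℂ) • affineVec i w, by
    have := norm_ne_zero_iff.2 (affineVec_ne i w)
    simp [norm_smul, this]⟩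

theorem affineCoord_smul {n : ℕ} (i : Fin (n + 1)) (c : ℂ) (hc : c ≠ 0)
    (z : EuclideanSpace ℂ (Fin (n + 1))) : affineCoord i (c • z) = affineCoord i z := by
  ext j
  simp [affineCoord, mul_div_mul_left _ _ hc]

theorem affineCoord_vec {n : ℕ} (i : Fin (n + 1)) (w : EuclideanSpace ℂ (Fin n)) :
    affineCoord i (affineVec i w) = w := by
  ext j
  simp [affineCoord, affineVec]

theorem affineVec_coord {n : ℕ} (i : Fin (n + 1)) (z : EuclideanSpace ℂ (Fin (n + 1)))
    (hz : z i ≠ 0) : affineVec i (affineCoord i z) = (z i)⁻¹ • z := by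
  ext k
  rcases Fin.eq_self_or_eq_succAbove i k with rfl | ⟨j, rfl⟩
  · rw [affineVec_self]
    simp [hz]
  · rw [affineVec_succAbove]
    simp [affineCoord, div_eq_inv_mul]

theorem hopf_affinePoint {n : ℕ} (i : Fin (n + 1)) (z : OddSphere n)
    (hz : (z : EuclideanSpace ℂ (Fin (n + 1))) i ≠ 0) :
    hopf (affinePoint i (affineCoord i z)) = hopf z := by
  rw [hopf_eq_iff]
  have hz1 : ‖(z : EuclideanSpace ℂ (Fin (n + 1)))‖ = 1 := by simp
  have hn : ‖(z : EuclideanSpace ℂ (Fin (n + 1))) i‖ ≠ 0 := norm_ne_zero_iff.2 hz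
  obtain ⟨g, hg⟩ : ∃ g : Circle, (g : ℂ) = (‖z.1 i‖ : ℂ) * (z.1 i)⁻¹ :=
    ⟨⟨_, mem_sphere_zero_iff_norm.2 (by simp [hn])⟩, rfl⟩
  refine ⟨g, Subtype.ext ?_⟩
  rw [coe_circle_smul, hg]
  simp only [affinePoint]
  rw [affineVec_coord i _ hz, norm_smul, hz1, smul_smul]
  simp

theorem continuous_affineVec {n : ℕ} (i : Fin (n + 1)) :
    Continuous (affineVec (n := n) i) := by
  refine (PiLp.continuous_toLp 2 _).comp (continuous_pi fun k => ?_)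
  rcases Fin.eq_self_or_eq_succAbove i k with rfl | ⟨j, rfl⟩
  · simpa using continuous_const
  · simp only [Fin.insertNth_apply_succAbove]
    fun_prop

/-- The affine chart `{z_i ≠ 0} → ℂⁿ` of `ℂPⁿ`. -/
def affineChart {n : ℕ} (i : Fin (n + 1)) :
    OpenPartialHomeomorph (CP n) (EuclideanSpace ℂ (Fin n)) where
  toFun := Quotient.lift (fun z : OddSphere n => affineCoord i z) (by
    rintro _ z ⟨g, rfl⟩
    exact affineCoord_smul i _ g.coe_ne_zero _)
  invFun w := hopf (affinePoint i w)
  source := {x | Quotient.liftOn x (fun z : OddSphere n => z.1 i ≠ 0) (by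
    rintro _ z ⟨g, rfl⟩
    simp [coe_circle_smul, g.coe_ne_zero])}
  target := Set.univ
  map_source' _ _ := Set.mem_univ _
  map_target' w _ := by
    have := norm_ne_zero_iff.2 (affineVec_ne i w)
    change (affinePoint i w).1 i ≠ 0
    simp [affinePoint, affineVec_self, this]
  left_inv' x := by
    induction x using Quotient.inductionOn with
    | h z => exact fun hz => hopf_affinePoint i z hz
  right_inv' w _ := by
    have := norm_ne_zero_iff.2 (affineVec_ne i w)
    change affineCoord i (affinePoint i w).1 = w
    rw [affinePoint, affineCoord_smul _ _ (by simpa using this), affineCoord_vec]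
  open_source := by
    refine isOpen_coinduced.2 ?_
    change IsOpen {z : OddSphere n | z.1 i ≠ 0}
    exact isOpen_ne_fun (by fun_prop) continuous_const
  open_target := isOpen_univ
  continuousOn_toFun := by
    have ho : IsOpen {x : CP n | Quotient.liftOn x (fun z : OddSphere n => z.1 i ≠ 0) (by
        rintro _ z ⟨g, rfl⟩
        simp [coe_circle_smul, g.coe_ne_zero])} := by
      refine isOpen_coinduced.2 ?_
      change IsOpen {z : OddSphere n | z.1 i ≠ 0}
      exact isOpen_ne_fun (by fun_prop) continuous_const
    refine (isQuotientMap_quotient_mk'.continuousOn_isOpen_iff ho).2 ?_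
    change ContinuousOn (fun z : OddSphere n => affineCoord i z.1) {z | z.1 i ≠ 0}
    refine (PiLp.continuous_toLp 2 _).comp_continuousOn (continuousOn_pi.2 fun j => ?_)
    exact ContinuousOn.div (by fun_prop) (by fun_prop) fun z hz => hz
  continuousOn_invFun := by
    refine (continuous_quotient_mk'.comp (Continuous.subtype_mk ?_ _)).continuousOn
    have h := continuous_affineVec i
    exact (Complex.continuous_ofReal.comp (h.norm.inv₀ fun w =>
      norm_ne_zero_iff.2 (affineVec_ne i w))).smul h

theorem exists_affineChart {n : ℕ} (x : CP n) : ∃ i, x ∈ (affineChart i).source := by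
  induction x using Quotient.inductionOn with
  | h z =>
    by_contra! h
    have h0 : z.1 = 0 := by
      ext i
      by_contra h1
      exact h i h1
    have := z.2
    rw [h0] at this
    simp at this

/-- The standard manifold structure of `ℂPⁿ`, given by the affine charts. -/
instance (n : ℕ) : ChartedSpace (EuclideanSpace ℂ (Fin n)) (CP n) where
  atlas := Set.range affineChart
  chartAt x := affineChart (exists_affineChart x).choose
  mem_chart_source x := (exists_affineChart x).choose_spec
  chart_mem_atlas _ := ⟨_, rfl⟩

instance (n : ℕ) : IsManifold 𝓘(ℝ, EuclideanSpace ℂ (Fin n)) ∞ (CP n) := by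
  apply isManifold_of_contDiffOn
  rintro _ _ ⟨i, rfl⟩ ⟨j, rfl⟩
  have h : ContDiffOn ℝ ∞ (fun w : EuclideanSpace ℂ (Fin n) => affineCoord j (affineVec i w))
      {w | affineVec i w j ≠ 0} := by
    have hv : ∀ k, ContDiff ℝ ∞ (fun w : EuclideanSpace ℂ (Fin n) => affineVec i w k) := by
      intro k
      rcases Fin.eq_self_or_eq_succAbove i k with rfl | ⟨l, rfl⟩
      · simp only [affineVec_self]
        exact contDiff_const
      · simp only [affineVec_succAbove]
        exact ((EuclideanSpace.proj l : EuclideanSpace ℂ (Fin n) →L[ℂ] ℂ).restrictScalars ℝ).contDiff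
    refine (PiLp.contDiff_toLp (𝕜 := ℝ)).comp_contDiffOn (contDiffOn_pi.2 fun l => ?_)
    simp only [div_eq_mul_inv]
    exact (hv (j.succAbove l)).contDiffOn.mul ((hv j).contDiffOn.inv fun w hw => hw)
  refine (h.mono ?_).congr ?_
  · rintro w hw
    have hw1 : (affinePoint i w).1 j ≠ 0 := hw.1.2
    intro h0
    apply hw1
    simp [affinePoint, h0]
  · intro w hw
    change affineCoord j (affinePoint i w).1 = _
    rw [affinePoint, affineCoord_smul]
    simpa using affineVec_ne i w

/-! ### The left-handed stabilization as a contact open book -/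

/-- The auxiliary choices in the construction of the open book `OB(T*Sⁿ, τ⁻¹)`. Write
`t = log |p|` on the complement of the zero section of `T*Sⁿ`. The page is `{t < 1}`, its content
is `{t ≤ 0}` and its margin is `{0 ≤ t < 1}`. -/
structure OpenBookData where
  /-- the twisting profile of the right-handed Dehn twist `τ`, as a function of `t` -/
  f : ℝ → ℝ
  f_smooth : ContDiff ℝ ∞ f
  f_antitone : Antitone f
  f_content : ∃ ε > 0, ∀ t ≤ ε, f t = Real.pi
  /-- the width of the collar of the boundary of the page in which `τ` is the identity -/
  δ : ℝ
  δ_pos : 0 < δ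
  f_collar : ∀ t, 1 - δ ≤ t → f t = 0
  /-- the constant of integration in the function `U` -/
  C : ℝ
  C_pos : 0 < C
  /-- the radius of the disk factor in the neighbourhood of the binding -/
  r₀ : ℝ
  r₀_pos : 0 < r₀
  /-- the function `h₁(r) = h (r²)` in the contact form `h₁ λ_P + h₂ dφ` near the binding -/
  h : ℝ → ℝ
  /-- the function `k` with `h₂(r) = r² k (r²)` in the contact form near the binding -/
  k : ℝ → ℝ
  h_smooth : ContDiff ℝ ∞ h
  k_smooth : ContDiff ℝ ∞ k
  h_pos : ∀ s, 0 ≤ s → s < (r₀ + δ) ^ 2 → 0 < h s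
  /-- the contact condition `h₁ h₂' - h₂ h₁' > 0`, written in the variable `s = r²` -/
  contact : ∀ s, 0 ≤ s → s < (r₀ + δ) ^ 2 →
    0 < h s * deriv (fun s => s * k s) s - s * k s * deriv h s
  /-- compatibility with the form `dφ + λ` on the mapping torus, via `t = 1 + r₀ - r` -/
  h_glue : ∀ r, r₀ < r → r < r₀ + δ → h (r ^ 2) = Real.exp (1 + r₀ - r)
  k_glue : ∀ r, r₀ < r → r < r₀ + δ →
    r ^ 2 * k (r ^ 2) = (C - ∫ s in (0 : ℝ)..1, deriv f s * Real.exp s) / (2 * Real.pi)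

namespace OpenBookData

/-- The positive function `U` with `τ^* λ = λ - dU`, as a function of `t = log |p|`. -/
def U (D : OpenBookData) (t : ℝ) : ℝ := D.C - ∫ s in (0 : ℝ)..t, deriv D.f s * Real.exp s

variable (D : OpenBookData)

theorem deriv_f_of_le {t : ℝ} (ht : t ≤ 0) : deriv D.f t = 0 := by
  obtain ⟨ε, hε, h⟩ := D.f_content
  have : D.f =ᶠ[𝓝 t] fun _ => Real.pi := by
    filter_upwards [Iio_mem_nhds (show t < ε by linarith)] with s hs using h s hs.le
  rw [this.deriv_eq, deriv_const]

theorem f_of_le {t : ℝ} (ht : t ≤ 0) : D.f t = Real.pi := by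
  obtain ⟨ε, hε, h⟩ := D.f_content
  exact h t (by linarith)

theorem continuous_integrand : Continuous fun s => deriv D.f s * Real.exp s :=
  (D.f_smooth.continuous_deriv (by simp)).mul Real.continuous_exp

theorem U_of_le {t : ℝ} (ht : t ≤ 0) : D.U t = D.C := by
  have h : ∫ s in (0 : ℝ)..t, deriv D.f s * Real.exp s = ∫ s in (0 : ℝ)..t, (0 : ℝ) := by
    refine intervalIntegral.integral_congr fun s hs => ?_
    rw [Set.uIcc_of_ge ht] at hs
    simp [D.deriv_f_of_le hs.2]
  simp [U, h]

theorem C_le_U (t : ℝ) : D.C ≤ D.U t := by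
  rcases le_total t 0 with ht | ht
  · exact (D.U_of_le ht).ge
  · have h : 0 ≤ ∫ s in (0 : ℝ)..t, -(deriv D.f s * Real.exp s) :=
      intervalIntegral.integral_nonneg ht fun s _ => by
        have := D.f_antitone.deriv_nonpos (x := s)
        nlinarith [Real.exp_pos s]
    rw [intervalIntegral.integral_neg] at h
    simp only [U]
    linarith

theorem U_pos (t : ℝ) : 0 < D.U t := D.C_pos.trans_le (D.C_le_U t)

theorem U_collar {t : ℝ} (ht : 1 - D.δ ≤ t) : D.U t = D.U 1 := by
  have hz : ∀ s, 1 - D.δ < s → deriv D.f s = 0 := by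
    intro s hs
    have : D.f =ᶠ[𝓝 s] fun _ => 0 := by
      filter_upwards [Ioi_mem_nhds hs] with u hu using D.f_collar u hu.le
    rw [this.deriv_eq, deriv_const]
  have hi : ∀ a b : ℝ, IntervalIntegrable (fun s => deriv D.f s * Real.exp s) MeasureTheory.volume a b :=
    fun a b => D.continuous_integrand.intervalIntegrable a b
  have h : ∫ s in t..1, deriv D.f s * Real.exp s = ∫ s in t..1, (0 : ℝ) := by
    refine intervalIntegral.integral_congr_ae (Filter.Eventually.of_forall fun s hs => ?_)
    have : min t 1 < s := hs.1
    have h1 : 1 - D.δ ≤ min t 1 := le_min ht (by linarith [D.δ_pos])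
    simp [hz s (h1.trans_lt this)]
  have h2 := intervalIntegral.integral_add_adjacent_intervals (hi 0 t) (hi t 1)
  rw [h] at h2
  simp only [U]
  simp at h2
  linarith

theorem continuous_U : Continuous D.U :=
  continuous_const.sub (intervalIntegral.continuous_primitive
    (fun a b => D.continuous_integrand.intervalIntegrable a b) 0)

end OpenBookData

/-- The normalized geodesic flow of the round sphere at time `s`, on `T*Sⁿ ⊆ ℝⁿ⁺¹ × ℝⁿ⁺¹`. On
`ST*Sⁿ` this is the Reeb flow of the canonical contact form. -/
def geodesicFlow {n : ℕ} (s : ℝ) (x : Euc n × Euc n) : Euc n × Euc n :=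
  (Real.cos s • x.1 + (Real.sin s / ‖x.2‖) • x.2, Real.cos s • x.2 - (Real.sin s * ‖x.2‖) • x.1)

/-- `P × D²`, with `P = ST*Sⁿ` and `D²` the open disk of radius `r₀ + δ`; its points are
`((q, p), z)`. -/
def bindingPiece (D : OpenBookData) (n : ℕ) : Set ((Euc n × Euc n) × ℂ) :=
  {x | x.1 ∈ unitCotangentSphere n ∧ ‖x.2‖ < D.r₀ + D.δ}

/-- `W × ℝ`, with `W = {(q, p) ∈ T*Sⁿ : |p| < e}`; its points are `((q, p), φ)`. -/
def pagePiece (n : ℕ) : Set ((Euc n × Euc n) × ℝ) :=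
  {x | ‖x.1.1‖ = 1 ∧ ⟪x.1.1, x.1.2⟫_ℝ = 0 ∧ ‖x.1.2‖ < Real.exp 1}

theorem bindingPiece_regular (D : OpenBookData) (n : ℕ) :
    IsRegularLevel (bindingPiece D n) {x | ‖x.2‖ < D.r₀ + D.δ}
      (fun x : (Euc n × Euc n) × ℂ =>
        (⟪x.1.1, x.1.1⟫_ℝ - 1, ⟪x.1.2, x.1.2⟫_ℝ - 1, ⟪x.1.1, x.1.2⟫_ℝ))
      (2 * n + 1) := by
  have hs : ∀ x ∈ bindingPiece D n, Function.Surjective (fderiv ℝ (fun x : (Euc n × Euc n) × ℂ =>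
      (⟪x.1.1, x.1.1⟫_ℝ - 1, ⟪x.1.2, x.1.2⟫_ℝ - 1, ⟪x.1.1, x.1.2⟫_ℝ)) x) := fun x hx =>
    stiefel_surj ((ContinuousLinearMap.fst ℝ (Euc n) (Euc n)).comp (ContinuousLinearMap.fst ℝ _ ℂ))
      ((ContinuousLinearMap.snd ℝ (Euc n) (Euc n)).comp (ContinuousLinearMap.fst ℝ _ ℂ))
      (fun v => ⟨(v, 0), rfl⟩) x hx.1.1 hx.1.2.1 hx.1.2.2
  have h1 : ContDiff ℝ ∞ fun x : (Euc n × Euc n) × ℂ => x.1.1 := contDiff_fst.fst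
  have h2 : ContDiff ℝ ∞ fun x : (Euc n × Euc n) × ℂ => x.1.2 := contDiff_fst.snd
  refine ⟨isOpen_lt (by fun_prop) continuous_const, ?_, ?_, hs, ?_⟩
  · intro x
    simp only [bindingPiece, unitCotangentSphere, Set.mem_ofPred_eq, Prod.mk_eq_zero,
      inner_self_sub_one]
    tauto
  · exact ((h1.inner ℝ h1).sub contDiff_const).prodMk
      (((h2.inner ℝ h2).sub contDiff_const).prodMk (h1.inner ℝ h2))
  · intro x hx
    simp [finrank_prod]
    omega

theorem pagePiece_regular (n : ℕ) :
    IsRegularLevel (pagePiece n) {x | ‖x.1.2‖ < Real.exp 1}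
      (fun x : (Euc n × Euc n) × ℝ => (⟪x.1.1, x.1.1⟫_ℝ - 1, ⟪x.1.1, x.1.2⟫_ℝ))
      (2 * n + 1) := by
  have hs : ∀ x ∈ pagePiece n, Function.Surjective (fderiv ℝ (fun x : (Euc n × Euc n) × ℝ =>
      (⟪x.1.1, x.1.1⟫_ℝ - 1, ⟪x.1.1, x.1.2⟫_ℝ)) x) := fun x hx =>
    cotangent_surj ((ContinuousLinearMap.fst ℝ (Euc n) (Euc n)).comp (ContinuousLinearMap.fst ℝ _ ℝ))
      ((ContinuousLinearMap.snd ℝ (Euc n) (Euc n)).comp (ContinuousLinearMap.fst ℝ _ ℝ))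
      (fun v => ⟨(v, 0), rfl⟩) x hx.1 hx.2.1
  have h1 : ContDiff ℝ ∞ fun x : (Euc n × Euc n) × ℝ => x.1.1 := contDiff_fst.fst
  have h2 : ContDiff ℝ ∞ fun x : (Euc n × Euc n) × ℝ => x.1.2 := contDiff_fst.snd
  refine ⟨isOpen_lt (by fun_prop) continuous_const, ?_, ?_, hs, ?_⟩
  · intro x
    simp only [pagePiece, Set.mem_ofPred_eq, Prod.mk_eq_zero, inner_self_sub_one]
    tauto
  · exact ((h1.inner ℝ h1).sub contDiff_const).prodMk (h1.inner ℝ h2)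
  · intro x hx
    simp [finrank_prod]
    omega

instance (D : OpenBookData) (n : ℕ) :
    ChartedSpace (EuclideanSpace ℝ (Fin (2 * n + 1))) (bindingPiece D n) :=
  levelChartedSpace (bindingPiece_regular D n)

instance (D : OpenBookData) (n : ℕ) : IsManifold (𝓡 (2 * n + 1)) ∞ (bindingPiece D n) :=
  levelIsManifold (bindingPiece_regular D n)

instance (n : ℕ) : ChartedSpace (EuclideanSpace ℝ (Fin (2 * n + 1))) (pagePiece n) :=
  levelChartedSpace (pagePiece_regular n)

instance (n : ℕ) : IsManifold (𝓡 (2 * n + 1)) ∞ (pagePiece n) :=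
  levelIsManifold (pagePiece_regular n)

section Flow
variable {n : ℕ}

theorem norm_eq_of_sq {x : Euc n} {c : ℝ} (hc : 0 ≤ c) (h : ⟪x, x⟫_ℝ = c ^ 2) : ‖x‖ = c := by
  rw [real_inner_self_eq_norm_sq] at h
  exact (pow_left_inj₀ (norm_nonneg _) hc two_ne_zero).1 h

theorem norm_geodesicFlow_snd (s : ℝ) {x : Euc n × Euc n} (h1 : ‖x.1‖ = 1)
    (h2 : ⟪x.1, x.2⟫_ℝ = 0) : ‖(geodesicFlow s x).2‖ = ‖x.2‖ := by
  apply norm_eq_of_sq (norm_nonneg _)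
  have h2' : ⟪x.2, x.1⟫_ℝ = 0 := by rw [real_inner_comm]; exact h2
  simp only [geodesicFlow, inner_sub_left, inner_sub_right, inner_smul_left, inner_smul_right,
    real_inner_self_eq_norm_sq, h1, h2, h2']
  simp
  linear_combination ‖x.2‖ ^ 2 * Real.sin_sq_add_cos_sq s

theorem inner_geodesicFlow (s : ℝ) {x : Euc n × Euc n} (h1 : ‖x.1‖ = 1)
    (h2 : ⟪x.1, x.2⟫_ℝ = 0) : ⟪(geodesicFlow s x).1, (geodesicFlow s x).2⟫_ℝ = 0 := by
  have h2' : ⟪x.2, x.1⟫_ℝ = 0 := by rw [real_inner_comm]; exact h2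
  simp only [geodesicFlow, inner_sub_right, inner_add_left, inner_smul_left, inner_smul_right,
    real_inner_self_eq_norm_sq, h1, h2, h2']
  rcases eq_or_ne ‖x.2‖ 0 with h | h
  · simp [h]
  · simp
    field_simp
    ring

/-- The flow preserves `T*Sⁿ` at `x` if `x` is not in the zero section or if `sin s = 0`. -/
theorem norm_geodesicFlow_fst (s : ℝ) {x : Euc n × Euc n} (h1 : ‖x.1‖ = 1)
    (h2 : ⟪x.1, x.2⟫_ℝ = 0) (h : x.2 ≠ 0 ∨ Real.sin s = 0) : ‖(geodesicFlow s x).1‖ = 1 := by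
  apply norm_eq_of_sq zero_le_one
  have h2' : ⟪x.2, x.1⟫_ℝ = 0 := by rw [real_inner_comm]; exact h2
  simp only [geodesicFlow, inner_add_right, inner_add_left, inner_smul_left, inner_smul_right,
    real_inner_self_eq_norm_sq, h1, h2, h2']
  have := Real.sin_sq_add_cos_sq s
  rcases h with h | h
  · have h := norm_ne_zero_iff.2 h
    simp
    field_simp
    linarith
  · rw [h] at this ⊢
    simp
    nlinarith

theorem geodesicFlow_add (s t : ℝ) {x : Euc n × Euc n} (h1 : ‖x.1‖ = 1)
    (h2 : ⟪x.1, x.2⟫_ℝ = 0) (h : x.2 ≠ 0 ∨ Real.sin s = 0 ∧ Real.sin t = 0) :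
    geodesicFlow s (geodesicFlow t x) = geodesicFlow (s + t) x := by
  have hn := norm_geodesicFlow_snd t h1 h2
  have hc := Real.cos_add s t
  have hs := Real.sin_add s t
  rcases h with h | ⟨h, h'⟩
  · have h0 := norm_ne_zero_iff.2 h
    apply Prod.ext
    · change Real.cos s • (geodesicFlow t x).1 +
        (Real.sin s / ‖(geodesicFlow t x).2‖) • (geodesicFlow t x).2 = _
      rw [hn]
      simp only [geodesicFlow, hc, hs]
      match_scalars <;> field_simp <;> ring
    · change Real.cos s • (geodesicFlow t x).2 -
        (Real.sin s * ‖(geodesicFlow t x).2‖) • (geodesicFlow t x).1 = _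
      rw [hn]
      simp only [geodesicFlow, hc, hs]
      match_scalars <;> field_simp <;> ring
  · simp [geodesicFlow, hc, hs, h, h', smul_smul]

theorem geodesicFlow_zero (x : Euc n × Euc n) : geodesicFlow 0 x = x := by
  simp [geodesicFlow]

end Flow

namespace OpenBookData
variable (D : OpenBookData) {n : ℕ}

theorem ne_zero_or_sin (k : ℤ) (x : Euc n × Euc n) :
    x.2 ≠ 0 ∨ Real.sin (k * D.f (Real.log ‖x.2‖)) = 0 := by
  by_cases h : x.2 = 0
  · right
    rw [h, norm_zero, Real.log_zero, D.f_of_le le_rfl, Real.sin_int_mul_pi]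
  · exact Or.inl h

/-- The right-handed Dehn twist `τ`: the normalized geodesic flow at time `f (log |p|)`, extended
over the zero section by the antipodal map (there `log 0 = 0` and `f 0 = π`). -/
def twist (x : Euc n × Euc n) : Euc n × Euc n := geodesicFlow (D.f (Real.log ‖x.2‖)) x

/-- The `k`-th power of the transformation `(x, φ) ↦ (τ x, φ + U x)` of `W × ℝ`, whose orbit space
is the mapping torus. -/
def deck (k : ℤ) (m : pagePiece n) : pagePiece n :=
  ⟨(geodesicFlow (k * D.f (Real.log ‖m.1.1.2‖)) m.1.1, m.1.2 + k * D.U (Real.log ‖m.1.1.2‖)),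
    norm_geodesicFlow_fst _ m.2.1 m.2.2.1 (D.ne_zero_or_sin k _),
    inner_geodesicFlow _ m.2.1 m.2.2.1, by
      change ‖(geodesicFlow _ m.1.1).2‖ < _
      rw [norm_geodesicFlow_snd _ m.2.1 m.2.2.1]
      exact m.2.2.2⟩

theorem deck_zero (m : pagePiece n) : D.deck 0 m = m :=
  Subtype.ext <| Prod.ext (by simp [deck, geodesicFlow_zero]) (by simp [deck])

theorem deck_add (k l : ℤ) (m : pagePiece n) : D.deck k (D.deck l m) = D.deck (k + l) m := by
  have hn : ‖(D.deck l m).1.1.2‖ = ‖m.1.1.2‖ := norm_geodesicFlow_snd _ m.2.1 m.2.2.1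
  apply Subtype.ext
  apply Prod.ext
  · change geodesicFlow (k * D.f (Real.log ‖(D.deck l m).1.1.2‖)) (D.deck l m).1.1 = _
    rw [hn]
    change geodesicFlow _ (geodesicFlow _ m.1.1) = geodesicFlow _ m.1.1
    rw [geodesicFlow_add _ _ m.2.1 m.2.2.1]
    · push_cast
      rw [add_mul]
    · have hk := D.ne_zero_or_sin k m.1.1
      have hl := D.ne_zero_or_sin l m.1.1
      tauto
  · change m.1.2 + l * D.U (Real.log ‖m.1.1.2‖) + k * D.U (Real.log ‖(D.deck l m).1.1.2‖) =
      m.1.2 + ((k + l : ℤ) : ℝ) * D.U (Real.log ‖m.1.1.2‖)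
    rw [hn]
    push_cast
    ring

theorem deck_one (m : pagePiece n) :
    (D.deck 1 m).1 = (D.twist m.1.1, m.1.2 + D.U (Real.log ‖m.1.1.2‖)) := by
  simp [deck, twist]

end OpenBookData

namespace OpenBookData
variable (D : OpenBookData) {n : ℕ}

/-- The gluing map `(p, r e^{iθ}) ↦ (e^{1 + r₀ - r} p, U_c θ / 2π)` from the part `r₀ < r < r₀ + δ`
of `P × D²` to the collar of the mapping torus, as a relation. Here `U_c` is the value of `U` at the
boundary of the page. -/
def Glue (b : bindingPiece D n) (m : pagePiece n) : Prop :=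
  D.r₀ < ‖b.1.2‖ ∧ m.1.1 = (b.1.1.1, Real.exp (1 + D.r₀ - ‖b.1.2‖) • b.1.1.2) ∧
    b.1.2 = ‖b.1.2‖ * Complex.exp (((2 * Real.pi * m.1.2 / D.U 1 : ℝ) : ℂ) * Complex.I)

theorem Glue.log_norm {D : OpenBookData} {b : bindingPiece D n} {m : pagePiece n}
    (h : D.Glue b m) : Real.log ‖m.1.1.2‖ = 1 + D.r₀ - ‖b.1.2‖ := by
  rw [h.2.1]
  change Real.log ‖Real.exp (1 + D.r₀ - ‖b.1.2‖) • b.1.1.2‖ = _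
  rw [norm_smul, b.2.1.2.1, mul_one, Real.norm_of_nonneg (Real.exp_pos _).le, Real.log_exp]

theorem Glue.collar {D : OpenBookData} {b : bindingPiece D n} {m : pagePiece n}
    (h : D.Glue b m) : 1 - D.δ ≤ Real.log ‖m.1.1.2‖ := by
  rw [h.log_norm]
  linarith [b.2.2]

theorem Glue.left_unique {D : OpenBookData} {b b' : bindingPiece D n} {m : pagePiece n}
    (h : D.Glue b m) (h' : D.Glue b' m) : b = b' := by
  have hr : ‖b.1.2‖ = ‖b'.1.2‖ := by linarith [h.log_norm, h'.log_norm]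
  have h1 := h.2.1.symm.trans h'.2.1
  rw [hr, Prod.mk.injEq] at h1
  refine Subtype.ext (Prod.ext (Prod.ext h1.1 ?_) ?_)
  · exact smul_right_injective _ (Real.exp_pos _).ne' h1.2
  · rw [h.2.2, h'.2.2, hr]

theorem deck_collar {D : OpenBookData} (k : ℤ) {m : pagePiece n}
    (h : 1 - D.δ ≤ Real.log ‖m.1.1.2‖) : (D.deck k m).1 = (m.1.1, m.1.2 + k * D.U 1) := by
  simp [deck, D.f_collar _ h, D.U_collar h, geodesicFlow_zero]

theorem Glue.deck {D : OpenBookData} {b : bindingPiece D n} {m : pagePiece n}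
    (h : D.Glue b m) (k : ℤ) : D.Glue b (D.deck k m) := by
  refine ⟨h.1, ?_, ?_⟩
  · rw [deck_collar k h.collar]
    exact h.2.1
  · rw [deck_collar k h.collar]
    have hU := (D.U_pos 1).ne'
    have : 2 * Real.pi * (m.1.2 + k * D.U 1) / D.U 1 =
        2 * Real.pi * m.1.2 / D.U 1 + k * (2 * Real.pi) := by
      field_simp
    rw [this]
    have h3 : (((2 * Real.pi * m.1.2 / D.U 1 + k * (2 * Real.pi) : ℝ) : ℂ) * Complex.I) =
        ((2 * Real.pi * m.1.2 / D.U 1 : ℝ) : ℂ) * Complex.I + k * (2 * Real.pi * Complex.I) := by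
      push_cast
      ring
    rw [h3, Complex.exp_add, Complex.exp_int_mul_two_pi_mul_I, mul_one]
    exact h.2.2

theorem Glue.right_unique {D : OpenBookData} {b : bindingPiece D n} {m m' : pagePiece n}
    (h : D.Glue b m) (h' : D.Glue b m') : ∃ k : ℤ, D.deck k m = m' := by
  have hb : (‖b.1.2‖ : ℂ) ≠ 0 := by
    have := D.r₀_pos.trans h.1
    exact_mod_cast this.ne'
  have h1 := mul_left_cancel₀ hb (h'.2.2.symm.trans h.2.2)
  obtain ⟨k, hk⟩ := Complex.exp_eq_exp_iff_exists_int.1 h1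
  refine ⟨k, Subtype.ext ?_⟩
  rw [deck_collar k h.collar]
  refine Prod.ext (h.2.1.trans h'.2.1.symm) ?_
  have h2 : ((2 * Real.pi * m'.1.2 / D.U 1 : ℝ) : ℂ) =
      ((2 * Real.pi * m.1.2 / D.U 1 + k * (2 * Real.pi) : ℝ) : ℂ) := by
    apply mul_right_cancel₀ Complex.I_ne_zero
    rw [hk]
    push_cast
    ring
  have h3 : 2 * Real.pi * m'.1.2 / D.U 1 = 2 * Real.pi * m.1.2 / D.U 1 + k * (2 * Real.pi) := by
    exact_mod_cast h2
  have hU := (D.U_pos 1).ne'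
  field_simp at h3
  change m.1.2 + k * D.U 1 = m'.1.2
  linarith

/-- The disjoint union of the pieces `P × D²` and `W × ℝ`. -/
abbrev Pieces (n : ℕ) := bindingPiece D n ⊕ pagePiece n

/-- The identifications defining the open book: points of `W × ℝ` are identified along the
transformation `(x, φ) ↦ (τ x, φ + U x)`, and `P × D²` is glued to the resulting mapping torus. -/
def Rel : D.Pieces n → D.Pieces n → Prop
  | .inl b, .inl b' => b = b'
  | .inl b, .inr m => D.Glue b m
  | .inr m, .inl b => D.Glue b m
  | .inr m, .inr m' => ∃ k : ℤ, D.deck k m = m'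

theorem rel_refl : ∀ x : D.Pieces n, D.Rel x x
  | .inl _ => rfl
  | .inr m => ⟨0, D.deck_zero m⟩

theorem rel_symm : ∀ {x y : D.Pieces n}, D.Rel x y → D.Rel y x
  | .inl _, .inl _, h => Eq.symm h
  | .inl _, .inr _, h => h
  | .inr _, .inl _, h => h
  | .inr m, .inr _, ⟨k, hk⟩ => ⟨-k, by rw [← hk, D.deck_add, neg_add_cancel, D.deck_zero]⟩

theorem rel_trans : ∀ {x y z : D.Pieces n}, D.Rel x y → D.Rel y z → D.Rel x z
  | .inl _, .inl _, .inl _, h, h' => Eq.trans h h'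
  | .inl _, .inl _, .inr _, h, h' => by
    obtain rfl : _ = _ := h
    exact h'
  | .inl _, .inr _, .inl _, h, h' => Glue.left_unique h h'
  | .inl _, .inr _, .inr _, h, ⟨k, hk⟩ => by
    subst hk
    exact Glue.deck h k
  | .inr _, .inl _, .inl _, h, h' => by
    obtain rfl : _ = _ := h'
    exact h
  | .inr _, .inl _, .inr _, h, h' => Glue.right_unique h h'
  | .inr _, .inr _, .inl _, ⟨k, hk⟩, h => by
    have h2 := Glue.deck h (-k)
    rw [← hk, D.deck_add, neg_add_cancel, D.deck_zero] at h2
    exact h2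
  | .inr _, .inr _, .inr _, ⟨k, hk⟩, ⟨l, hl⟩ => ⟨l + k, by rw [← D.deck_add, hk, hl]⟩

/-- The equivalence relation defining the open book. -/
def setoid (n : ℕ) : Setoid (D.Pieces n) :=
  ⟨D.Rel, D.rel_refl, D.rel_symm, D.rel_trans⟩

/-- The manifold `OB(T*Sⁿ, τ⁻¹)`. -/
def OB (n : ℕ) : Type := Quotient (D.setoid n)

instance (n : ℕ) : TopologicalSpace (D.OB n) :=
  inferInstanceAs (TopologicalSpace (Quotient (D.setoid n)))

/-- The quotient map from the pieces to the open book. -/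
def proj (x : D.Pieces n) : D.OB n := Quotient.mk (D.setoid n) x

theorem proj_eq_iff {x y : D.Pieces n} : D.proj x = D.proj y ↔ D.Rel x y :=
  Quotient.eq (r := D.setoid n)

theorem continuous_comp_log {g : ℝ → ℝ} (hg : Continuous g) {c : ℝ} (hc : ∀ t ≤ 0, g t = c) :
    Continuous fun p : Euc n => g (Real.log ‖p‖) := by
  rw [continuous_iff_continuousAt]
  intro p
  rcases eq_or_ne p 0 with rfl | hp
  · refine (continuousAt_const (y := c)).congr ?_
    filter_upwards [Metric.ball_mem_nhds (0 : Euc n) one_pos] with p hp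
    rw [mem_ball_zero_iff] at hp
    exact (hc _ (Real.log_nonpos (norm_nonneg _) hp.le)).symm
  · exact hg.continuousAt.comp (continuousAt_id.norm.log (norm_ne_zero_iff.2 hp))

theorem continuous_deck (k : ℤ) : Continuous (D.deck (n := n) k) := by
  have hf : Continuous fun p : Euc n => D.f (Real.log ‖p‖) :=
    continuous_comp_log D.f_smooth.continuous fun t ht => D.f_of_le ht
  have hU : Continuous fun p : Euc n => D.U (Real.log ‖p‖) :=
    continuous_comp_log D.continuous_U fun t ht => D.U_of_le ht
  have hs : Continuous fun p : Euc n => (Real.sin (k * D.f (Real.log ‖p‖)) / ‖p‖) • p := by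
    rw [continuous_iff_continuousAt]
    intro p
    rcases eq_or_ne p 0 with rfl | hp
    · refine (continuousAt_const (y := (0 : Euc n))).congr ?_
      filter_upwards [Metric.ball_mem_nhds (0 : Euc n) one_pos] with p hp
      rw [mem_ball_zero_iff] at hp
      rw [D.f_of_le (Real.log_nonpos (norm_nonneg _) hp.le), Real.sin_int_mul_pi]
      simp
    · exact ((Real.continuous_sin.comp (continuous_const.mul hf)).continuousAt.div
        continuous_norm.continuousAt (norm_ne_zero_iff.2 hp)).smul continuousAt_id
  have hp : Continuous fun m : pagePiece n => m.1.1.2 := by fun_prop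
  have hf' := hf.comp hp
  have hU' := hU.comp hp
  have hs' := hs.comp hp
  simp only [Function.comp_def] at hf' hU' hs'
  refine Continuous.subtype_mk (Continuous.prodMk (Continuous.prodMk ?_ ?_) ?_) _
  · exact Continuous.add (by fun_prop) hs'
  · fun_prop
  · fun_prop

/-- If `x ~ y`, then every point near `x` is equivalent to a point near `y`. -/
theorem rel_lift {x y : D.Pieces n} (h : D.Rel x y) {S : Set (D.Pieces n)} (hS : S ∈ 𝓝 y) :
    ∀ᶠ x' in 𝓝 x, ∃ y' ∈ S, D.Rel x' y' := by
  rcases x with b | m <;> rcases y with b' | m'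
  · obtain rfl : b = b' := h
    filter_upwards [hS] with x' hx' using ⟨x', hx', D.rel_refl x'⟩
  · -- the inverse of the collar coordinates, with a local choice of the angle
    have hG : D.Glue b m' := h
    rw [nhds_inr, Filter.mem_map, nhds_subtype, Filter.mem_comap] at hS
    obtain ⟨T, hT, hTS⟩ := hS
    rw [nhds_inl, Filter.eventually_map]
    have hz : b.1.2 ≠ 0 := norm_pos_iff.1 (D.r₀_pos.trans hG.1)
    let g : bindingPiece D n → (Euc n × Euc n) × ℝ := fun c =>
      ((c.1.1.1, Real.exp (1 + D.r₀ - ‖c.1.2‖) • c.1.1.2),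
        m'.1.2 + D.U 1 / (2 * Real.pi) * Complex.arg (c.1.2 / b.1.2))
    have hgb : g b = m'.1 := by
      refine Prod.ext hG.2.1.symm ?_
      simp [g, div_self hz]
    have hgc : ContinuousAt g b := by
      have h1 : ContinuousAt (fun c : bindingPiece D n => Complex.arg (c.1.2 / b.1.2)) b := by
        refine ContinuousAt.comp (g := Complex.arg) (f := fun c : bindingPiece D n => c.1.2 / b.1.2)
          ?_ (by fun_prop)
        refine Complex.continuousAt_arg ?_
        simp [div_self hz]
      refine ContinuousAt.prodMk (by fun_prop) (by fun_prop)
    have hT' : ∀ᶠ c in 𝓝 b, g c ∈ T := hgc.eventually_mem (by rw [hgb]; exact hT)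
    have hr : ∀ᶠ c : bindingPiece D n in 𝓝 b, D.r₀ < ‖c.1.2‖ :=
      (continuous_subtype_val.snd.norm.continuousAt (x := b)).eventually_const_lt hG.1
    filter_upwards [hT', hr] with c hc hcr
    have hmem : g c ∈ pagePiece n := by
      refine ⟨c.2.1.1, ?_, ?_⟩
      · change ⟪c.1.1.1, Real.exp (1 + D.r₀ - ‖c.1.2‖) • c.1.1.2⟫_ℝ = 0
        rw [inner_smul_right, c.2.1.2.2, mul_zero]
      · change ‖Real.exp (1 + D.r₀ - ‖c.1.2‖) • c.1.1.2‖ < _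
        rw [norm_smul, c.2.1.2.1, mul_one, Real.norm_of_nonneg (Real.exp_pos _).le]
        exact Real.exp_lt_exp.2 (by linarith)
    refine ⟨.inr ⟨g c, hmem⟩, hTS hc, hcr, rfl, ?_⟩
    have hcz : c.1.2 ≠ 0 := norm_pos_iff.1 (D.r₀_pos.trans hcr)
    have hU := (D.U_pos 1).ne'
    have e1 : (((2 * Real.pi * (g c).2 / D.U 1 : ℝ) : ℂ) * Complex.I) =
        ((2 * Real.pi * m'.1.2 / D.U 1 : ℝ) : ℂ) * Complex.I +
          (Complex.arg (c.1.2 / b.1.2) : ℂ) * Complex.I := by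
      have : 2 * Real.pi * (g c).2 / D.U 1 =
          2 * Real.pi * m'.1.2 / D.U 1 + Complex.arg (c.1.2 / b.1.2) := by
        simp only [g]
        field_simp
      rw [this]
      push_cast
      ring
    have e2 : Complex.exp (((2 * Real.pi * m'.1.2 / D.U 1 : ℝ) : ℂ) * Complex.I) =
        b.1.2 / ‖b.1.2‖ := by
      have hb : (‖b.1.2‖ : ℂ) ≠ 0 := by exact_mod_cast norm_ne_zero_iff.2 hz
      rw [eq_div_iff hb, mul_comm]
      exact hG.2.2.symm
    have e3 := Complex.norm_mul_exp_arg_mul_I (c.1.2 / b.1.2)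
    change c.1.2 = ‖c.1.2‖ * Complex.exp (((2 * Real.pi * (g c).2 / D.U 1 : ℝ) : ℂ) * Complex.I)
    rw [e1, Complex.exp_add, e2]
    rw [norm_div, Complex.ofReal_div] at e3
    have hb : (‖b.1.2‖ : ℂ) ≠ 0 := by exact_mod_cast norm_ne_zero_iff.2 hz
    field_simp at e3 ⊢
    exact e3.symm
  · -- collar coordinates
    have hG : D.Glue b' m := h
    rw [nhds_inl, Filter.mem_map, nhds_subtype, Filter.mem_comap] at hS
    obtain ⟨T, hT, hTS⟩ := hS
    rw [nhds_inr, Filter.eventually_map]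
    have hl := hG.log_norm
    have hp : ‖m.1.1.2‖ ≠ 0 := by
      rw [hG.2.1]
      change ‖Real.exp (1 + D.r₀ - ‖b'.1.2‖) • b'.1.1.2‖ ≠ 0
      rw [norm_smul, b'.2.1.2.1, mul_one]
      exact norm_ne_zero_iff.2 (Real.exp_pos _).ne'
    let g : pagePiece n → (Euc n × Euc n) × ℂ := fun c =>
      ((c.1.1.1, ‖c.1.1.2‖⁻¹ • c.1.1.2), ((1 + D.r₀ - Real.log ‖c.1.1.2‖ : ℝ) : ℂ) *
        Complex.exp (((2 * Real.pi * c.1.2 / D.U 1 : ℝ) : ℂ) * Complex.I))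
    have hgm : g m = b'.1 := by
      refine Prod.ext (Prod.ext ?_ ?_) ?_
      · change m.1.1.1 = _
        rw [hG.2.1]
      · change ‖m.1.1.2‖⁻¹ • m.1.1.2 = _
        rw [hG.2.1]
        change ‖Real.exp (1 + D.r₀ - ‖b'.1.2‖) • b'.1.1.2‖⁻¹ • Real.exp (1 + D.r₀ - ‖b'.1.2‖) • b'.1.1.2 = _
        rw [norm_smul, b'.2.1.2.1, mul_one, Real.norm_of_nonneg (Real.exp_pos _).le, smul_smul,
          inv_mul_cancel₀ (Real.exp_pos _).ne', one_smul]
      · change ((1 + D.r₀ - Real.log ‖m.1.1.2‖ : ℝ) : ℂ) * _ = _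
        rw [hl, hG.2.2]
        congr 2
        rw [← hG.2.2]
        ring
    have hlc : ContinuousAt (fun c : pagePiece n => Real.log ‖c.1.1.2‖) m :=
      ContinuousAt.log (by fun_prop) hp
    have hinv : ContinuousAt (fun c : pagePiece n => ‖c.1.1.2‖⁻¹) m :=
      ContinuousAt.inv₀ (f := fun c : pagePiece n => ‖c.1.1.2‖) (by fun_prop) hp
    have hgc : ContinuousAt g m := by
      refine ContinuousAt.prodMk (ContinuousAt.prodMk (by fun_prop)
        (hinv.smul (by fun_prop))) ?_
      refine ContinuousAt.mul (Complex.continuous_ofReal.continuousAt.comp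
        (continuousAt_const.sub hlc)) (by fun_prop)
    have hT' : ∀ᶠ c in 𝓝 m, g c ∈ T := hgc.eventually_mem (by rw [hgm]; exact hT)
    have h1 : ∀ᶠ c : pagePiece n in 𝓝 m, Real.log ‖c.1.1.2‖ < 1 :=
      hlc.eventually_lt_const (show Real.log ‖m.1.1.2‖ < 1 by rw [hl]; linarith [hG.1])
    have h2 : ∀ᶠ c : pagePiece n in 𝓝 m, 1 - D.δ < Real.log ‖c.1.1.2‖ :=
      hlc.eventually_const_lt (show _ < Real.log ‖m.1.1.2‖ by rw [hl]; linarith [b'.2.2])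
    have h3 : ∀ᶠ c : pagePiece n in 𝓝 m, ‖c.1.1.2‖ ≠ 0 :=
      ContinuousAt.eventually_ne (by fun_prop) hp
    filter_upwards [hT', h1, h2, h3] with c hc hc1 hc2 hc3
    have hnz : ‖(g c).2‖ = 1 + D.r₀ - Real.log ‖c.1.1.2‖ := by
      change ‖((1 + D.r₀ - Real.log ‖c.1.1.2‖ : ℝ) : ℂ) *
        Complex.exp (((2 * Real.pi * c.1.2 / D.U 1 : ℝ) : ℂ) * Complex.I)‖ = _
      rw [norm_mul, Complex.norm_exp_ofReal_mul_I, mul_one, Complex.norm_real,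
        Real.norm_of_nonneg (by linarith [D.r₀_pos])]
    have hmem : g c ∈ bindingPiece D n := by
      refine ⟨⟨c.2.1, ?_, ?_⟩, ?_⟩
      · change ‖‖c.1.1.2‖⁻¹ • c.1.1.2‖ = 1
        rw [norm_smul, norm_inv, norm_norm, inv_mul_cancel₀ hc3]
      · change ⟪c.1.1.1, ‖c.1.1.2‖⁻¹ • c.1.1.2⟫_ℝ = 0
        rw [inner_smul_right, c.2.2.1, mul_zero]
      · rw [hnz]
        linarith
    refine ⟨.inl ⟨g c, hmem⟩, hTS hc, ?_, ?_, ?_⟩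
    · change D.r₀ < ‖(g c).2‖
      rw [hnz]
      linarith
    · change c.1.1 = (c.1.1.1, Real.exp (1 + D.r₀ - ‖(g c).2‖) • ‖c.1.1.2‖⁻¹ • c.1.1.2)
      rw [hnz, sub_sub_cancel, Real.exp_log (lt_of_le_of_ne (norm_nonneg _) hc3.symm), smul_smul,
        mul_inv_cancel₀ hc3, one_smul]
    · change (g c).2 = ‖(g c).2‖ * _
      rw [hnz]
  · obtain ⟨k, rfl⟩ := h
    rw [nhds_inr, Filter.mem_map] at hS
    rw [nhds_inr, Filter.eventually_map]
    filter_upwards [(D.continuous_deck k).continuousAt.preimage_mem_nhds hS] with m' hm'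
    exact ⟨.inr (D.deck k m'), hm', k, rfl⟩

theorem isOpenMap_proj : IsOpenMap (D.proj (n := n)) := by
  intro S hS
  refine isOpen_coinduced.2 (isOpen_iff_mem_nhds.2 ?_)
  rintro x ⟨y, hy, hxy⟩
  have hr : D.Rel x y := D.proj_eq_iff.1 hxy.symm
  filter_upwards [D.rel_lift hr (hS.mem_nhds hy)] with x' hx'
  obtain ⟨y', hy', h'⟩ := hx'
  exact ⟨y', hy', (D.proj_eq_iff.2 h').symm⟩

theorem exists_injOn_nhds (x : D.Pieces n) : ∃ S, IsOpen S ∧ x ∈ S ∧ Set.InjOn D.proj S := by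
  rcases x with b | m
  · refine ⟨Set.range Sum.inl, isOpen_range_inl, ⟨b, rfl⟩, ?_⟩
    rintro _ ⟨c, rfl⟩ _ ⟨c', rfl⟩ h
    exact congrArg Sum.inl (D.proj_eq_iff.1 h)
  · refine ⟨Sum.inr '' {c : pagePiece n | |c.1.2 - m.1.2| < D.C / 2}, ?_, ⟨m, ?_, rfl⟩, ?_⟩
    · refine isOpenMap_inr _ (isOpen_lt (by fun_prop) continuous_const)
    · simpa using D.C_pos
    · rintro _ ⟨c, hc, rfl⟩ _ ⟨c', hc', rfl⟩ h
      obtain ⟨k, rfl⟩ := D.proj_eq_iff.1 h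
      have hk : k = 0 := by
        have h1 := abs_lt.1 (show |c.1.2 - m.1.2| < D.C / 2 from hc)
        have h2 := abs_lt.1 (show |c.1.2 + k * D.U (Real.log ‖c.1.1.2‖) - m.1.2| < D.C / 2 from hc')
        have h3 := D.C_le_U (Real.log ‖c.1.1.2‖)
        have h4 := D.C_pos
        by_contra hk
        rcases lt_or_gt_of_ne hk with hk | hk
        · have : (k : ℝ) ≤ -1 := by exact_mod_cast Int.le_sub_one_of_lt hk
          nlinarith
        · have : (1 : ℝ) ≤ k := by exact_mod_cast hk
          nlinarith
      rw [hk, D.deck_zero]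

theorem isLocalHomeomorph_proj : IsLocalHomeomorph (D.proj (n := n)) := by
  rw [isLocalHomeomorph_iff_isOpenEmbedding_restrict]
  intro x
  obtain ⟨S, hS, hx, hinj⟩ := D.exists_injOn_nhds x
  refine ⟨S, hS.mem_nhds hx, .of_continuous_injective_isOpenMap ?_ ?_ ?_⟩
  · exact continuous_quotient_mk'.comp continuous_subtype_val
  · exact hinj.injective
  · exact D.isOpenMap_proj.comp hS.isOpenMap_subtype_val

/-- The manifold structure of the open book, for which the quotient map from the pieces is a local
diffeomorphism. -/
instance (n : ℕ) : ChartedSpace (EuclideanSpace ℝ (Fin (2 * n + 1))) (D.OB n) :=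
  D.isLocalHomeomorph_proj.chartedSpace (Quotient.mk_surjective (s := D.setoid n))

end OpenBookData

namespace OpenBookData

/-- Admissible choices exist. -/
theorem nonempty : Nonempty OpenBookData := by
  let T := Real.smoothTransition
  have hT : ContDiff ℝ ∞ T := Real.smoothTransition.contDiff
  have hT0 : ∀ x, x ≤ 0 → T x = 0 := fun x hx => Real.smoothTransition.zero_of_nonpos hx
  have hT1 : ∀ x, 1 ≤ x → T x = 1 := fun x hx => Real.smoothTransition.one_of_one_le hx
  have hTm : Monotone T := Real.smoothTransition.monotone
  have hTle : ∀ x, T x ≤ 1 := Real.smoothTransition.le_one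
  have hTnn : ∀ x, 0 ≤ T x := Real.smoothTransition.nonneg
  let f : ℝ → ℝ := fun t => Real.pi * (1 - T (3 * t - 1))
  have hf : ContDiff ℝ ∞ f := by fun_prop
  have hfa : Antitone f := fun s t h => by
    have := hTm (show 3 * s - 1 ≤ 3 * t - 1 by linarith)
    exact mul_le_mul_of_nonneg_left (by linarith) Real.pi_pos.le
  let c : ℝ := (1 - ∫ s in (0 : ℝ)..1, deriv f s * Real.exp s) / (2 * Real.pi)
  have hc : 0 < c := by
    have h : 0 ≤ ∫ s in (0 : ℝ)..1, -(deriv f s * Real.exp s) :=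
      intervalIntegral.integral_nonneg zero_le_one fun s _ => by
        have := hfa.deriv_nonpos (x := s)
        nlinarith [Real.exp_pos s]
    rw [intervalIntegral.integral_neg] at h
    exact div_pos (by linarith) (by positivity)
  let χ : ℝ → ℝ := fun s => T (4 * s - 1)
  let η : ℝ → ℝ := fun s => T (8 * s - 1)
  let ψ : ℝ → ℝ := fun s => s * η s + (1 - η s) / 8
  have hχ : ContDiff ℝ ∞ χ := by fun_prop
  have hη : ContDiff ℝ ∞ η := by fun_prop
  have hψ : ContDiff ℝ ∞ ψ := by fun_prop
  have hχm : Monotone χ := fun s t h => hTm (by linarith)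
  have hηm : Monotone η := fun s t h => hTm (by linarith)
  have hψpos : ∀ s, 0 < ψ s := fun s => by
    rcases le_total s (1 / 8) with h | h
    · simp only [ψ, show η s = 0 from hT0 _ (by linarith)]
      norm_num
    · have h1 := hTle (8 * s - 1)
      have h2 := hTnn (8 * s - 1)
      simp only [ψ, η]
      nlinarith
  have hψs : ∀ s, 1 / 4 ≤ s → ψ s = s := fun s h => by
    simp [ψ, show η s = 1 from hT1 _ (by linarith)]
  have hχs : ∀ s, 1 / 2 ≤ s → χ s = 1 := fun s h => hT1 _ (by linarith)
  have hχψ : ∀ s, s * (χ s / ψ s) = χ s := fun s => by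
    rcases le_total s (1 / 4) with h | h
    · simp [show χ s = 0 from hT0 _ (by linarith)]
    · rw [hψs s h]
      field_simp
  have hψd : ∀ s, HasDerivAt ψ (η s + (s - 1 / 8) * deriv η s) s := fun s => by
    have h1 := (hη.differentiable (by simp) s).hasDerivAt
    refine (((hasDerivAt_id s).mul h1).add (((hasDerivAt_const s 1).sub h1).div_const 8)).congr_deriv ?_
    simp
    ring
  have hψd0 : ∀ s, 0 ≤ η s + (s - 1 / 8) * deriv η s := fun s => by
    have h1 := hηm.deriv_nonneg (x := s)
    have h2 := hTnn (8 * s - 1)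
    rcases lt_or_ge s (1 / 8) with h | h
    · have h3 : deriv η s = 0 := by
        have : η =ᶠ[𝓝 s] fun _ => 0 := by
          filter_upwards [Iio_mem_nhds h] with u hu
          exact hT0 _ (by linarith [show u < 1 / 8 from hu])
        rw [this.deriv_eq, deriv_const]
      rw [h3, mul_zero, add_zero]
      exact h2
    · exact add_nonneg h2 (mul_nonneg (by linarith) h1)
  let k : ℝ → ℝ := fun s => c * ((1 - χ s) + χ s / ψ s)
  let h : ℝ → ℝ := fun s => Real.exp (2 - Real.sqrt (ψ s))
  have hsk : (fun s => s * k s) = fun s => c * (s * (1 - χ s) + χ s) := funext fun s => by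
    have := hχψ s
    simp only [k]
    linear_combination c * this
  have hskd : ∀ s, HasDerivAt (fun s => s * k s) (c * ((1 - χ s) + (1 - s) * deriv χ s)) s := by
    intro s
    have h1 := (hχ.differentiable (by simp) s).hasDerivAt
    rw [hsk]
    refine ((((hasDerivAt_id s).mul ((hasDerivAt_const s 1).sub h1)).add h1).const_mul c).congr_deriv ?_
    simp
    left
    ring
  have hhd : ∀ s, HasDerivAt h (h s * -((η s + (s - 1 / 8) * deriv η s) / (2 * Real.sqrt (ψ s)))) s :=
    fun s => ((((hψd s).sqrt (hψpos s).ne').const_sub 2)).exp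
  refine ⟨{
    f := f
    f_smooth := hf
    f_antitone := hfa
    f_content := ⟨1 / 3, by norm_num, fun t ht => by simp [f, hT0 (3 * t - 1) (by linarith)]⟩
    δ := 1 / 3
    δ_pos := by norm_num
    f_collar := fun t ht => by simp [f, hT1 (3 * t - 1) (by linarith)]
    C := 1
    C_pos := one_pos
    r₀ := 1
    r₀_pos := one_pos
    h := h
    k := k
    h_smooth := (contDiff_const.sub (hψ.sqrt fun s => (hψpos s).ne')).exp
    k_smooth := contDiff_const.mul ((contDiff_const.sub hχ).add (hχ.div hψ fun s => (hψpos s).ne'))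
    h_pos := fun s _ _ => Real.exp_pos _
    contact := ?_
    h_glue := fun r hr _ => ?_
    k_glue := fun r hr _ => ?_ }⟩
  · intro s hs _
    have hh : 0 < h s := Real.exp_pos _
    have hq : 0 < 2 * Real.sqrt (ψ s) := mul_pos two_pos (Real.sqrt_pos.2 (hψpos s))
    rw [(hskd s).deriv, (hhd s).deriv, show s * k s = c * (s * (1 - χ s) + χ s) from congrFun hsk s]
    set B := (η s + (s - 1 / 8) * deriv η s) / (2 * Real.sqrt (ψ s)) with hB
    have hB0 : 0 ≤ B := div_nonneg (hψd0 s) hq.le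
    have e : h s * (c * (1 - χ s + (1 - s) * deriv χ s)) - c * (s * (1 - χ s) + χ s) * (h s * -B) =
        h s * c * ((1 - χ s + (1 - s) * deriv χ s) + (s * (1 - χ s) + χ s) * B) := by ring
    rw [e]
    refine mul_pos (mul_pos hh hc) ?_
    have h1 : χ s ≤ 1 := hTle _
    have h2 : 0 ≤ χ s := hTnn _
    have h3 := hχm.deriv_nonneg (x := s)
    rcases lt_or_ge (1 / 2) s with h4 | h4
    · have h5 : deriv χ s = 0 := by
        have : χ =ᶠ[𝓝 s] fun _ => 1 := by
          filter_upwards [Ioi_mem_nhds h4] with u hu using hχs u hu.le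
        rw [this.deriv_eq, deriv_const]
      have h6 : deriv η s = 0 := by
        have : η =ᶠ[𝓝 s] fun _ => 1 := by
          filter_upwards [Ioi_mem_nhds h4] with u hu
          exact hT1 _ (by linarith [show 1 / 2 < u from hu])
        rw [this.deriv_eq, deriv_const]
      have h7 : 0 < B := by
        rw [hB, h6, show η s = 1 from hT1 _ (by linarith)]
        exact div_pos (by norm_num) hq
      rw [h5, hχs s h4.le]
      simpa using h7
    · have h8 : 0 ≤ (s * (1 - χ s) + χ s) * B :=
        mul_nonneg (add_nonneg (mul_nonneg hs (by linarith)) h2) hB0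
      have h9 : 0 ≤ (1 - s) * deriv χ s := mul_nonneg (by linarith) h3
      rcases lt_or_eq_of_le h1 with h10 | h10
      · linarith
      · have h11 : 1 / 4 ≤ s := by
          by_contra! h
          rw [show χ s = 0 from hT0 _ (by linarith)] at h10
          norm_num at h10
        have h12 : η s = 1 := hT1 _ (by linarith)
        have h13 := hηm.deriv_nonneg (x := s)
        have h14 : 0 < B := div_pos (by rw [h12]; nlinarith) hq
        rw [h10]
        rw [h10] at h8
        simp only [sub_self, mul_zero, zero_add, one_mul]
        linarith
  · have h1 : (1 : ℝ) / 4 ≤ r ^ 2 := by nlinarith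
    simp only [h, hψs _ h1, Real.sqrt_sq (zero_le_one.trans hr.le)]
    norm_num
  · have h1 : (1 : ℝ) / 2 ≤ r ^ 2 := by nlinarith
    have h2 := congrFun hsk (r ^ 2)
    simp only [hχs _ h1] at h2
    rw [h2]
    simp [c]

end OpenBookData

/-! ### One-forms and contact forms on manifolds -/

section Forms
variable {E H M : Type*} [NormedAddCommGroup E] [NormedSpace ℝ E] [TopologicalSpace H]
  {E' H' M' : Type*} [NormedAddCommGroup E'] [NormedSpace ℝ E'] [TopologicalSpace H']
  [TopologicalSpace M] [ChartedSpace H M] [TopologicalSpace M'] [ChartedSpace H' M']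

/-- A (not necessarily continuous) one-form on a manifold. -/
abbrev OneForm (I : ModelWithCorners ℝ E H) (M : Type*) [TopologicalSpace M] [ChartedSpace H M] :=
  ∀ x : M, TangentSpace I x →L[ℝ] ℝ

/-- The pullback of a one-form along a map. -/
def pullback (I : ModelWithCorners ℝ E H) {I' : ModelWithCorners ℝ E' H'} (F : M → M')
    (β : OneForm I' M') : OneForm I M :=
  fun x => (β (F x)).comp (mfderiv I I' F x)

/-- The expression of the one-form `α` in the preferred chart at `x`. -/
def localForm {I : ModelWithCorners ℝ E H} (α : OneForm I M) (x : M) (u : E) : E →L[ℝ] ℝ :=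
  (α ((extChartAt I x).symm u)).comp (mfderiv 𝓘(ℝ, E) I (extChartAt I x).symm u)

/-- The exterior derivative `dα(v, w)` at a point `x` of a manifold without boundary. -/
def dForm {I : ModelWithCorners ℝ E H} (α : OneForm I M) (x : M) (v w : TangentSpace I x) : ℝ :=
  let A : E →L[ℝ] E →L[ℝ] ℝ := fderiv ℝ (localForm α x) (extChartAt I x x)
  let v' : E := mfderiv I 𝓘(ℝ, E) (extChartAt I x) x v
  let w' : E := mfderiv I 𝓘(ℝ, E) (extChartAt I x) x w
  A v' w' - A w' v'

/-- A contact form on an odd-dimensional manifold without boundary: a smooth, nowhere vanishing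
one-form `α` such that `dα` is nondegenerate on `ker α`. -/
structure IsContactForm {I : ModelWithCorners ℝ E H} [IsManifold I 1 M] (α : OneForm I M) :
    Prop where
  smooth : ContMDiff I (I.prod 𝓘(ℝ, E →L[ℝ] ℝ)) ∞
    (fun x => Bundle.TotalSpace.mk' (E →L[ℝ] ℝ) (E := fun x : M => TangentSpace I x →L[ℝ] ℝ) x (α x))
  ne_zero : ∀ x, α x ≠ 0
  nondegenerate : ∀ x v, α x v = 0 → v ≠ 0 → ∃ w, α x w = 0 ∧ dForm α x v w ≠ 0

end Forms

/-- The canonical Liouville form `λ_can = p dq`. -/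
def liouville {n : ℕ} (x : Euc n × Euc n) : Euc n × Euc n →L[ℝ] ℝ :=
  (innerSL ℝ x.2).comp (ContinuousLinearMap.fst ℝ (Euc n) (Euc n))

/-- The canonical contact form on `ST*Sⁿ`. It is invariant under the antipodal map, and descends to
the canonical contact form on `ST*ℝPⁿ`. -/
def canonicalForm (n : ℕ) : OneForm (𝓡 (2 * n - 1)) (unitCotangentSphere n) :=
  pullback (I' := 𝓘(ℝ, Euc n × Euc n)) (𝓡 (2 * n - 1)) Subtype.val liouville

namespace OpenBookData

/-- The contact form `h₁(r) λ_P + h₂(r) dφ` on `P × D²`, where `h₂(r) dφ = k(r²) (x dy - y dx)`. -/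
def bindingForm (D : OpenBookData) (n : ℕ) : OneForm (𝓡 (2 * n + 1)) (bindingPiece D n) :=
  pullback (I' := 𝓘(ℝ, (Euc n × Euc n) × ℂ)) (𝓡 (2 * n + 1)) Subtype.val
    (fun x : (Euc n × Euc n) × ℂ =>
      D.h (‖x.2‖ ^ 2) • (liouville x.1).comp (ContinuousLinearMap.fst ℝ (Euc n × Euc n) ℂ) +
      D.k (‖x.2‖ ^ 2) • (x.2.re • Complex.imCLM - x.2.im • Complex.reCLM).comp
        (ContinuousLinearMap.snd ℝ (Euc n × Euc n) ℂ))

/-- The contact form `dφ + λ` on `W × ℝ`, which descends to the mapping torus. -/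
def pageForm (n : ℕ) : OneForm (𝓡 (2 * n + 1)) (pagePiece n) :=
  pullback (I' := 𝓘(ℝ, (Euc n × Euc n) × ℝ)) (𝓡 (2 * n + 1)) Subtype.val
    (fun x : (Euc n × Euc n) × ℝ =>
      ContinuousLinearMap.snd ℝ (Euc n × Euc n) ℝ +
      (liouville x.1).comp (ContinuousLinearMap.fst ℝ (Euc n × Euc n) ℝ))

/-- The one-form `β` defines the cooriented contact structure of the open book: on each of the two
pieces it is a positive multiple of the given contact form. -/
def DefinesContactStructure (D : OpenBookData) {n : ℕ} (β : OneForm (𝓡 (2 * n + 1)) (D.OB n)) :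
    Prop :=
  (∀ b, ∃ c > 0, pullback (𝓡 (2 * n + 1)) (fun b => D.proj (Sum.inl b)) β b =
    c • D.bindingForm n b) ∧
  (∀ m, ∃ c > 0, pullback (𝓡 (2 * n + 1)) (fun m => D.proj (Sum.inr m)) β m =
    c • pageForm n m)

end OpenBookData

/-- The vector field generating the circle action on `S²ⁿ⁺¹`. -/
def circleField {n : ℕ} (z : OddSphere n) : TangentSpace (𝓡 (2 * n + 1)) z :=
  mfderiv 𝓘(ℝ, ℝ) (𝓡 (2 * n + 1)) (fun t : ℝ => Circle.exp t • z) 0 (1 : ℝ)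

/-- Invariance of a one-form under the circle action on `S²ⁿ⁺¹`. -/
def IsCircleInvariant {n : ℕ} (α : OneForm (𝓡 (2 * n + 1)) (OddSphere n)) : Prop :=
  ∀ g : Circle, pullback (𝓡 (2 * n + 1)) (fun z : OddSphere n => g • z) α = α

/-- The almost dividing set in `ℂPⁿ` of a circle-invariant contact form on `S²ⁿ⁺¹`. -/
def almostDividingSet {n : ℕ} (α : OneForm (𝓡 (2 * n + 1)) (OddSphere n)) : Set (CP n) :=
  {x | ∀ z, hopf z = x → α z (circleField z) = 0}

/-- `e` is a contactomorphism from `(ST*ℝPⁿ, λ_can)` to the almost dividing set `Γ ⊆ ℂPⁿ` of `α`: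
it is a smooth embedding with image `Γ`, and it pulls back the one-form on `Γ` induced by `α` to a
positive multiple of `λ_can`. The induced one-form assigns to a vector `dπ(w)` tangent to `Γ`, with
`π` the Hopf fibration, the value `α(w)`, and `λ_can` is evaluated on the double cover `ST*Sⁿ`. -/
structure IsContactomorphismToDividingSet {n : ℕ}
    (α : OneForm (𝓡 (2 * n + 1)) (OddSphere n)) (e : UnitCotangentRP n → CP n) : Prop where
  embedding : Manifold.IsSmoothEmbedding (𝓡 (2 * n - 1)) 𝓘(ℝ, EuclideanSpace ℂ (Fin n)) ∞ e
  range_eq : Set.range e = almostDividingSet α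
  contact : ∀ (x : unitCotangentSphere n) (z : OddSphere n), hopf z = e (toUnitCotangentRP x) →
    ∃ c > 0, ∀ (v : TangentSpace (𝓡 (2 * n - 1)) x) (w : TangentSpace (𝓡 (2 * n + 1)) z),
      (mfderiv (𝓡 (2 * n + 1)) 𝓘(ℝ, EuclideanSpace ℂ (Fin n)) hopf z w :
          EuclideanSpace ℂ (Fin n)) =
        mfderiv (𝓡 (2 * n - 1)) 𝓘(ℝ, EuclideanSpace ℂ (Fin n))
          (fun y => e (toUnitCotangentRP y)) x v →
      α z w = c * canonicalForm n x v

end LeftStabilization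

end

open LeftStabilization

open scoped Manifold ContDiff InnerProductSpace Topology

noncomputable section

namespace LeftStabilization

open Module

open scoped ComplexConjugate

/-! On the sphere in ℂⁿ⁺¹ consider the function Q(w) = Σ wⱼ² (`dot w w`). Where |Q| < 1, a point is
determined by Q and by a frame u = q + ip with (q, p) ∈ ST*Sⁿ, through w = A u + (Q / 4A) ū with A =
`amp Q` (this is `theta`, inverted by `frame`). Where |Q| = 1, w is a unit complex multiple of a
real vector. The circle acts by g · (u, Q) = (gu, g²Q) (`theta_smul`).

The diffeomorphism `obDiffeo` sends the binding to Q = 0 and turns the angle of the open book into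
arg Q. A point ((q, p), z) of P × D² goes to the frame q + ip and a radially rescaled z. A point
((q, p), φ) of W × ℝ, with t = log |p| and θ = 2πφ/U(t), goes to the frame e^{i f(t) θ / 2π} (q + i
p/|p|) and the square σ(t) e^{iθ}, where σ (`sig`) decreases from 1 at the zero section to 0 at the
binding. The rotation of the frame makes this map descend to the mapping torus: the geodesic flow
for time f multiplies the frame by e^{-if}, while φ ↦ φ + U adds 2π to θ (`pageMap_deck`). Near the
zero section f = π, and the map becomes e^{iθ/2} times a smooth function of (q, p)
(`pmap_of_le_one`). Smooth local sections (`exists_section`) provide the inverse.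

For frames one has p dq = -½ Im⟨u, du⟩. Written in the rotated frame, dφ + λ equals -½ eᵗ Im⟨u, du⟩
+ (U + eᵗ f)/2π dθ: since U' = -f' eᵗ, the terms in dt cancel. So the contact forms of both pieces
have the shape -½ H₁(t) Im⟨u, du⟩ + H₂(t) dθ, and both are pulled back from one form α = F Im⟨w, dw⟩
+ G Im(Q̄ dQ) on the sphere, with F and G functions of |Q| (`sphereForm_bmap`, `sphereForm_pmap`).
Such a form is invariant under the circle. Its smoothness and the contact condition are inherited
from the two pieces through the local sections (`contactForm_of_section`, `isContactAt_page`,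
`isContactAt_binding`).

The circle field turns u at speed 1 and arg Q at speed 2, so α(X) = 2H₂ - H₁ off the zero section.
By the contact condition H₂/H₁ is strictly decreasing in t (`strictAntiOn_ratio`). It exceeds 1/2 at
t = 0 and is 0 at the binding, so α(X) vanishes on exactly one level |Q| = s₀ (`exists_level`,
`exists_dividing_level`). Each circle orbit in this level meets {Q = s₀} in a pair ±w, and {Q = s₀}
is a copy of ST*Sⁿ by u ↦ `theta u s₀`. Hence the quotient of the level by the circle is ST*Sⁿ/±1 =
ST*ℝPⁿ (`toCP`). On {Q = s₀} the term in dθ vanishes, and α is H₁ > 0 times the canonical form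
(`alpha_liftDeriv`). -/

/-! ### Curves -/

section Curves
variable {E H M : Type*} [NormedAddCommGroup E] [NormedSpace ℝ E] [TopologicalSpace H]
  [TopologicalSpace M] [ChartedSpace H M] {I : ModelWithCorners ℝ E H}
  {V : Type*} [NormedAddCommGroup V] [NormedSpace ℝ V]

/-- The curve `c` passes through `x` with velocity `v` at time `0`. -/
structure HasVelocity (I : ModelWithCorners ℝ E H) (c : ℝ → M) (x : M) (v : E) : Prop where
  zero : c 0 = x
  deriv : HasMFDerivAt 𝓘(ℝ, ℝ) I c 0 (ContinuousLinearMap.toSpanSingleton ℝ v)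

/-- Every tangent vector of a manifold without boundary is the velocity of a curve. -/
theorem exists_hasVelocity [I.Boundaryless] (x : M) (v : E) :
    ∃ c : ℝ → M, HasVelocity I c x v := by
  let γ : ℝ → E := fun τ => extChartAt I x x + τ • v
  have hγ : Continuous γ := by fun_prop
  have h0 : γ 0 = extChartAt I x x := by simp [γ]
  have hc0 : (extChartAt I x).symm (γ 0) = x := by rw [h0, extChartAt_to_inv]
  have htgt : ∀ᶠ τ in 𝓝 (0 : ℝ), γ τ ∈ (extChartAt I x).target :=
    hγ.continuousAt.eventually_mem ((isOpen_extChartAt_target x).mem_nhds (by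
      rw [h0]; exact mem_extChartAt_target x))
  refine ⟨fun τ => (extChartAt I x).symm (γ τ), hc0, ?_, ?_⟩
  · refine ContinuousAt.comp ?_ hγ.continuousAt
    rw [h0]
    exact continuousAt_extChartAt_symm x
  · have hd : HasDerivAt γ v 0 := by
      have h := ((hasDerivAt_id (0 : ℝ)).smul_const v).const_add (extChartAt I x x)
      rwa [one_smul] at h
    have : writtenInExtChartAt 𝓘(ℝ, ℝ) I 0 (fun τ => (extChartAt I x).symm (γ τ)) =ᶠ[𝓝 0] γ := by
      filter_upwards [htgt] with τ hτ
      simp only [writtenInExtChartAt, Function.comp_apply]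
      rw [hc0]
      exact (extChartAt I x).right_inv hτ
    simp only [mfld_simps]
    exact (hd.hasFDerivAt.congr_of_eventuallyEq this).hasFDerivWithinAt

variable (I) in
/-- The differential of a map to a vector space, as a linear map between model spaces. -/
def tderiv (F : M → V) (x : M) : E →L[ℝ] V := mfderiv I 𝓘(ℝ, V) F x

theorem hasMFDerivAt_tderiv {F : M → V} {x : M} (hF : MDifferentiableAt I 𝓘(ℝ, V) F x) :
    HasMFDerivAt I 𝓘(ℝ, V) F x (tderiv (V := V) I F x) := hF.hasMFDerivAt

/-- Identities between one-forms on the pieces and on the sphere are verified along such curves,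
which turns them into one-variable calculus. -/
theorem HasVelocity.hasDerivAt_comp {c : ℝ → M} {x : M} {v : E} (hc : HasVelocity I c x v)
    {F : M → V} (hF : MDifferentiableAt I 𝓘(ℝ, V) F x) :
    HasDerivAt (fun τ => F (c τ)) (tderiv I F x v) 0 := by
  obtain ⟨rfl, hcd⟩ := hc
  have h : HasFDerivAt (fun τ => F (c τ)) ((tderiv I F (c 0)).comp
      (ContinuousLinearMap.toSpanSingleton ℝ v)) 0 :=
    ((hasMFDerivAt_tderiv hF).comp 0 hcd).hasFDerivAt
  refine h.hasDerivAt.congr_deriv ?_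
  simp

end Curves

/-! ### Regular level sets as submanifolds -/

section LevelSets
variable {V F : Type*} [NormedAddCommGroup V] [NormedSpace ℝ V] [FiniteDimensional ℝ V]
  [NormedAddCommGroup F] [NormedSpace ℝ F] [FiniteDimensional ℝ F]
  {S Ω : Set V} {f : V → F} {d : ℕ}
  {E H M : Type*} [NormedAddCommGroup E] [NormedSpace ℝ E] [TopologicalSpace H]
  [TopologicalSpace M] [ChartedSpace H M] {I : ModelWithCorners ℝ E H}

/-- Near `x₀`, the inclusion of a regular level set is a smooth map of the coordinates. -/
theorem IsRegularLevel.exists_param (hS : IsRegularLevel S Ω f d) (x₀ : S) :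
    ∃ (B : V →L[ℝ] EuclideanSpace ℝ (Fin d)) (g : EuclideanSpace ℝ (Fin d) → V),
      (∀ x : S, levelChart hS x₀ x = B x) ∧ ContDiffAt ℝ ∞ g (B x₀) ∧
      ∀ x ∈ (levelChart hS x₀).source, g (levelChart hS x₀ x) = x := by
  have h := (hS.exists_chart x₀).choose_spec.choose_spec
  set B := (hS.exists_chart x₀).choose with hB
  set φ := (hS.exists_chart x₀).choose_spec.choose with hφ
  have hval : ∀ x : S, φ x = (0, B x) := fun x => by
    rw [h.2.2.1, ((hS.mem_iff _).1 x.2).2]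
  have hφc : (φ : V → _) = fun z => (f z, B z) := funext h.2.2.1
  have hc : ContDiff ℝ ∞ φ := by
    rw [hφc]
    exact hS.contDiff.prodMk (ContinuousLinearMap.contDiff _)
  have hmem : ((0 : F), B x₀) ∈ φ.target := hval x₀ ▸ φ.map_source h.1
  obtain ⟨e, he⟩ := h.2.2.2 _ h.1
  have hs : φ.symm (0, B x₀) = x₀ := by rw [← hval, φ.left_inv h.1]
  have hinv : ContDiffAt ℝ ∞ φ.symm (0, B x₀) :=
    φ.contDiffAt_symm hmem (by rw [hs]; exact he) hc.contDiffAt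
  have hg : ContDiffAt ℝ ∞ (fun u => φ.symm ((0 : F), u)) (B x₀) :=
    hinv.comp _ (contDiffAt_const.prodMk contDiffAt_id)
  refine ⟨B, fun u => φ.symm (0, u), fun x => rfl, hg, fun x hx => ?_⟩
  change φ.symm (0, B x) = x
  rw [← hval, φ.left_inv hx]

theorem IsRegularLevel.contMDiff_val (hS : IsRegularLevel S Ω f d) :
    letI := levelChartedSpace hS
    ContMDiff (𝓡 d) 𝓘(ℝ, V) ∞ (Subtype.val : S → V) := by
  let := levelChartedSpace hS
  intro x
  obtain ⟨B, g, hB, hg, hgx⟩ := hS.exists_param x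
  have h1 : ContMDiffAt (𝓡 d) 𝓘(ℝ, V) ∞ (g ∘ extChartAt (𝓡 d) x) x := by
    refine ContMDiffAt.comp x (I' := 𝓘(ℝ, EuclideanSpace ℝ (Fin d))) ?_ contMDiffAt_extChartAt
    have : extChartAt (𝓡 d) x x = B x := hB x
    rw [this]
    exact hg.contMDiffAt
  refine h1.congr_of_eventuallyEq ?_
  filter_upwards [(levelChart hS x).open_source.mem_nhds (mem_chart_source _ x)] with y hy
  exact (hgx y hy).symm

/-- The charts of a level set are restrictions of linear maps of the ambient space, so ambient
smoothness suffices. -/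
theorem IsRegularLevel.contMDiffAt_of_val (hS : IsRegularLevel S Ω f d) {m : ℕ∞ω} {G : M → S} {x : M}
    (hG : ContMDiffAt I 𝓘(ℝ, V) m (fun y => (G y : V)) x) :
    letI := levelChartedSpace hS
    ContMDiffAt I (𝓡 d) m G x := by
  let := levelChartedSpace hS
  obtain ⟨B, g, hB, -⟩ := hS.exists_param (G x)
  refine contMDiffAt_iff_target.2 ⟨?_, ?_⟩
  · exact Topology.IsInducing.subtypeVal.continuousAt_iff.2 hG.continuousAt
  · have : (extChartAt (𝓡 d) (G x)) ∘ G = fun y => B (G y) := funext fun y => hB (G y)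
    rw [this]
    exact B.contMDiff.contMDiffAt.comp x hG

omit [FiniteDimensional ℝ V] [FiniteDimensional ℝ F] in
/-- Tangent vectors lie in the kernel of the differential of the defining map. -/
theorem IsRegularLevel.fderiv_tangent (hS : IsRegularLevel S Ω f d) {G : M → S} {x : M}
    (hG : MDifferentiableAt I 𝓘(ℝ, V) (fun y => (G y : V)) x) (v : E) :
    fderiv ℝ f (G x) (tderiv I (fun y => (G y : V)) x v) = 0 := by
  have h1 : HasMFDerivAt 𝓘(ℝ, V) 𝓘(ℝ, F) f (G x : V) (fderiv ℝ f (G x : V) : V →L[ℝ] F) :=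
    ((hS.contDiff.differentiable (by simp)) (G x : V)).hasFDerivAt.hasMFDerivAt
  have h2 := h1.comp x (hasMFDerivAt_tderiv hG)
  have h3 : f ∘ (fun y => (G y : V)) = fun _ => 0 := funext fun y => ((hS.mem_iff _).1 (G y).2).2
  rw [h3] at h2
  have h4 := hasMFDerivAt_unique h2 (hasMFDerivAt_const (0 : F) x)
  exact DFunLike.congr_fun h4 v

end LevelSets

/-! ### Quotients by local homeomorphisms -/

section LocalHomeomorph
variable {E H X Y : Type*} [NormedAddCommGroup E] [NormedSpace ℝ E] [TopologicalSpace H]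
  [TopologicalSpace X] [ChartedSpace H X] [TopologicalSpace Y] {I : ModelWithCorners ℝ E H}
  {E' H' N : Type*} [NormedAddCommGroup E'] [NormedSpace ℝ E'] [TopologicalSpace H']
  [TopologicalSpace N] [ChartedSpace H' N] {I' : ModelWithCorners ℝ E' H'} {m : ℕ∞ω}
  {p : X → Y}

/-- A map from the quotient is smooth if its composition with the quotient map is. -/
theorem IsLocalHomeomorph.contMDiff_of_comp (hp : IsLocalHomeomorph p) (hs : Function.Surjective p)
    {f : Y → N} (hf : ContMDiff I I' m (f ∘ p)) :
    letI := hp.chartedSpace (H := H) hs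
    ContMDiff I I' m f := by
  let := hp.chartedSpace (H := H) hs
  intro y
  set x := hs.hasRightInverse.choose y with hx
  have hxy : p x = y := hs.hasRightInverse.choose_spec y
  have h := contMDiffAt_iff.1 (hf x)
  have hcont : ContinuousAt f y := by
    have h1 : ContinuousAt (hp.localInverseAt x) y := by
      refine (hp.localInverseAt x).continuousAt ?_
      rw [← hxy]; simp
    have h2 : hp.localInverseAt x y = x := by
      rw [← hxy]; simp
    have h3 : ContinuousAt ((f ∘ p) ∘ hp.localInverseAt x) y :=
      ContinuousAt.comp (by rw [h2]; exact h.1) h1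
    refine h3.congr ?_
    have : (hp.localInverseAt x).source ∈ 𝓝 y :=
      (hp.localInverseAt x).open_source.mem_nhds (by rw [← hxy]; simp)
    filter_upwards [this] with z hz
    simp only [Function.comp_apply]
    rw [hp.apply_localInverseAt_of_mem hz]
  refine contMDiffAt_iff.2 ⟨hcont, ?_⟩
  -- The chart at `y` is a local inverse of `p` followed by the chart at the chosen preimage `x`.
  -- Hence `f` at `y` and `f ∘ p` at `x` have the same coordinate expression.
  have hchart : extChartAt I y = (hp.localInverseAt x).toPartialEquiv.trans (extChartAt I x) := by
    simp only [extChartAt, OpenPartialHomeomorph.extend]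
    change ((hp.localInverseAt x).toPartialEquiv.trans (chartAt H x).toPartialEquiv).trans _ = _
    rw [PartialEquiv.trans_assoc]
  have hli : hp.localInverseAt x y = x := by rw [← hxy]; simp
  have e1 : extChartAt I y y = extChartAt I x x := by
    rw [hchart]
    change extChartAt I x (hp.localInverseAt x y) = _
    rw [hli]
  have e2 : ((extChartAt I y).symm : E → Y) = p ∘ (extChartAt I x).symm := by
    rw [hchart]
    change (hp.localInverseAt x).symm ∘ (extChartAt I x).symm = _
    rw [IsLocalHomeomorph.localInverseAt_symm]
  have h3 := h.2
  simp only [Function.comp_apply, hxy] at h3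
  rw [e1, e2]
  exact h3

/-- A map into the quotient is smooth if it lifts locally to smooth maps. -/
theorem IsLocalHomeomorph.contMDiffAt_of_lift (hp : IsLocalHomeomorph p) (hs : Function.Surjective p)
    {g : N → Y} {z : N} (hg : ∀ x, p x = g z → ∃ j : N → X, j z = x ∧ ContMDiffAt I' I m j z ∧
      ∀ᶠ w in 𝓝 z, p (j w) = g w) :
    letI := hp.chartedSpace (H := H) hs
    ContMDiffAt I' I m g z := by
  let := hp.chartedSpace (H := H) hs
  -- The chart at `g z` goes through one preimage chosen beforehand, which is why lifts through
  -- every preimage are required.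
  set x := hs.hasRightInverse.choose (g z) with hx
  have hxy : p x = g z := hs.hasRightInverse.choose_spec (g z)
  obtain ⟨j, hjz, hj, hpj⟩ := hg x hxy
  have hcont : ContinuousAt g z :=
    ((hp.continuous.continuousAt.comp hj.continuousAt).congr hpj)
  refine contMDiffAt_iff_target.2 ⟨hcont, ?_⟩
  have hj2 := (contMDiffAt_iff_target.1 hj).2
  rw [hjz] at hj2
  refine hj2.congr_of_eventuallyEq ?_
  have hx' : ∀ᶠ w in 𝓝 z, j w ∈ (hp.localInverseAt x).target :=
    hj.continuousAt.eventually_mem ((hp.localInverseAt x).open_target.mem_nhds (by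
      rw [hjz]; exact hp.self_mem_localInverseAt_target))
  filter_upwards [hpj, hx'] with w hw hw'
  change extChartAt I x (hp.localInverseAt x (g w)) = extChartAt I x (j w)
  rw [← hw]
  congr 1
  have := (hp.localInverseAt x).right_inv hw'
  rwa [IsLocalHomeomorph.localInverseAt_symm] at this

end LocalHomeomorph

/-! ### Pullbacks of one-forms from vector spaces -/

section PullbackForms
variable {E H M V : Type*} [NormedAddCommGroup E] [NormedSpace ℝ E] [TopologicalSpace H]
  [TopologicalSpace M] [ChartedSpace H M] {I : ModelWithCorners ℝ E H} [IsManifold I ∞ M]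
  [NormedAddCommGroup V] [NormedSpace ℝ V]
  {α : OneForm I M} {j : M → V} {β : V → V →L[ℝ] ℝ} {x : M}

/-- In the trivialization at `x` the form is the composite of the smooth maps `β ∘ j` and the
differential of `j`. -/
theorem contMDiffAt_of_eq_pullback (hj : ContMDiffAt I 𝓘(ℝ, V) ∞ j x) (hβ : ContDiffAt ℝ ∞ β (j x))
    (hα : ∀ᶠ y in 𝓝 x, ∀ v : E, α y v = β (j y) (tderiv I j y v)) :
    ContMDiffAt I (I.prod 𝓘(ℝ, E →L[ℝ] ℝ)) ∞
      (fun x => Bundle.TotalSpace.mk' (E →L[ℝ] ℝ) (E := fun x : M => TangentSpace I x →L[ℝ] ℝ) x (α x)) x := by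
  have : IsManifold I 1 M := .of_le (n := ∞) (by simp)
  rw [contMDiffAt_hom_bundle]
  refine ⟨contMDiffAt_id, ?_⟩
  have h1 : ContMDiffAt I 𝓘(ℝ, E →L[ℝ] V) ∞
      (inTangentCoordinates I 𝓘(ℝ, V) id j (fun y => mfderiv I 𝓘(ℝ, V) j y) x) x :=
    hj.mfderiv_const (by simp)
  have h2 : ContMDiffAt I 𝓘(ℝ, V →L[ℝ] ℝ) ∞ (fun y => β (j y)) x := hβ.contMDiffAt.comp x hj
  refine (h2.clm_comp h1).congr_of_eventuallyEq ?_
  filter_upwards [hα] with y hy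
  ext v
  simp only [ContinuousLinearMap.inCoordinates, inTangentCoordinates, ContinuousLinearMap.comp_apply,
    TangentBundle.continuousLinearMapAt_model_space]
  simp only [Bundle.Trivial.fiberBundle_trivializationAt', Bundle.Trivial.continuousLinearMapAt_trivialization]
  exact hy _

/-- In a chart, `j` becomes a map `J` and the form becomes `β (J u)` composed with the derivative of
`J`. The terms with the second derivative of `J` are symmetric in the two vectors and drop out after
antisymmetrization. -/
theorem dForm_of_eq_pullback [I.Boundaryless] (hj : ContMDiffAt I 𝓘(ℝ, V) ∞ j x) (hβ : ContDiffAt ℝ ∞ β (j x))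
    (hα : ∀ᶠ y in 𝓝 x, ∀ v : E, α y v = β (j y) (tderiv I j y v)) (v w : E) :
    dForm α x v w = fderiv ℝ β (j x) (tderiv I j x v) (tderiv I j x w) -
      fderiv ℝ β (j x) (tderiv I j x w) (tderiv I j x v) := by
  have : IsManifold I 1 M := .of_le (n := ∞) (by simp)
  set χ := extChartAt I x with hχ
  set u₀ := χ x with hu₀
  have hu0 : χ.symm u₀ = x := extChartAt_to_inv x
  have htgt : χ.target ∈ 𝓝 u₀ := (isOpen_extChartAt_target x).mem_nhds (mem_extChartAt_target x)
  let J : E → V := j ∘ χ.symm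
  have hχs : ∀ u ∈ χ.target, ContMDiffAt 𝓘(ℝ, E) I ∞ χ.symm u := fun u hu =>
    (contMDiffOn_extChartAt_symm x).contMDiffAt ((isOpen_extChartAt_target x).mem_nhds hu)
  have hJ : ContDiffAt ℝ ∞ J u₀ := by
    have h : ContMDiffAt I 𝓘(ℝ, V) ∞ j (χ.symm u₀) := by rwa [hu0]
    exact (h.comp u₀ (hχs u₀ (mem_extChartAt_target x))).contDiffAt
  have hcs : Filter.Tendsto χ.symm (𝓝 u₀) (𝓝 x) := by
    have := (hχs u₀ (mem_extChartAt_target x)).continuousAt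
    rwa [ContinuousAt, hu0] at this
  have hjd : ∀ᶠ y in 𝓝 x, MDifferentiableAt I 𝓘(ℝ, V) j y := by
    have h1 : ContMDiffAt I 𝓘(ℝ, V) 1 j x := hj.of_le (by simp)
    filter_upwards [(contMDiffAt_iff_contMDiffAt_nhds (by simp)).1 h1] with y hy
    exact hy.mdifferentiableAt (by simp)
  have hloc : localForm α x =ᶠ[𝓝 u₀] fun u => (β (J u)).comp (fderiv ℝ J u) := by
    filter_upwards [htgt, hcs.eventually hα, hcs.eventually hjd] with u hu h1 h2
    let T : E →L[ℝ] E := mfderiv 𝓘(ℝ, E) I χ.symm u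
    have h3 : HasFDerivAt J ((tderiv I j (χ.symm u)).comp T) u :=
      ((hasMFDerivAt_tderiv h2).comp u
        ((hχs u hu).mdifferentiableAt (by simp)).hasMFDerivAt).hasFDerivAt
    ext ξ
    rw [h3.fderiv]
    exact h1 (T ξ)
  have hβd := (hβ.differentiableAt (by simp)).hasFDerivAt
  have hJd := (hJ.differentiableAt (by simp)).hasFDerivAt
  have hJ1 : HasFDerivAt (fderiv ℝ J) (fderiv ℝ (fderiv ℝ J) u₀) u₀ :=
    ((hJ.fderiv_right (m := 1) (by norm_cast)).differentiableAt (by simp)).hasFDerivAt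
  have hJu : J u₀ = j x := congrArg j hu0
  rw [← hJu] at hβd
  have hmain := (hβd.comp u₀ hJd).clm_comp hJ1
  have hA : fderiv ℝ (localForm α x) u₀ = _ := hloc.fderiv_eq.trans hmain.fderiv
  have hsymm : IsSymmSndFDerivAt ℝ J u₀ := hJ.isSymmSndFDerivAt (by
    simp only [minSmoothness_of_isRCLikeNormedField]
    norm_cast)
  let T : E →L[ℝ] E := mfderiv I 𝓘(ℝ, E) χ x
  have hDJ : ∀ ξ : E, tderiv I j x ξ = fderiv ℝ J u₀ (T ξ) := by
    intro ξ
    have h1 : HasMFDerivAt I 𝓘(ℝ, V) (J ∘ χ) x ((fderiv ℝ J u₀).comp T) := HasMFDerivAt.comp x (f := χ)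
      (hJd.hasMFDerivAt) ((contMDiffAt_extChartAt (n := 1)).mdifferentiableAt (by simp)).hasMFDerivAt
    have h2 : j =ᶠ[𝓝 x] J ∘ χ := by
      filter_upwards [extChartAt_source_mem_nhds (I := I) x] with y hy
      exact congrArg j (χ.left_inv hy).symm
    exact DFunLike.congr_fun ((h1.congr_of_eventuallyEq h2).mfderiv) ξ
  have key : dForm α x v w = fderiv ℝ (localForm α x) u₀ (T v) (T w) -
      fderiv ℝ (localForm α x) u₀ (T w) (T v) := rfl
  rw [key, hA, hDJ, hDJ, ← hJu]
  have hs : fderiv ℝ (fderiv ℝ J) u₀ (T v) (T w) = fderiv ℝ (fderiv ℝ J) u₀ (T w) (T v) := hsymm _ _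
  simp only [add_apply, ContinuousLinearMap.comp_apply,
    ContinuousLinearMap.compL_apply, ContinuousLinearMap.flip_apply, hs]
  ring

end PullbackForms

/-! ### Immersions of finite-dimensional manifolds -/

section Immersion

/-- A chart of the maximal atlas composed with a local diffeomorphism of the model space. -/
theorem trans_mem_maximalAtlas {E N : Type*} [NormedAddCommGroup E] [NormedSpace ℝ E]
    [TopologicalSpace N] [ChartedSpace E N] [IsManifold 𝓘(ℝ, E) ∞ N]
    {ψ : OpenPartialHomeomorph N E} (hψ : ψ ∈ atlas E N) {k : OpenPartialHomeomorph E E}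
    (hk : ContDiffOn ℝ ∞ k k.source) (hk' : ContDiffOn ℝ ∞ k.symm k.target) :
    ψ.trans k ∈ IsManifold.maximalAtlas 𝓘(ℝ, E) ∞ N := by
  have hkm : k ∈ contDiffGroupoid ∞ 𝓘(ℝ, E) := by
    refine mem_groupoid_of_pregroupoid.2 ⟨?_, ?_⟩
    · simpa [contDiffPregroupoid] using hk
    · simpa [contDiffPregroupoid] using hk'
  rw [IsManifold.mem_maximalAtlas_iff, mem_maximalAtlas_iff]
  intro e' he'
  constructor
  · rw [OpenPartialHomeomorph.trans_symm_eq_symm_trans_symm, OpenPartialHomeomorph.trans_assoc]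
    exact (contDiffGroupoid ∞ 𝓘(ℝ, E)).trans ((contDiffGroupoid ∞ 𝓘(ℝ, E)).symm hkm)
      (HasGroupoid.compatible hψ he')
  · rw [← OpenPartialHomeomorph.trans_assoc]
    exact (contDiffGroupoid ∞ 𝓘(ℝ, E)).trans (HasGroupoid.compatible he' hψ) hkm

variable {E E' F M N : Type*} [NormedAddCommGroup E] [NormedSpace ℝ E] [FiniteDimensional ℝ E]
  [NormedAddCommGroup E'] [NormedSpace ℝ E'] [FiniteDimensional ℝ E']
  [NormedAddCommGroup F] [NormedSpace ℝ F] [FiniteDimensional ℝ F]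

/-- A map between finite-dimensional vector spaces with injective differential extends to a local
diffeomorphism. -/
theorem exists_straightening (hd : finrank ℝ E + finrank ℝ F = finrank ℝ E') {g : E → E'} {U : Set E}
    (hU : IsOpen U) (hg : ContDiffOn ℝ ∞ g U)
    {u₀ : E} (hu₀ : u₀ ∈ U) (hinj : Function.Injective (fderiv ℝ g u₀)) :
    ∃ G : OpenPartialHomeomorph (E × F) E',
      (u₀, 0) ∈ G.source ∧ (∀ u, G (u, 0) = g u) ∧ ContDiffOn ℝ ∞ G G.source ∧
      ContDiffOn ℝ ∞ G.symm G.target := by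
  -- The extension is `(u, c) ↦ g u + L c`, where `L` maps `F` isomorphically onto a complement `C`
  -- of the image of the differential.
  obtain ⟨C, hC⟩ := (LinearMap.range (fderiv ℝ g u₀ : E →ₗ[ℝ] E')).exists_isCompl
  have hfr : finrank ℝ F = finrank ℝ C := by
    have h1 := Submodule.finrank_add_eq_of_isCompl hC
    rw [LinearMap.finrank_range_of_inj hinj] at h1
    omega
  let L : F →L[ℝ] E' := C.subtypeL.comp
    ((LinearEquiv.ofFinrankEq F C hfr).toContinuousLinearEquiv : F →L[ℝ] C)
  have hL : ∀ c, L c ∈ C := fun c => (LinearEquiv.ofFinrankEq F C hfr c).2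
  have hLi : ∀ c, L c = 0 → c = 0 := fun c hc =>
    (LinearEquiv.ofFinrankEq F C hfr).map_eq_zero_iff.1 (Subtype.ext hc)
  let A : E × F →ₗ[ℝ] E' := (fderiv ℝ g u₀ : E →ₗ[ℝ] E').coprod L
  have hA : Function.Injective A := by
    rw [← LinearMap.ker_eq_bot, LinearMap.ker_eq_bot']
    rintro ⟨u, c⟩ huc
    have h1 : fderiv ℝ g u₀ u + L c = 0 := huc
    have h2 : L c ∈ LinearMap.range (fderiv ℝ g u₀ : E →ₗ[ℝ] E') :=
      ⟨-u, by simpa using (neg_eq_of_add_eq_zero_right h1)⟩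
    have h3 : L c = 0 := by
      have := hC.disjoint.le_bot (⟨h2, hL c⟩ : L c ∈ _ ⊓ C)
      simpa using this
    rw [h3, add_zero] at h1
    have h4 : u = 0 := hinj (by rw [h1, map_zero])
    exact Prod.ext h4 (hLi c h3)
  let e : (E × F) ≃L[ℝ] E' :=
    (LinearEquiv.ofInjectiveOfFinrankEq A hA (by rw [finrank_prod, hd])).toContinuousLinearEquiv
  let Gf : E × F → E' := fun y => g y.1 + L y.2
  have hUC : IsOpen (U ×ˢ (Set.univ : Set F)) := hU.prod isOpen_univ
  have hGf : ContDiffOn ℝ ∞ Gf (U ×ˢ Set.univ) :=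
    (hg.comp contDiffOn_fst (fun y hy => hy.1)).add (L.contDiff.comp contDiff_snd).contDiffOn
  have hmem : ((u₀, 0) : E × F) ∈ U ×ˢ (Set.univ : Set F) := ⟨hu₀, trivial⟩
  have hGat : ContDiffAt ℝ ∞ Gf (u₀, 0) := hGf.contDiffAt (hUC.mem_nhds hmem)
  have hder : HasFDerivAt Gf (e : E × F →L[ℝ] E') (u₀, 0) := by
    have h1 : HasFDerivAt g (fderiv ℝ g u₀) ((u₀, 0) : E × F).1 :=
      ((hg.contDiffAt (hU.mem_nhds hu₀)).differentiableAt (by simp)).hasFDerivAt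
    refine ((h1.comp _ hasFDerivAt_fst).add
      (L.hasFDerivAt.comp ((u₀, 0) : E × F) hasFDerivAt_snd)).congr_fderiv ?_
    exact ContinuousLinearMap.ext fun y => rfl
  -- Keeping only points with invertible differential makes the inverse smooth on its whole domain
  -- and not just near one point.
  let W : Set (E × F) := (U ×ˢ Set.univ) ∩ fderiv ℝ Gf ⁻¹'
    Set.range ((↑) : ((E × F) ≃L[ℝ] E') → (E × F →L[ℝ] E'))
  have hW : IsOpen W := (hGf.continuousOn_fderiv_of_isOpen hUC (by simp)).isOpen_inter_preimage hUC
    ContinuousLinearEquiv.isOpen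
  have hmW : ((u₀, 0) : E × F) ∈ W := ⟨hmem, e, hder.fderiv.symm⟩
  let G := (hGat.toOpenPartialHomeomorph Gf hder (by simp)).restrOpen W hW
  have hGs : G.source ⊆ W := fun y hy => hy.2
  refine ⟨G, ⟨hGat.mem_toOpenPartialHomeomorph_source hder (by simp), hmW⟩, ?_, ?_, ?_⟩
  · intro u
    change g u + L 0 = g u
    simp
  · exact hGf.mono fun y hy => (hGs hy).1
  · intro z hz
    have h1 := hGs (G.map_target hz)
    obtain ⟨e', he'⟩ := h1.2
    have h2 : ContDiffAt ℝ ∞ Gf (G.symm z) := hGf.contDiffAt (hUC.mem_nhds h1.1)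
    refine (G.contDiffAt_symm hz (f₀' := e') ?_ h2).contDiffWithinAt
    rw [he']
    exact (h2.differentiableAt (by simp)).hasFDerivAt

variable [TopologicalSpace M] [ChartedSpace E M] [IsManifold 𝓘(ℝ, E) ∞ M]
  [TopologicalSpace N] [ChartedSpace E' N] [IsManifold 𝓘(ℝ, E') ∞ N]

/-- The coordinate expression of `f` is straightened by a local diffeomorphism `G` of `E × F` into
`E'`. Appending the inverse of `G` to the chart of the target brings `f` to the normal form `u ↦ (u,
0)`. -/
theorem isImmersion_of_injective_mfderiv (hd : finrank ℝ E + finrank ℝ F = finrank ℝ E') {f : M → N}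
    (hf : ContMDiff 𝓘(ℝ, E) 𝓘(ℝ, E') ∞ f)
    (hinj : ∀ x, Function.Injective (mfderiv 𝓘(ℝ, E) 𝓘(ℝ, E') f x)) :
    Manifold.IsImmersion 𝓘(ℝ, E) 𝓘(ℝ, E') ∞ f := by
  refine Manifold.IsImmersionOfComplement.isImmersion (F := F) fun x => ?_
  set φ := chartAt E x with hφ
  set ψ := chartAt E' (f x) with hψ
  let g : E → E' := ψ ∘ f ∘ φ.symm
  let U : Set E := φ.target ∩ φ.symm ⁻¹' (f ⁻¹' ψ.source)
  have hU : IsOpen U := φ.continuousOn_symm.isOpen_inter_preimage φ.open_target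
    (ψ.open_source.preimage hf.continuous)
  have hg : ContDiffOn ℝ ∞ g U := by
    intro u hu
    have h1 : ContMDiffAt 𝓘(ℝ, E) 𝓘(ℝ, E) ∞ φ.symm u :=
      contMDiffAt_symm_of_mem_maximalAtlas (IsManifold.chart_mem_maximalAtlas x) hu.1
    have h2 : ContMDiffAt 𝓘(ℝ, E') 𝓘(ℝ, E') ∞ ψ (f (φ.symm u)) :=
      contMDiffAt_of_mem_maximalAtlas (IsManifold.chart_mem_maximalAtlas (f x)) hu.2
    exact (h2.comp u ((hf _).comp u h1)).contDiffAt.contDiffWithinAt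
  have hu₀ : φ x ∈ U := ⟨mem_chart_target E x, by
    change f (φ.symm (φ x)) ∈ ψ.source
    rw [φ.left_inv (mem_chart_source E x)]
    exact mem_chart_source E' (f x)⟩
  have hder : fderiv ℝ g (φ x) = mfderiv 𝓘(ℝ, E) 𝓘(ℝ, E') f x := by
    rw [((hf x).mdifferentiableAt (by simp)).mfderiv]
    simp only [mfld_simps, fderivWithin_univ]
    rfl
  obtain ⟨G, hG0, hGg, hGs, hGt⟩ := exists_straightening (F := F) hd hU hg hu₀ (by
    rw [hder]; exact hinj x)
  let e : (E × F) ≃L[ℝ] E' := (LinearEquiv.ofFinrankEq (E × F) E' (by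
    rw [finrank_prod, hd])).toContinuousLinearEquiv
  let k : OpenPartialHomeomorph E' E' := G.symm.trans e.toHomeomorph.toOpenPartialHomeomorph
  have hk : ContDiffOn ℝ ∞ k k.source := by
    refine e.contDiff.comp_contDiffOn (hGt.mono ?_)
    intro y hy
    exact hy.1
  have hk' : ContDiffOn ℝ ∞ k.symm k.target := by
    refine hGs.comp (e.symm.contDiff.contDiffOn) ?_
    intro y hy
    exact hy.2
  -- The source chart is shrunk so that its coordinates `u` lie in `U` and `(u, 0)` lies in the
  -- source of `G`.
  let s : Set M := (φ.trans (OpenPartialHomeomorph.ofSet U hU)).source ∩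
    (φ.trans (OpenPartialHomeomorph.ofSet _ (G.open_source.preimage
      (by fun_prop : Continuous fun u : E => (u, (0 : F)))))).source
  have hs : IsOpen s := (OpenPartialHomeomorph.open_source _).inter (OpenPartialHomeomorph.open_source _)
  refine Manifold.IsImmersionAtOfComplement.mk_of_continuousAt hf.continuous.continuousAt e
    (φ.restr s) (ψ.trans k) ?_ ?_
    (restr_mem_maximalAtlas _ (IsManifold.chart_mem_maximalAtlas (n := ∞) (I := 𝓘(ℝ, E)) x) hs)
    (trans_mem_maximalAtlas (chart_mem_atlas E' (f x)) hk hk') ?_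
  · rw [OpenPartialHomeomorph.restr_source' _ _ hs]
    exact ⟨mem_chart_source E x, ⟨mem_chart_source E x, hu₀⟩, mem_chart_source E x, hG0⟩
  · refine ⟨mem_chart_source E' (f x), ?_, trivial⟩
    change ψ (f x) ∈ G.target
    have h := G.map_source hG0
    rw [hGg] at h
    simpa [g, φ.left_inv (mem_chart_source E x)] using h
  · intro u hu
    have hu1 : u ∈ φ.target ∧ φ.symm u ∈ s := by
      simpa [OpenPartialHomeomorph.restr_target, hs.interior_eq] using hu
    have hu2 : φ (φ.symm u) = u := φ.right_inv hu1.1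
    have hu3 : (φ (φ.symm u), (0 : F)) ∈ G.source := hu1.2.2.2
    rw [hu2] at hu3
    have h4 : G.symm (g u) = (u, 0) := by rw [← hGg, G.left_inv hu3]
    change e (G.symm (g u)) = e (u, 0)
    rw [h4]

end Immersion

/-! ### Complex coordinates -/

/-- The complex vector space `ℂⁿ⁺¹` containing the sphere `S²ⁿ⁺¹`. -/
abbrev Cx (n : ℕ) := EuclideanSpace ℂ (Fin (n + 1))

section Complex
variable {n : ℕ}

/-- The identification `(q, p) ↦ q + i p` of `ℝⁿ⁺¹ × ℝⁿ⁺¹` with `ℂⁿ⁺¹`. -/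
def cplx (n : ℕ) : (Euc n × Euc n) ≃L[ℝ] Cx n :=
  LinearEquiv.toContinuousLinearEquiv
    { toFun := fun x => WithLp.toLp 2 fun j => ⟨x.1 j, x.2 j⟩
      invFun := fun w => (WithLp.toLp 2 fun j => (w j).re, WithLp.toLp 2 fun j => (w j).im)
      map_add' := fun x y => by ext j; apply Complex.ext <;> simp
      map_smul' := fun c x => by ext j; apply Complex.ext <;> simp
      left_inv := fun x => by ext j <;> simp
      right_inv := fun w => by ext j; simp }

theorem cplx_apply (x : Euc n × Euc n) (j : Fin (n + 1)) : cplx n x j = ⟨x.1 j, x.2 j⟩ := rfl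

/-- Complex conjugation on `ℂⁿ⁺¹`. -/
def cj : Cx n →L[ℝ] Cx n :=
  LinearMap.toContinuousLinearMap
    { toFun := fun w => WithLp.toLp 2 fun j => conj (w j)
      map_add' := fun x y => by ext j; simp
      map_smul' := fun c x => by ext j; simp }

theorem cj_apply (w : Cx n) (j : Fin (n + 1)) : cj w j = conj (w j) := rfl

@[simp] theorem cj_cj (w : Cx n) : cj (cj w) = w := by
  ext j; simp [cj_apply]

@[simp] theorem cj_smul (c : ℂ) (w : Cx n) : cj (c • w) = conj c • cj w := by
  ext j; simp [cj_apply]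

/-- The complex bilinear form `∑ wⱼ vⱼ`. -/
def dot (w v : Cx n) : ℂ := ⟪cj w, v⟫_ℂ

theorem dot_eq_sum (w v : Cx n) : dot w v = ∑ j, w j * v j := by
  simp [dot, PiLp.inner_apply, cj_apply, mul_comm]

theorem dot_comm (w v : Cx n) : dot w v = dot v w := by
  simp [dot_eq_sum, mul_comm]

theorem conj_dot (w v : Cx n) : conj (dot w v) = dot (cj w) (cj v) := by
  simp [dot_eq_sum, cj_apply]

@[simp] theorem dot_add_left (w w' v : Cx n) : dot (w + w') v = dot w v + dot w' v := by
  simp [dot]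

@[simp] theorem dot_add_right (w v v' : Cx n) : dot w (v + v') = dot w v + dot w v' := by
  simp [dot]

@[simp] theorem dot_sub_left (w w' v : Cx n) : dot (w - w') v = dot w v - dot w' v := by
  simp [dot]

@[simp] theorem dot_sub_right (w v v' : Cx n) : dot w (v - v') = dot w v - dot w v' := by
  simp [dot]

@[simp] theorem dot_smul_left (c : ℂ) (w v : Cx n) : dot (c • w) v = c * dot w v := by
  simp [dot, mul_comm]

@[simp] theorem dot_smul_right (c : ℂ) (w v : Cx n) : dot w (c • v) = c * dot w v := by
  simp [dot]

theorem inner_eq_dot (w v : Cx n) : ⟪w, v⟫_ℂ = dot (cj w) v := by simp [dot]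

theorem dot_cj_self (w : Cx n) : dot (cj w) w = (‖w‖ : ℂ) ^ 2 := by
  rw [← inner_eq_dot, inner_self_eq_norm_sq_to_K]
  rfl

theorem norm_dot_self_le (w : Cx n) : ‖dot w w‖ ≤ ‖w‖ ^ 2 := by
  have h := norm_inner_le_norm (𝕜 := ℂ) (cj w) w
  have h2 : ‖cj w‖ = ‖w‖ := by
    simp [EuclideanSpace.norm_eq, cj_apply]
  rw [h2, ← pow_two] at h
  exact h

theorem dot_cplx (x y : Euc n × Euc n) :
    dot (cplx n x) (cplx n y) = ⟨⟪x.1, y.1⟫_ℝ - ⟪x.2, y.2⟫_ℝ, ⟪x.1, y.2⟫_ℝ + ⟪x.2, y.1⟫_ℝ⟩ := by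
  apply Complex.ext
  · simp [dot_eq_sum, cplx_apply, PiLp.inner_apply, mul_comm]
  · simp [dot_eq_sum, cplx_apply, PiLp.inner_apply, Finset.sum_add_distrib, mul_comm]

theorem dot_cj_cplx (x y : Euc n × Euc n) :
    dot (cj (cplx n x)) (cplx n y) =
      ⟨⟪x.1, y.1⟫_ℝ + ⟪x.2, y.2⟫_ℝ, ⟪x.1, y.2⟫_ℝ - ⟪x.2, y.1⟫_ℝ⟩ := by
  apply Complex.ext
  · simp [dot_eq_sum, cplx_apply, cj_apply, PiLp.inner_apply, Finset.sum_add_distrib, mul_comm]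
  · simp [dot_eq_sum, cplx_apply, cj_apply, PiLp.inner_apply, Finset.sum_add_distrib, mul_comm,
      sub_eq_add_neg, add_comm]

theorem HasDerivAt.dot {w v : ℝ → Cx n} {w' v' : Cx n} {τ : ℝ} (hw : HasDerivAt w w' τ)
    (hv : HasDerivAt v v' τ) :
    HasDerivAt (fun τ => dot (w τ) (v τ)) (dot (w τ) v' + dot w' (v τ)) τ :=
  HasDerivAt.inner ℂ (cj.hasFDerivAt.comp_hasDerivAt τ hw) hv

theorem contDiff_dot {m : ℕ∞ω} : ContDiff ℝ m fun w : Cx n => dot w w :=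
  cj.contDiff.inner ℂ contDiff_id

/-! ### Coordinates on the sphere: a frame and the square `dot w w` -/

/-- The vectors `q + i p` with `q`, `p` orthonormal. -/
def IsFrame (u : Cx n) : Prop := dot u u = 0 ∧ dot (cj u) u = 2

theorem isFrame_cplx {x : Euc n × Euc n} : IsFrame (cplx n x) ↔ x ∈ unitCotangentSphere n := by
  simp only [IsFrame, dot_cplx, dot_cj_cplx, unitCotangentSphere, Set.mem_ofPred_eq,
    real_inner_self_eq_norm_sq, Complex.ext_iff]
  simp only [real_inner_comm x.1 x.2, Complex.zero_re, Complex.zero_im, Complex.re_ofNat,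
    Complex.im_ofNat]
  constructor
  · rintro ⟨⟨h1, h2⟩, h3, -⟩
    have hq : ‖x.1‖ ^ 2 = 1 := by linarith
    have hp : ‖x.2‖ ^ 2 = 1 := by linarith
    refine ⟨?_, ?_, by linarith⟩
    · exact (pow_eq_one_iff_of_nonneg (norm_nonneg _) two_ne_zero).1 hq
    · exact (pow_eq_one_iff_of_nonneg (norm_nonneg _) two_ne_zero).1 hp
  · rintro ⟨h1, h2, h3⟩
    rw [h1, h2, h3]
    norm_num

namespace IsFrame
variable {u : Cx n} (hu : IsFrame u)
include hu

theorem dot_self : dot u u = 0 := hu.1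
theorem cj_dot : dot (cj u) u = 2 := hu.2
theorem dot_cj : dot u (cj u) = 2 := by rw [dot_comm]; exact hu.2
theorem cj_dot_cj : dot (cj u) (cj u) = 0 := by rw [← conj_dot, hu.1, map_zero]

end IsFrame

theorem IsFrame.smul {u : Cx n} (hu : IsFrame u) {g : ℂ} (hg : conj g * g = 1) : IsFrame (g • u) := by
  constructor
  · simp [hu.dot_self]
  · simp only [cj_smul, dot_smul_left, dot_smul_right, hu.cj_dot]
    linear_combination 2 * hg

/-- The function `√(1 - |Q|²)`. -/
def cosq (Q : ℂ) : ℝ := √(1 - ‖Q‖ ^ 2)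

/-- The coefficient `A = √(1 + cosq Q) / 2`. -/
def amp (Q : ℂ) : ℝ := √(1 + cosq Q) / 2

theorem cosq_pos {Q : ℂ} (hQ : ‖Q‖ < 1) : 0 < cosq Q :=
  Real.sqrt_pos.2 (by nlinarith [norm_nonneg Q])

theorem cosq_nonneg (Q : ℂ) : 0 ≤ cosq Q := Real.sqrt_nonneg _

theorem cosq_sq {Q : ℂ} (hQ : ‖Q‖ ≤ 1) : cosq Q ^ 2 = 1 - ‖Q‖ ^ 2 :=
  Real.sq_sqrt (by nlinarith [norm_nonneg Q])

theorem amp_pos (Q : ℂ) : 0 < amp Q :=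
  div_pos (Real.sqrt_pos.2 (by linarith [cosq_nonneg Q])) two_pos

theorem amp_sq (Q : ℂ) : 4 * amp Q ^ 2 = 1 + cosq Q := by
  have := Real.sq_sqrt (show 0 ≤ 1 + cosq Q by linarith [cosq_nonneg Q])
  simp only [amp]
  linear_combination this

theorem amp_ne_zero (Q : ℂ) : (amp Q : ℂ) ≠ 0 := by exact_mod_cast (amp_pos Q).ne'

theorem amp_sq' (Q : ℂ) : 4 * (amp Q : ℂ) ^ 2 = 1 + cosq Q := by exact_mod_cast amp_sq Q

theorem conj_mul_self {Q : ℂ} (hQ : ‖Q‖ ≤ 1) : conj Q * Q = 1 - (cosq Q : ℂ) ^ 2 := by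
  have h := cosq_sq hQ
  have h2 : conj Q * Q = ((‖Q‖ ^ 2 : ℝ) : ℂ) := by
    rw [Complex.conj_mul']; push_cast; rfl
  rw [h2, show ‖Q‖ ^ 2 = 1 - cosq Q ^ 2 by linarith]
  push_cast
  rfl

theorem contDiffAt_cosq {Q : ℂ} (hQ : ‖Q‖ < 1) : ContDiffAt ℝ ∞ cosq Q :=
  (contDiffAt_const.sub (contDiff_norm_sq ℝ).contDiffAt).sqrt (by nlinarith [norm_nonneg Q])

theorem contDiffAt_amp {Q : ℂ} (hQ : ‖Q‖ < 1) : ContDiffAt ℝ ∞ amp Q :=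
  ((contDiffAt_const.add (contDiffAt_cosq hQ)).sqrt (by linarith [cosq_nonneg Q])).div_const _

/-- The point of the sphere with frame `u` and square `Q`. -/
def theta (u : Cx n) (Q : ℂ) : Cx n := (amp Q : ℂ) • u + (Q / (4 * amp Q)) • cj u

/-- The frame of a point `w` of the sphere. -/
def frame (w : Cx n) : Cx n :=
  (2 / cosq (dot w w) : ℂ) • ((amp (dot w w) : ℂ) • w - (dot w w / (4 * amp (dot w w))) • cj w)

/-- Since `u` and `cj u` are isotropic, only the cross terms survive: 2 · A · (Q / 4A) · 2 = Q. -/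
theorem dot_theta {u : Cx n} (hu : IsFrame u) (Q : ℂ) : dot (theta u Q) (theta u Q) = Q := by
  have h := amp_ne_zero Q
  simp only [theta, dot_add_left, dot_add_right, dot_smul_left, dot_smul_right, hu.dot_self,
    hu.dot_cj, hu.cj_dot, hu.cj_dot_cj]
  field_simp
  ring

/-- With B = Q / 4A, the squared norm is 2 (A² + |B|²). The value of `amp` comes from setting this
equal to 1, a quadratic equation for A² with roots (1 ± √(1 - |Q|²)) / 4, of which the larger one
stays positive at Q = 0. -/
theorem norm_theta {u : Cx n} (hu : IsFrame u) {Q : ℂ} (hQ : ‖Q‖ ≤ 1) : ‖theta u Q‖ = 1 := by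
  have h := amp_ne_zero Q
  have h1 := amp_sq' Q
  have h2 := conj_mul_self hQ
  have h3 : dot (cj (theta u Q)) (theta u Q) = 1 := by
    simp only [theta, map_add, cj_smul, cj_cj, dot_add_left, dot_add_right, dot_smul_left,
      dot_smul_right, hu.dot_self, hu.dot_cj, hu.cj_dot, hu.cj_dot_cj, map_div₀, map_mul,
      Complex.conj_ofReal, map_ofNat]
    field_simp
    linear_combination 2 * h2 + (8 * (amp Q : ℂ) ^ 2 - 2 + 2 * cosq Q) * h1
  rw [dot_cj_self] at h3
  have h4 : ‖theta u Q‖ ^ 2 = 1 := by exact_mod_cast h3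
  exact (pow_eq_one_iff_of_nonneg (norm_nonneg _) two_ne_zero).1 h4

/-- This is the determinant of the linear system giving `w` and `cj w` in terms of `u` and `cj u`.
It vanishes only for |Q| = 1, where the point no longer determines the frame; elsewhere `frame`
solves the system. -/
theorem amp_sq_sub {Q : ℂ} (hQ : ‖Q‖ ≤ 1) :
    (amp Q : ℂ) ^ 2 - Q / (4 * amp Q) * (conj Q / (4 * amp Q)) = cosq Q / 2 := by
  have h := amp_ne_zero Q
  have h3 : Q / (4 * amp Q) * (conj Q / (4 * amp Q)) = conj Q * Q / (4 * (4 * (amp Q : ℂ) ^ 2)) := by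
    field_simp
  have h1 := amp_sq' Q
  have h4 : (1 + cosq Q : ℂ) ≠ 0 := by rw [← h1]; simpa using h
  rw [h3, h1, conj_mul_self hQ, show (amp Q : ℂ) ^ 2 = (1 + cosq Q) / 4 by rw [← h1]; ring]
  field_simp
  ring

theorem amp_sq_add {Q : ℂ} (hQ : ‖Q‖ ≤ 1) :
    (amp Q : ℂ) ^ 2 + Q / (4 * amp Q) * (conj Q / (4 * amp Q)) = 1 / 2 := by
  have h := amp_sq_sub hQ
  linear_combination (amp_sq' Q) / 2 - h

theorem frame_theta {u : Cx n} (hu : IsFrame u) {Q : ℂ} (hQ : ‖Q‖ < 1) : frame (theta u Q) = u := by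
  have h3 : (cosq Q : ℂ) ≠ 0 := by exact_mod_cast (cosq_pos hQ).ne'
  have h4 := amp_sq_sub hQ.le
  rw [frame, dot_theta hu]
  simp only [theta, map_add, cj_smul, cj_cj, map_div₀, map_mul, Complex.conj_ofReal, map_ofNat]
  set A : ℂ := (amp Q : ℂ)
  set B : ℂ := Q / (4 * A)
  set B' : ℂ := conj Q / (4 * A)
  have : (2 / cosq Q : ℂ) • (A • (A • u + B • cj u) - B • (A • cj u + B' • u)) =
      (2 / cosq Q * (A ^ 2 - B * B') : ℂ) • u := by module
  rw [this, h4]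
  rw [show (2 / cosq Q * (cosq Q / 2) : ℂ) = 1 by field_simp, one_smul]

theorem theta_frame {w : Cx n} (hQ : ‖dot w w‖ < 1) : theta (frame w) (dot w w) = w := by
  have h3 : (cosq (dot w w) : ℂ) ≠ 0 := by exact_mod_cast (cosq_pos hQ).ne'
  have h4 := amp_sq_sub hQ.le
  simp only [theta, frame, map_sub, cj_smul, cj_cj, map_div₀, map_mul, Complex.conj_ofReal,
    map_ofNat]
  set Q : ℂ := dot w w
  set A : ℂ := (amp Q : ℂ)
  set B : ℂ := Q / (4 * A)
  set B' : ℂ := conj Q / (4 * A)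
  have : A • (2 / cosq Q : ℂ) • (A • w - B • cj w) + B • (2 / cosq Q : ℂ) • (A • cj w - B' • w) =
      (2 / cosq Q * (A ^ 2 - B * B') : ℂ) • w := by module
  rw [this, h4]
  rw [show (2 / cosq Q * (cosq Q / 2) : ℂ) = 1 by field_simp, one_smul]

theorem isFrame_frame {w : Cx n} (hw : ‖w‖ = 1) (hQ : ‖dot w w‖ < 1) : IsFrame (frame w) := by
  have h3 : (cosq (dot w w) : ℂ) ≠ 0 := by exact_mod_cast (cosq_pos hQ).ne'
  have h5 := amp_sq_add hQ.le
  have h6 := conj_mul_self hQ.le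
  have h7 : dot (cj w) w = 1 := by rw [dot_cj_self, hw]; simp
  have h8 : dot (cj w) (cj w) = conj (dot w w) := (conj_dot w w).symm
  have h9 : dot w (cj w) = 1 := by rw [dot_comm, h7]
  have h := amp_ne_zero (dot w w)
  constructor
  · simp only [frame, dot_smul_left, dot_smul_right, dot_sub_left, dot_sub_right, h7, h8, h9]
    have h10 : (dot w w) / (4 * amp (dot w w)) * amp (dot w w) = dot w w / 4 := by field_simp
    linear_combination (2 / cosq (dot w w) : ℂ) ^ 2 * dot w w * h5 -
      2 * (2 / cosq (dot w w) : ℂ) ^ 2 * h10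
  · simp only [frame, map_sub, cj_smul, cj_cj, map_div₀, map_mul, Complex.conj_ofReal,
      map_ofNat, dot_smul_left, dot_smul_right, dot_sub_left, dot_sub_right, h7, h8, h9]
    have h10 : (dot w w) / (4 * amp (dot w w)) * amp (dot w w) = dot w w / 4 := by field_simp
    have h11 : conj (dot w w) / (4 * amp (dot w w)) * amp (dot w w) = conj (dot w w) / 4 := by
      field_simp
    have h12 : (2 / cosq (dot w w) : ℂ) ^ 2 * cosq (dot w w) ^ 2 = 4 := by field_simp; norm_num
    linear_combination (2 / cosq (dot w w) : ℂ) ^ 2 * h5 -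
      (2 / cosq (dot w w) : ℂ) ^ 2 * conj (dot w w) * h10 -
      (2 / cosq (dot w w) : ℂ) ^ 2 * (dot w w) * h11 -
      (2 / cosq (dot w w) : ℂ) ^ 2 / 2 * h6 + h12 / 2

theorem amp_smul {g : ℂ} (hg : ‖g‖ = 1) (Q : ℂ) : amp (g * Q) = amp Q := by
  simp [amp, cosq, hg]

/-- `amp` depends on |Q| only, and conjugating `g • u` costs a factor g⁻². This equivariance gives
smoothness of the page map at the zero section, and it shows that changing the sign of a frame
changes the sign of the point when Q is fixed. -/
theorem theta_smul {g : ℂ} (hg : ‖g‖ = 1) (u : Cx n) (Q : ℂ) :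
    theta (g • u) (g ^ 2 * Q) = g • theta u Q := by
  have hgg : g * conj g = 1 := by rw [Complex.mul_conj', hg]; simp
  rw [theta, theta, amp_smul (by simp [hg])]
  simp only [cj_smul]
  have : g ^ 2 * Q / (4 * amp Q) = g ^ 2 * (Q / (4 * amp Q)) := by ring
  rw [this]
  set B := Q / (4 * (amp Q : ℂ))
  have h2 : g ^ 2 * B * conj g = g * B := by linear_combination g * B * hgg
  rw [smul_smul (g ^ 2 * B), h2]
  module

theorem contDiffAt_theta {y : Cx n × ℂ} (hy : ‖y.2‖ < 1) :
    ContDiffAt ℝ ∞ (fun y : Cx n × ℂ => theta y.1 y.2) y := by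
  have h1 : ContDiffAt ℝ ∞ (fun y : Cx n × ℂ => (amp y.2 : ℂ)) y :=
    Complex.ofRealCLM.contDiff.contDiffAt.comp y ((contDiffAt_amp hy).comp y contDiffAt_snd)
  have h2 : ContDiffAt ℝ ∞ (fun y : Cx n × ℂ => y.2) y := contDiffAt_snd
  have h3 : ContDiffAt ℝ ∞ (fun y : Cx n × ℂ => y.2 / (4 * (amp y.2 : ℂ))) y :=
    h2.mul ((contDiffAt_const.mul h1).inv (mul_ne_zero (by norm_num) (amp_ne_zero _)))
  exact (h1.smul contDiffAt_fst).add (h3.smul (cj.contDiff.contDiffAt.comp y contDiffAt_fst))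

theorem contDiffAt_frame {w : Cx n} (hw : ‖dot w w‖ < 1) : ContDiffAt ℝ ∞ (frame : Cx n → Cx n) w := by
  have h0 : ContDiffAt ℝ ∞ (fun w : Cx n => dot w w) w := contDiff_dot.contDiffAt
  have h1 : ContDiffAt ℝ ∞ (fun w : Cx n => (amp (dot w w) : ℂ)) w :=
    Complex.ofRealCLM.contDiff.contDiffAt.comp w
      (ContDiffAt.comp w (f := fun w : Cx n => dot w w) (contDiffAt_amp hw) h0)
  have h2 : ContDiffAt ℝ ∞ (fun w : Cx n => (cosq (dot w w) : ℂ)) w :=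
    Complex.ofRealCLM.contDiff.contDiffAt.comp w
      (ContDiffAt.comp w (f := fun w : Cx n => dot w w) (contDiffAt_cosq hw) h0)
  have h3 : (cosq (dot w w) : ℂ) ≠ 0 := by exact_mod_cast (cosq_pos hw).ne'
  have h4 : ContDiffAt ℝ ∞ (fun w : Cx n => (2 / cosq (dot w w) : ℂ)) w :=
    contDiffAt_const.mul (h2.inv h3)
  have h5 : ContDiffAt ℝ ∞ (fun w : Cx n => dot w w / (4 * amp (dot w w))) w :=
    h0.mul ((contDiffAt_const.mul h1).inv (mul_ne_zero (by norm_num) (amp_ne_zero _)))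
  exact h4.smul ((h1.smul contDiffAt_id).sub (h5.smul cj.contDiff.contDiffAt))

/-- The differentials of `Im ⟪w, w⟫` and of `dot w w` along a curve `w = theta u Q`. -/
theorem hasDerivAt_theta {u : ℝ → Cx n} {Q : ℝ → ℂ} {u' : Cx n} {Q' : ℂ} (hu : HasDerivAt u u' 0)
    (hQ : HasDerivAt Q Q' 0) (hf : ∀ᶠ τ in 𝓝 0, IsFrame (u τ)) (hQ1 : ‖Q 0‖ < 1) {w' : Cx n}
    (hw : HasDerivAt (fun τ => theta (u τ) (Q τ)) w' 0) :
    2 * dot (theta (u 0) (Q 0)) w' = Q' ∧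
    (dot (cj (theta (u 0) (Q 0))) w').im = cosq (Q 0) / 2 * (dot (cj (u 0)) u').im +
      (conj (Q 0) * Q').im / (2 * (1 + cosq (Q 0))) := by
  have hf0 := hf.self_of_nhds
  constructor
  · have h1 := (HasDerivAt.dot hw hw).congr_of_eventuallyEq
      (hf.mono fun τ h => (dot_theta h (Q τ)).symm)
    rw [h1.unique hQ |>.symm, dot_comm w']
    ring
  · have hA : ∃ A' : ℝ, HasDerivAt (fun τ => amp (Q τ)) A' 0 := by
      have := ((contDiffAt_amp hQ1).differentiableAt (by simp)).hasFDerivAt.comp_hasDerivAt 0 hQ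
      exact ⟨_, this⟩
    obtain ⟨A', hA⟩ := hA
    have hA2 := hA.ofReal_comp
    have hB := hQ.div (hA2.const_mul (4 : ℂ)) (mul_ne_zero (by norm_num) (amp_ne_zero (Q 0)))
    have hw2 := (hA2.smul hu).add (hB.smul (cj.hasFDerivAt.comp_hasDerivAt 0 hu))
    have hw3 := hw.unique hw2
    simp only [Pi.div_apply, Function.comp_apply] at hw3
    have hd1 : dot (u 0) u' = 0 := by
      have h2 := (HasDerivAt.dot hu hu).unique ((hasDerivAt_const (0 : ℝ) (0 : ℂ)).congr_of_eventuallyEq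
        (hf.mono fun τ h => h.dot_self))
      rw [dot_comm u'] at h2
      linear_combination h2 / 2
    have hd2 : dot (cj (u 0)) (cj u') = 0 := by rw [← conj_dot, hd1, map_zero]
    have hd3 : dot (u 0) (cj u') = conj (dot (cj (u 0)) u') := by rw [conj_dot, cj_cj]
    have hA0 := amp_ne_zero (Q 0)
    have hsub := amp_sq_sub hQ1.le
    -- The derivative of the amplitude contributes a real number only. In the imaginary part the
    -- first two summands combine with coefficient A² - |B|² because of the conjugation in the
    -- second.
    have hkey : dot (cj (theta (u 0) (Q 0))) w' =
        ((amp (Q 0) ^ 2 : ℝ) : ℂ) * dot (cj (u 0)) u' +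
        ((‖Q 0‖ ^ 2 / (16 * amp (Q 0) ^ 2) : ℝ) : ℂ) * conj (dot (cj (u 0)) u') +
        ((2 * amp (Q 0) * A' - ‖Q 0‖ ^ 2 * A' / (8 * amp (Q 0) ^ 3) : ℝ) : ℂ) +
        ((1 / (8 * amp (Q 0) ^ 2) : ℝ) : ℂ) * (conj (Q 0) * Q') := by
      rw [hw3, theta]
      simp only [map_add, cj_smul, cj_cj, dot_add_left, dot_add_right, dot_smul_left,
        dot_smul_right, hf0.dot_self, hf0.dot_cj, hf0.cj_dot, hf0.cj_dot_cj, map_div₀,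
        map_mul, Complex.conj_ofReal, map_ofNat, hd1, hd2, hd3]
      push_cast
      rw [← Complex.mul_conj' (Q 0)]
      field_simp
      ring
    have hre : amp (Q 0) ^ 2 - ‖Q 0‖ ^ 2 / (16 * amp (Q 0) ^ 2) = cosq (Q 0) / 2 := by
      have h1 : Q 0 / (4 * amp (Q 0)) * (conj (Q 0) / (4 * amp (Q 0))) =
          (‖Q 0‖ : ℂ) ^ 2 / (16 * (amp (Q 0) : ℂ) ^ 2) := by
        rw [← Complex.mul_conj' (Q 0)]
        field_simp
        ring
      rw [h1] at hsub
      exact_mod_cast hsub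
    have h8 : 8 * amp (Q 0) ^ 2 = 2 * (1 + cosq (Q 0)) := by rw [← amp_sq]; ring
    rw [hkey]
    simp only [Complex.add_im, Complex.im_ofReal_mul, Complex.conj_im, Complex.ofReal_im]
    rw [← hre, h8]
    ring

end Complex

namespace OpenBookData
variable (D : OpenBookData)

/-! ### The radial profile -/

/-- The slope of the radial profile near the binding. -/
def slope : ℝ := 1 / (4 * (1 + D.r₀))

theorem slope_pos : 0 < D.slope := by
  have := D.r₀_pos
  exact div_pos one_pos (by linarith)

/-- The radial profile as a function of the norm `ρ` of a covector. -/
def radius (ρ : ℝ) : ℝ :=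
  (1 - Real.smoothTransition (Real.log ρ)) * (1 - ρ ^ 2 / 18) +
    Real.smoothTransition (Real.log ρ) * (D.slope * (1 + D.r₀ - Real.log ρ))

/-- The radial profile as a function of `t = log ρ`. -/
def sig (t : ℝ) : ℝ := D.radius (Real.exp t)

theorem radius_of_pos {ρ : ℝ} (hρ : 0 < ρ) : D.radius ρ = D.sig (Real.log ρ) := by
  rw [sig, Real.exp_log hρ]

theorem radius_of_le_one {ρ : ℝ} (h0 : 0 ≤ ρ) (h1 : ρ ≤ 1) : D.radius ρ = 1 - ρ ^ 2 / 18 := by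
  simp [radius, Real.smoothTransition.zero_of_nonpos (Real.log_nonpos h0 h1)]

theorem sig_eq (t : ℝ) : D.sig t = (1 - Real.smoothTransition t) * (1 - Real.exp (2 * t) / 18) +
    Real.smoothTransition t * (D.slope * (1 + D.r₀ - t)) := by
  rw [sig, radius, Real.log_exp, ← Real.exp_nat_mul]
  norm_num

/-- Affine near the binding, so that `expand` is multiplication by the constant `slope` near `0`,
hence smooth there although the norm is not. -/
theorem sig_of_one_le {t : ℝ} (ht : 1 ≤ t) : D.sig t = D.slope * (1 + D.r₀ - t) := by
  rw [sig_eq, Real.smoothTransition.one_of_one_le ht]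
  ring

/-- With ρ = eᵗ this is chosen so that √((1 - σ)/2) = ρ/6. The imaginary part of the page map is
then p/6 up to a rotation, and no singularity arises at p = 0. -/
theorem sig_of_nonpos {t : ℝ} (ht : t ≤ 0) : D.sig t = 1 - Real.exp (2 * t) / 18 := by
  rw [sig_eq, Real.smoothTransition.zero_of_nonpos ht]
  ring

theorem contDiff_sig : ContDiff ℝ ∞ D.sig := by
  have hT : ContDiff ℝ ∞ Real.smoothTransition := Real.smoothTransition.contDiff
  rw [show D.sig = _ from funext D.sig_eq]
  fun_prop

theorem deriv_smoothTransition_eq_zero {t : ℝ} (ht : t < 0 ∨ 1 < t) :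
    deriv Real.smoothTransition t = 0 := by
  rcases ht with ht | ht
  · have : Real.smoothTransition =ᶠ[𝓝 t] fun _ => 0 := by
      filter_upwards [Iio_mem_nhds ht] with s hs using Real.smoothTransition.zero_of_nonpos hs.le
    rw [this.deriv_eq, deriv_const]
  · have : Real.smoothTransition =ᶠ[𝓝 t] fun _ => 1 := by
      filter_upwards [Ioi_mem_nhds ht] with s hs using Real.smoothTransition.one_of_one_le hs.le
    rw [this.deriv_eq, deriv_const]

theorem exp_two_mul_le {t : ℝ} (ht : t ≤ 1) : Real.exp (2 * t) ≤ 9 := by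
  have h1 : Real.exp (2 * t) ≤ Real.exp 1 * Real.exp 1 := by
    rw [← Real.exp_add]
    exact Real.exp_le_exp.2 (by linarith)
  nlinarith [Real.exp_one_lt_d9, Real.exp_pos 1]

theorem slope_mul_le {t : ℝ} (ht : 0 ≤ t) : D.slope * (1 + D.r₀ - t) ≤ 1 / 4 := by
  have := D.r₀_pos
  rw [slope, div_mul_eq_mul_div, div_le_iff₀ (by linarith)]
  linarith

/-- Both interpolated functions decrease. The switch on 0 ≤ t ≤ 1 from the first to the second
decreases too: there the first is at least 1/2, since e² ≤ 9, and the second at most 1/4, by the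
choice of `slope`. -/
theorem deriv_sig_neg (t : ℝ) : deriv D.sig t < 0 := by
  have hT : HasDerivAt Real.smoothTransition (deriv Real.smoothTransition t) t :=
    (Real.smoothTransition.contDiff (n := 1)).differentiable (by simp) t |>.hasDerivAt
  have he : HasDerivAt (fun t => 1 - Real.exp (2 * t) / 18) (-(Real.exp (2 * t) * 2 / 18)) t := by
    have := ((((hasDerivAt_id t).const_mul 2).exp).div_const 18).const_sub 1
    simpa using this
  have hb : HasDerivAt (fun t => D.slope * (1 + D.r₀ - t)) (D.slope * -1) t :=
    ((hasDerivAt_id t).const_sub _).const_mul _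
  have hd := ((hT.const_sub 1).mul he).add (hT.mul hb)
  have hs : D.sig = (((fun x => 1 - Real.smoothTransition x) * fun t => 1 - Real.exp (2 * t) / 18) +
      Real.smoothTransition * fun t => D.slope * (1 + D.r₀ - t)) := funext D.sig_eq
  rw [← hs] at hd
  rw [hd.deriv]
  set T := Real.smoothTransition t
  set T' := deriv Real.smoothTransition t with hT'
  have h0 : 0 ≤ T := Real.smoothTransition.nonneg t
  have h1 : T ≤ 1 := Real.smoothTransition.le_one t
  have h2 : 0 ≤ T' := Real.smoothTransition.monotone.deriv_nonneg
  have hsl := D.slope_pos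
  have hex := Real.exp_pos (2 * t)
  have h3 : 0 ≤ T' * ((1 - Real.exp (2 * t) / 18) - D.slope * (1 + D.r₀ - t)) := by
    by_cases h : t < 0 ∨ 1 < t
    · rw [hT', deriv_smoothTransition_eq_zero h, zero_mul]
    · push Not at h
      refine mul_nonneg h2 ?_
      linarith [exp_two_mul_le h.2, D.slope_mul_le h.1]
  have h4 : 0 < (1 - T) * (Real.exp (2 * t) * 2 / 18) + T * D.slope := by
    rcases h1.lt_or_eq with h | h
    · have : 0 < (1 - T) * (Real.exp (2 * t) * 2 / 18) := mul_pos (by linarith) (by positivity)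
      have : 0 ≤ T * D.slope := by positivity
      linarith
    · rw [h]
      linarith
  linarith

theorem strictAnti_sig : StrictAnti D.sig := strictAnti_of_deriv_neg D.deriv_sig_neg

theorem sig_lt_one (t : ℝ) : D.sig t < 1 := by
  have h : ∀ t ≤ 0, D.sig t < 1 := fun t ht => by
    rw [D.sig_of_nonpos ht]
    linarith [Real.exp_pos (2 * t)]
  rcases le_total t 0 with ht | ht
  · exact h t ht
  · exact (D.strictAnti_sig.antitone ht).trans_lt (h 0 le_rfl)

theorem sig_zero : D.sig (1 + D.r₀) = 0 := by
  rw [D.sig_of_one_le (by linarith [D.r₀_pos])]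
  ring

theorem exists_sig_eq {s : ℝ} (hs : s < 1) : ∃ t, D.sig t = s := by
  obtain ⟨a, ha⟩ : ∃ a, s ≤ D.sig a := by
    refine ⟨min 0 (Real.log (1 - s) / 2), ?_⟩
    rw [D.sig_of_nonpos (min_le_left _ _)]
    have h1 : Real.exp (2 * min 0 (Real.log (1 - s) / 2)) ≤ 1 - s := by
      rw [← Real.le_log_iff_exp_le (by linarith)]
      linarith [min_le_right 0 (Real.log (1 - s) / 2)]
    linarith
  obtain ⟨b, hb⟩ : ∃ b, D.sig b ≤ s := by
    have hsl := D.slope_pos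
    refine ⟨max 1 (1 + D.r₀ - s / D.slope), ?_⟩
    rw [D.sig_of_one_le (le_max_left _ _)]
    have h1 := le_max_right 1 (1 + D.r₀ - s / D.slope)
    have h2 : D.slope * (1 + D.r₀ - max 1 (1 + D.r₀ - s / D.slope)) ≤ D.slope * (s / D.slope) :=
      mul_le_mul_of_nonneg_left (by linarith) hsl.le
    rwa [mul_div_cancel₀ _ hsl.ne'] at h2
  exact mem_range_of_exists_le_of_exists_ge D.contDiff_sig.continuous ⟨b, hb⟩ ⟨a, ha⟩

/-- The inverse of the radial profile. -/
def tinv : ℝ → ℝ := Function.invFun D.sig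

theorem tinv_sig (t : ℝ) : D.tinv (D.sig t) = t := Function.leftInverse_invFun D.strictAnti_sig.injective t

theorem sig_tinv {s : ℝ} (hs : s < 1) : D.sig (D.tinv s) = s := Function.invFun_eq (D.exists_sig_eq hs)

theorem contDiffAt_tinv {s : ℝ} (hs : s < 1) : ContDiffAt ℝ ∞ D.tinv s := by
  have h1 : ContDiffAt ℝ ∞ D.sig (D.tinv s) := D.contDiff_sig.contDiffAt
  have h2 := (h1.differentiableAt (by simp)).hasDerivAt
  have h3 := h2.hasFDerivAt_equiv (D.deriv_sig_neg _).ne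
  have h4 := h1.to_localInverse h3 (by simp)
  rw [D.sig_tinv hs] at h4
  refine h4.congr_of_eventuallyEq ?_
  have h5 := (h1.hasStrictFDerivAt' h3 (by simp)).eventually_right_inverse
  rw [D.sig_tinv hs] at h5
  filter_upwards [h5] with y hy
  rw [← hy, D.tinv_sig]
  exact congrArg _ hy.symm

theorem tinv_lt_iff {s t : ℝ} (hs : s < 1) : D.tinv s < t ↔ D.sig t < s := by
  conv_rhs => rw [← D.sig_tinv hs]
  exact D.strictAnti_sig.lt_iff_gt.symm

theorem lt_tinv_iff {s t : ℝ} (hs : s < 1) : t < D.tinv s ↔ s < D.sig t := by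
  conv_rhs => rw [← D.sig_tinv hs]
  exact D.strictAnti_sig.lt_iff_gt.symm

theorem radius_pos {ρ : ℝ} (h0 : 0 ≤ ρ) (h1 : ρ < Real.exp 1) : 0 < D.radius ρ := by
  rcases h0.eq_or_lt with rfl | h0
  · rw [D.radius_of_le_one le_rfl zero_le_one]
    norm_num
  · rw [D.radius_of_pos h0, ← D.sig_zero]
    refine D.strictAnti_sig ?_
    have := (Real.log_lt_iff_lt_exp h0).2 h1
    linarith [D.r₀_pos]

theorem radius_lt_one {ρ : ℝ} (h0 : 0 < ρ) : D.radius ρ < 1 := by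
  rw [D.radius_of_pos h0]
  exact D.sig_lt_one _

theorem radius_zero : D.radius 0 = 1 := by
  rw [D.radius_of_le_one le_rfl zero_le_one]
  norm_num

/-! ### Scaling in the radial direction -/

/-- The diffeomorphism of the disk factor near the binding onto the disk of squares `dot w w`. -/
def expand (z : ℂ) : ℂ := ((D.sig (1 + D.r₀ - ‖z‖) / ‖z‖ : ℝ) : ℂ) * z

/-- The inverse of `expand`. -/
def shrink (Q : ℂ) : ℂ := (((1 + D.r₀ - D.tinv ‖Q‖) / ‖Q‖ : ℝ) : ℂ) * Q

theorem norm_expand (z : ℂ) : ‖D.expand z‖ = D.sig (1 + D.r₀ - ‖z‖) := by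
  rcases eq_or_ne z 0 with rfl | hz
  · simp [expand, D.sig_zero]
  · have h0 : 0 ≤ D.sig (1 + D.r₀ - ‖z‖) := by
      rw [← D.sig_zero]
      exact D.strictAnti_sig.antitone (by linarith [norm_nonneg z])
    have := norm_pos_iff.2 hz
    rw [expand, norm_mul, Complex.norm_real, Real.norm_of_nonneg (by positivity)]
    field_simp

theorem tinv_zero : D.tinv 0 = 1 + D.r₀ := by rw [← D.sig_zero, D.tinv_sig]

theorem norm_shrink {Q : ℂ} (hQ : ‖Q‖ < 1) : ‖D.shrink Q‖ = 1 + D.r₀ - D.tinv ‖Q‖ := by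
  rcases eq_or_ne Q 0 with rfl | hz
  · simp [shrink, D.tinv_zero]
  · have h0 : 0 ≤ 1 + D.r₀ - D.tinv ‖Q‖ := by
      by_contra! h
      have := (D.lt_tinv_iff (t := 1 + D.r₀) hQ).1 (by linarith)
      rw [D.sig_zero] at this
      linarith [norm_nonneg Q]
    have := norm_pos_iff.2 hz
    rw [shrink, norm_mul, Complex.norm_real, Real.norm_of_nonneg (by positivity)]
    field_simp

theorem shrink_expand (z : ℂ) : D.shrink (D.expand z) = z := by
  rcases eq_or_ne z 0 with rfl | hz
  · simp [shrink, expand]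
  · have h0 : 0 < D.sig (1 + D.r₀ - ‖z‖) := by
      rw [← D.sig_zero]
      exact D.strictAnti_sig (by linarith [norm_pos_iff.2 hz])
    have := norm_pos_iff.2 hz
    rw [shrink, D.norm_expand, D.tinv_sig, expand, ← mul_assoc, ← Complex.ofReal_mul,
      show (1 + D.r₀ - (1 + D.r₀ - ‖z‖)) / D.sig (1 + D.r₀ - ‖z‖) *
        (D.sig (1 + D.r₀ - ‖z‖) / ‖z‖) = 1 by field_simp; ring]
    simp

theorem expand_shrink {Q : ℂ} (hQ : ‖Q‖ < 1) : D.expand (D.shrink Q) = Q := by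
  rcases eq_or_ne Q 0 with rfl | hz
  · simp [shrink, expand]
  · have hr := D.norm_shrink hQ
    have hs : D.shrink Q ≠ 0 := by
      rw [← norm_pos_iff, hr]
      have := (D.tinv_lt_iff (t := 1 + D.r₀) hQ).2 (by rw [D.sig_zero]; exact norm_pos_iff.2 hz)
      linarith
    have h1 := norm_pos_iff.2 hs
    have h2 := norm_pos_iff.2 hz
    rw [expand, hr, show 1 + D.r₀ - (1 + D.r₀ - D.tinv ‖Q‖) = D.tinv ‖Q‖ by ring, D.sig_tinv hQ,
      shrink, ← mul_assoc, ← Complex.ofReal_mul]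
    rw [hr] at h1
    rw [show ‖Q‖ / (1 + D.r₀ - D.tinv ‖Q‖) * ((1 + D.r₀ - D.tinv ‖Q‖) / ‖Q‖) = 1 by field_simp]
    simp

theorem contDiff_expand : ContDiff ℝ ∞ D.expand := by
  rw [contDiff_iff_contDiffAt]
  intro z
  rcases eq_or_ne z 0 with rfl | hz
  · have : D.expand =ᶠ[𝓝 0] fun z => (D.slope : ℂ) * z := by
      filter_upwards [Metric.ball_mem_nhds (0 : ℂ) D.r₀_pos] with z hz
      rw [mem_ball_zero_iff] at hz
      rcases eq_or_ne z 0 with rfl | h0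
      · simp [expand]
      · have := norm_pos_iff.2 h0
        rw [expand, D.sig_of_one_le (by linarith)]
        rw [show D.slope * (1 + D.r₀ - (1 + D.r₀ - ‖z‖)) / ‖z‖ = D.slope by field_simp; ring]
    exact (contDiffAt_const.mul contDiffAt_id).congr_of_eventuallyEq this
  · have hn := contDiffAt_norm (n := ∞) ℝ hz
    have h1 : ContDiffAt ℝ ∞ (fun z : ℂ => D.sig (1 + D.r₀ - ‖z‖) / ‖z‖) z :=
      (D.contDiff_sig.contDiffAt.comp z (contDiffAt_const.sub hn)).div hn (norm_ne_zero_iff.2 hz)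
    exact (Complex.ofRealCLM.contDiff.contDiffAt.comp z h1).mul contDiffAt_id

theorem contDiffAt_shrink {Q : ℂ} (hQ : ‖Q‖ < 1) : ContDiffAt ℝ ∞ D.shrink Q := by
  rcases eq_or_ne Q 0 with rfl | hz
  · have : D.shrink =ᶠ[𝓝 0] fun z => ((1 / D.slope : ℝ) : ℂ) * z := by
      -- The value `slope * r₀` is that of the profile at t = 1; for smaller squares the inverse
      -- profile is affine.
      have h1 : 0 < min 1 (D.slope * D.r₀) := lt_min one_pos (mul_pos D.slope_pos D.r₀_pos)
      filter_upwards [Metric.ball_mem_nhds (0 : ℂ) h1] with z hz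
      rw [mem_ball_zero_iff, lt_min_iff] at hz
      rcases eq_or_ne z 0 with rfl | h0
      · simp [shrink]
      · have := norm_pos_iff.2 h0
        have hsl := D.slope_pos
        have h2 : ‖z‖ / D.slope < D.r₀ := by rw [div_lt_iff₀ hsl]; linarith
        have h3 : D.sig (1 + D.r₀ - ‖z‖ / D.slope) = ‖z‖ := by
          rw [D.sig_of_one_le (by linarith)]
          field_simp
          ring
        have h4 : D.tinv ‖z‖ = 1 + D.r₀ - ‖z‖ / D.slope := by
          conv_lhs => rw [← h3, D.tinv_sig]
        rw [shrink, h4, show (1 + D.r₀ - (1 + D.r₀ - ‖z‖ / D.slope)) / ‖z‖ = 1 / D.slope by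
          field_simp; ring]
    exact (contDiffAt_const.mul contDiffAt_id).congr_of_eventuallyEq this
  · have hn := contDiffAt_norm (n := ∞) ℝ hz
    have h1 : ContDiffAt ℝ ∞ (fun z : ℂ => (1 + D.r₀ - D.tinv ‖z‖) / ‖z‖) Q :=
      (contDiffAt_const.sub ((D.contDiffAt_tinv hQ).comp Q hn)).div hn (norm_ne_zero_iff.2 hz)
    exact (Complex.ofRealCLM.contDiff.contDiffAt.comp Q h1).mul contDiffAt_id

/-! ### The functions `U` and the coefficients of the contact form -/

theorem hasDerivAt_U (t : ℝ) : HasDerivAt D.U (-(deriv D.f t * Real.exp t)) t :=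
  (intervalIntegral.integral_hasDerivAt_right (D.continuous_integrand.intervalIntegrable 0 t)
    (D.continuous_integrand.stronglyMeasurableAtFilter _ _)
    D.continuous_integrand.continuousAt).const_sub _

theorem contDiff_U : ContDiff ℝ ∞ D.U := by
  have h : deriv D.U = fun t => -(deriv D.f t * Real.exp t) := funext fun t => (D.hasDerivAt_U t).deriv
  refine contDiff_infty_iff_deriv.2 ⟨fun t => (D.hasDerivAt_U t).differentiableAt, ?_⟩
  rw [h]
  exact ((contDiff_infty_iff_deriv.1 D.f_smooth).2.mul Real.contDiff_exp).neg

/-- The coefficient `h₁`, as a function of `t`. -/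
def H₁ (t : ℝ) : ℝ := if t < 1 then Real.exp t else D.h ((1 + D.r₀ - t) ^ 2)

/-- The coefficient `h₂`, as a function of `t`. -/
def H₂ (t : ℝ) : ℝ :=
  if t < 1 then (D.U t + Real.exp t * D.f t) / (2 * Real.pi)
  else (1 + D.r₀ - t) ^ 2 * D.k ((1 + D.r₀ - t) ^ 2)

theorem H₁_page {t : ℝ} (ht : t < 1) : D.H₁ t = Real.exp t := if_pos ht

/-- The summand with `f` arises when the Liouville form is rewritten in the frame rotated by fθ/2π.
-/
theorem H₂_page {t : ℝ} (ht : t < 1) : D.H₂ t = (D.U t + Real.exp t * D.f t) / (2 * Real.pi) :=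
  if_pos ht

/-- The gluing conditions make the two branches agree on the collar 1 - δ < t < 1. So near t = 1 the
binding formula holds on both sides, and the case distinction does no harm to smoothness. -/
theorem H₁_binding {t : ℝ} (ht : 1 - D.δ < t) : D.H₁ t = D.h ((1 + D.r₀ - t) ^ 2) := by
  by_cases h : t < 1
  · rw [D.H₁_page h, D.h_glue (1 + D.r₀ - t) (by linarith) (by linarith)]
    congr 1
    ring
  · exact if_neg h

theorem H₂_binding {t : ℝ} (ht : 1 - D.δ < t) :
    D.H₂ t = (1 + D.r₀ - t) ^ 2 * D.k ((1 + D.r₀ - t) ^ 2) := by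
  by_cases h : t < 1
  · rw [D.H₂_page h, D.k_glue (1 + D.r₀ - t) (by linarith) (by linarith), D.f_collar t ht.le,
      D.U_collar ht.le, mul_zero, add_zero]
    rfl
  · exact if_neg h

theorem H₁_pos {t : ℝ} (ht : t ≤ 1 + D.r₀) : 0 < D.H₁ t := by
  by_cases h : t < 1
  · rw [D.H₁_page h]
    exact Real.exp_pos _
  · push Not at h
    rw [D.H₁_binding (by linarith [D.δ_pos])]
    have := D.δ_pos
    exact D.h_pos _ (sq_nonneg _) (pow_lt_pow_left₀ (by linarith) (by linarith) two_ne_zero)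

/-- On the page the ratio is (U e⁻ᵗ + f)/2π, and U' = -f' eᵗ cancels f', leaving the derivative -U
e⁻ᵗ/2π. Near the binding the sign is that of the contact condition, reversed because s = (1 + r₀ -
t)² decreases in t. -/
theorem ratio_deriv_neg {t : ℝ} (ht : t < 1 + D.r₀) :
    DifferentiableAt ℝ (fun t => D.H₂ t / D.H₁ t) t ∧ deriv (fun t => D.H₂ t / D.H₁ t) t < 0 := by
  suffices ∃ d < 0, HasDerivAt (fun t => D.H₂ t / D.H₁ t) d t by
    obtain ⟨d, hd, h⟩ := this
    exact ⟨h.differentiableAt, h.deriv ▸ hd⟩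
  by_cases h : t < 1
  · have hf : HasDerivAt D.f (deriv D.f t) t := (D.f_smooth.differentiable (by simp) t).hasDerivAt
    have h1 := (((D.hasDerivAt_U t).mul (hasDerivAt_id t).neg.exp).add hf).div_const (2 * Real.pi)
    refine ⟨_, ?_, h1.congr_of_eventuallyEq ?_⟩
    · have := D.U_pos t
      have h2 : Real.exp t * Real.exp (-t) = 1 := by rw [← Real.exp_add]; simp
      have h3 : 0 < D.U t * Real.exp (-t) := by positivity
      refine div_neg_of_neg_of_pos ?_ (by positivity)
      simp only [Pi.neg_apply, id]
      have h4 : deriv D.f t * Real.exp t * Real.exp (-t) = deriv D.f t := by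
        linear_combination deriv D.f t * h2
      linarith
    · filter_upwards [Iio_mem_nhds h] with s hs
      rw [D.H₁_page hs, D.H₂_page hs]
      simp [Real.exp_neg]
      field_simp
  · push Not at h
    have hδ := D.δ_pos
    set x := (1 + D.r₀ - t) ^ 2 with hx
    have hx0 : 0 ≤ x := sq_nonneg _
    have hx1 : x < (D.r₀ + D.δ) ^ 2 := pow_lt_pow_left₀ (by linarith) (by linarith) two_ne_zero
    have hh : HasDerivAt D.h (deriv D.h x) x := (D.h_smooth.differentiable (by simp) x).hasDerivAt
    have hk : HasDerivAt (fun s => s * D.k s) (deriv (fun s => s * D.k s) x) x :=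
      ((contDiff_id.mul D.k_smooth).differentiable (by simp) x).hasDerivAt
    have hp := D.h_pos x hx0 hx1
    have hr : HasDerivAt (fun t => (1 + D.r₀ - t) ^ 2) (2 * (1 + D.r₀ - t) * -1) t := by
      simpa using ((hasDerivAt_id t).const_sub (1 + D.r₀)).fun_pow 2
    have h1 := (hk.div hh hp.ne').comp t hr
    refine ⟨_, ?_, h1.congr_of_eventuallyEq ?_⟩
    · have hc := D.contact x hx0 hx1
      have h2 : 0 < (deriv (fun s => s * D.k s) x * D.h x - x * D.k x * deriv D.h x) / D.h x ^ 2 :=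
        div_pos (by linarith) (by positivity)
      exact mul_neg_of_pos_of_neg h2 (by linarith)
    · filter_upwards [Ioi_mem_nhds (show 1 - D.δ < t by linarith)] with s hs
      rw [D.H₁_binding hs, D.H₂_binding hs]
      rfl

/-- This adds the endpoint t = 1 + r₀, the core of the binding, which the strict inequality on the
derivative leaves out. -/
theorem continuousOn_ratio : ContinuousOn (fun t => D.H₂ t / D.H₁ t) (Set.Iic (1 + D.r₀)) := by
  intro t ht
  rcases (show t ≤ 1 + D.r₀ from ht).lt_or_eq with h | rfl
  · exact (D.ratio_deriv_neg h).1.continuousAt.continuousWithinAt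
  · have hδ := D.δ_pos
    have hr := D.r₀_pos
    have hp := D.h_pos 0 le_rfl (by positivity)
    have h1 : ContinuousAt (fun t => (1 + D.r₀ - t) ^ 2 * D.k ((1 + D.r₀ - t) ^ 2) /
        D.h ((1 + D.r₀ - t) ^ 2)) (1 + D.r₀) := by
      have := D.k_smooth.continuous
      have := D.h_smooth.continuous
      refine ContinuousAt.div (by fun_prop) (by fun_prop) ?_
      simpa using hp.ne'
    refine (h1.congr ?_).continuousWithinAt
    filter_upwards [Ioi_mem_nhds (show 1 - D.δ < 1 + D.r₀ by linarith)] with s hs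
    rw [D.H₁_binding hs, D.H₂_binding hs]

theorem strictAntiOn_ratio : StrictAntiOn (fun t => D.H₂ t / D.H₁ t) (Set.Iic (1 + D.r₀)) :=
  strictAntiOn_of_deriv_neg (convex_Iic _) D.continuousOn_ratio fun t ht => by
    rw [interior_Iic] at ht
    exact (D.ratio_deriv_neg ht).2

/-- The circle action is tangent to the contact structure at exactly one level of `t`. -/
theorem exists_level : ∃ t₀ < 1 + D.r₀, ∀ t ≤ 1 + D.r₀, 2 * D.H₂ t = D.H₁ t ↔ t = t₀ := by
  have hr := D.r₀_pos
  have hp := Real.pi_pos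
  have hδ := D.δ_pos
  -- The ratio at t = 0 is (C + π)/2π. It is the value π of the twisting profile that lifts it above
  -- 1/2, whatever C is.
  have h0 : 1 / 2 ≤ D.H₂ 0 / D.H₁ 0 := by
    rw [D.H₁_page one_pos, D.H₂_page one_pos, D.f_of_le le_rfl, D.U_of_le le_rfl, Real.exp_zero,
      div_one, le_div_iff₀ (by positivity)]
    linarith [D.C_pos]
  have h1 : D.H₂ (1 + D.r₀) / D.H₁ (1 + D.r₀) = 0 := by
    rw [D.H₂_binding (by linarith)]
    simp
  obtain ⟨t₀, ht, h⟩ := intermediate_value_Icc' (show 0 ≤ 1 + D.r₀ by linarith)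
    (D.continuousOn_ratio.mono Set.Icc_subset_Iic_self)
    (show (1 / 2 : ℝ) ∈ Set.Icc _ _ from ⟨by rw [h1]; norm_num, h0⟩)
  have hiff : ∀ t ≤ 1 + D.r₀, 2 * D.H₂ t = D.H₁ t ↔ D.H₂ t / D.H₁ t = 1 / 2 := fun t ht => by
    rw [div_eq_div_iff (D.H₁_pos ht).ne' two_ne_zero]
    constructor <;> intro h <;> linarith
  refine ⟨t₀, ht.2.lt_of_ne ?_, fun t ht' => ?_⟩
  · rintro rfl
    simp only [h1] at h
    norm_num at h
  · rw [hiff t ht']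
    constructor
    · intro h2
      exact D.strictAntiOn_ratio.injOn ht' ht.2 (h2.trans h.symm)
    · rintro rfl
      exact h

end OpenBookData

/-! ### Rotations -/

/-- The unit complex number with argument `θ`. -/
def rot (θ : ℝ) : ℂ := Complex.exp (θ * Complex.I)

@[simp] theorem norm_rot (θ : ℝ) : ‖rot θ‖ = 1 := Complex.norm_exp_ofReal_mul_I θ

@[simp] theorem rot_zero : rot 0 = 1 := by simp [rot]

theorem rot_add (θ η : ℝ) : rot (θ + η) = rot θ * rot η := by
  simp [rot, add_mul, Complex.exp_add]

theorem rot_ne_zero (θ : ℝ) : rot θ ≠ 0 := Complex.exp_ne_zero _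

theorem conj_rot (θ : ℝ) : conj (rot θ) = rot (-θ) := by
  simp [rot, ← Complex.exp_conj]

theorem rot_neg_mul (θ : ℝ) : rot (-θ) * rot θ = 1 := by rw [← rot_add]; simp

theorem conj_rot_mul (θ : ℝ) : conj (rot θ) * rot θ = 1 := by rw [conj_rot, rot_neg_mul]

theorem rot_eq (θ : ℝ) : rot θ = ⟨Real.cos θ, Real.sin θ⟩ := by
  apply Complex.ext
  · simp [rot, Complex.exp_ofReal_mul_I_re]
  · simp [rot, Complex.exp_ofReal_mul_I_im]

theorem rot_half_sq (θ : ℝ) : rot (θ / 2) ^ 2 = rot θ := by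
  rw [pow_two, ← rot_add, add_halves]

theorem rot_eq_rot {θ η : ℝ} (h : rot θ = rot η) : ∃ k : ℤ, θ = η + k * (2 * Real.pi) := by
  obtain ⟨k, hk⟩ := Complex.exp_eq_exp_iff_exists_int.1 h
  refine ⟨k, ?_⟩
  have h2 : (θ : ℂ) = ((η + k * (2 * Real.pi) : ℝ) : ℂ) := by
    apply mul_right_cancel₀ Complex.I_ne_zero
    rw [hk]
    push_cast
    ring
  exact_mod_cast h2

theorem rot_add_int (θ : ℝ) (k : ℤ) : rot (θ + k * (2 * Real.pi)) = rot θ := by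
  rw [rot_add, rot]
  have : ((k * (2 * Real.pi) : ℝ) : ℂ) * Complex.I = k * (2 * Real.pi * Complex.I) := by
    push_cast; ring
  rw [rot, this, Complex.exp_int_mul_two_pi_mul_I, mul_one]

theorem contDiff_rot : ContDiff ℝ ∞ rot :=
  (Complex.ofRealCLM.contDiff.mul contDiff_const).cexp

theorem hasDerivAt_rot (θ : ℝ) : HasDerivAt rot (rot θ * Complex.I) θ := by
  have h := ((hasDerivAt_id (θ : ℂ)).mul_const Complex.I).cexp.comp_ofReal
  have h2 : HasDerivAt (fun y : ℝ => Complex.exp (y * Complex.I)) (rot θ * Complex.I) θ := by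
    simpa [rot] using h
  exact h2

variable {n : ℕ}

theorem rot_smul_cplx (θ : ℝ) (q p : Euc n) : rot θ • cplx n (q, p) =
    cplx n (Real.cos θ • q - Real.sin θ • p, Real.sin θ • q + Real.cos θ • p) := by
  ext j
  apply Complex.ext
  · simp [rot_eq, cplx_apply]
  · simp [rot_eq, cplx_apply]; ring

theorem rot_smul_injective (θ : ℝ) : Function.Injective fun w : Cx n => rot θ • w :=
  smul_right_injective _ (rot_ne_zero θ)

/-- The covector of unit length in the direction of `p` (zero if `p = 0`). -/
def unitDir (x : Euc n × Euc n) : Euc n × Euc n := (x.1, ‖x.2‖⁻¹ • x.2)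

theorem unitDir_mem {x : Euc n × Euc n} (h1 : ‖x.1‖ = 1) (h2 : ⟪x.1, x.2⟫_ℝ = 0) (h : x.2 ≠ 0) :
    unitDir x ∈ unitCotangentSphere n := by
  have := norm_ne_zero_iff.2 h
  refine ⟨h1, ?_, ?_⟩
  · simp [unitDir, norm_smul, this]
  · simp [unitDir, inner_smul_right, h2]

theorem isFrame_unitDir {x : Euc n × Euc n} (h1 : ‖x.1‖ = 1) (h2 : ⟪x.1, x.2⟫_ℝ = 0) (h : x.2 ≠ 0) :
    IsFrame (cplx n (unitDir x)) := isFrame_cplx.2 (unitDir_mem h1 h2 h)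

theorem IsFrame.rot {u : Cx n} (hu : IsFrame u) (θ : ℝ) : IsFrame (rot θ • u) :=
  hu.smul (conj_rot_mul θ)

/-- The geodesic flow rotates the orthonormal pair (q, p/|p|) in its plane, and on q + i p/|p| this
is multiplication by e^{-is}. For p = 0 the direction is zero, and the formula needs sin s = 0. -/
theorem unitDir_geodesicFlow (s : ℝ) {x : Euc n × Euc n} (h1 : ‖x.1‖ = 1) (h2 : ⟪x.1, x.2⟫_ℝ = 0)
    (h : x.2 ≠ 0 ∨ Real.sin s = 0) :
    cplx n (unitDir (geodesicFlow s x)) = rot (-s) • cplx n (unitDir x) := by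
  have hn := norm_geodesicFlow_snd s h1 h2
  rw [unitDir, hn, unitDir, rot_smul_cplx]
  congr 1
  rcases eq_or_ne x.2 0 with h0 | h0
  · have hs : Real.sin s = 0 := h.resolve_left (not_not.2 h0)
    simp [geodesicFlow, h0, hs]
  · have := norm_ne_zero_iff.2 h0
    simp only [geodesicFlow, Real.cos_neg, Real.sin_neg]
    congr 1
    · module
    · rw [smul_sub, smul_smul, smul_smul]
      match_scalars <;> field_simp

/-- The value of `theta` on real squares. -/
theorem theta_real (x : Euc n × Euc n) {s : ℝ} (h0 : 0 ≤ s) (h1 : s ≤ 1) :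
    theta (cplx n x) s = cplx n (√((1 + s) / 2) • x.1, √((1 - s) / 2) • x.2) := by
  have hA := amp_pos (s : ℂ)
  have hn : ‖(s : ℂ)‖ = s := by simp [abs_of_nonneg h0]
  have hA2 := amp_sq (s : ℂ)
  have hc := cosq_nonneg (s : ℂ)
  have hc2 := cosq_sq (Q := (s : ℂ)) (by rwa [hn])
  rw [hn] at hc2
  set A := amp (s : ℂ)
  have hB : (s / (4 * A)) ^ 2 = (1 - cosq (s : ℂ)) / 4 := by
    rw [div_pow, mul_pow, div_eq_div_iff (by positivity) (by norm_num)]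
    linear_combination 4 * hc2 - 4 * (1 - cosq (s : ℂ)) * hA2
  have hAB : A * (s / (4 * A)) = s / 4 := by field_simp
  have hp : √((1 + s) / 2) = A + s / (4 * A) := by
    rw [Real.sqrt_eq_iff_mul_self_eq (by linarith) (by positivity)]
    linear_combination -hB - 2 * hAB - hA2 / 4
  have hm : √((1 - s) / 2) = A - s / (4 * A) := by
    have : s / (4 * A) ≤ A := by
      rw [div_le_iff₀ (by positivity)]
      nlinarith
    rw [Real.sqrt_eq_iff_mul_self_eq (by linarith) (by linarith)]
    linear_combination -hB + 2 * hAB - hA2 / 4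
  rw [hp, hm]
  ext j
  have e : theta (cplx n x) (s : ℂ) j = (A : ℂ) * cplx n x j + ((s / (4 * A) : ℝ) : ℂ) * cj (cplx n x) j := by
    simp [theta, A]
  rw [e]
  apply Complex.ext
  · simp only [cplx_apply, cj_apply, Complex.add_re, Complex.re_ofReal_mul, Complex.conj_re,
      PiLp.smul_apply, smul_eq_mul]
    ring
  · simp only [cplx_apply, cj_apply, Complex.add_im, Complex.im_ofReal_mul, Complex.conj_im,
      PiLp.smul_apply, smul_eq_mul]
    ring

theorem contDiffAt_theta_comp {X : Type*} [NormedAddCommGroup X] [NormedSpace ℝ X] {u : X → Cx n}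
    {Q : X → ℂ} {x : X} (hu : ContDiffAt ℝ ∞ u x) (hQ : ContDiffAt ℝ ∞ Q x) (h : ‖Q x‖ < 1) :
    ContDiffAt ℝ ∞ (fun x => theta (u x) (Q x)) x :=
  ContDiffAt.comp (g := fun y : Cx n × ℂ => theta y.1 y.2) (f := fun x => (u x, Q x)) x
    (contDiffAt_theta (y := (u x, Q x)) h) (hu.prodMk hQ)

namespace OpenBookData
variable (D : OpenBookData)

/-! ### The maps from the pieces of the open book to the sphere -/

/-- The map from `P × D²` to the sphere, in ambient coordinates. -/
def bmap (x : (Euc n × Euc n) × ℂ) : Cx n := theta (cplx n x.1) (D.expand x.2)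

/-- The angular coordinate `2πφ/U` on the mapping torus. -/
def angle (x : (Euc n × Euc n) × ℝ) : ℝ := 2 * Real.pi * x.2 / D.U (Real.log ‖x.1.2‖)

/-- The map from `W × ℝ` to the sphere, in ambient coordinates. -/
def pmap (x : (Euc n × Euc n) × ℝ) : Cx n :=
  theta (rot (D.f (Real.log ‖x.1.2‖) * D.angle x / (2 * Real.pi)) • cplx n (unitDir x.1))
    (D.radius ‖x.1.2‖ * rot (D.angle x))

theorem norm_expand_lt (z : ℂ) : ‖D.expand z‖ < 1 := by
  rw [D.norm_expand]
  exact D.sig_lt_one _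

theorem contDiff_bmap : ContDiff ℝ ∞ (D.bmap (n := n)) := by
  rw [contDiff_iff_contDiffAt]
  intro x
  exact contDiffAt_theta_comp ((cplx n).contDiff.comp contDiff_fst).contDiffAt
    (D.contDiff_expand.comp contDiff_snd).contDiffAt (D.norm_expand_lt _)

/-- Here f = π, so the frame is rotated by θ/2 and the square by θ. By `theta_smul` the rotation
comes out as a common factor, and what remains involves p only through p/6 and |p|². -/
theorem pmap_of_le_one {x : (Euc n × Euc n) × ℝ} (h : ‖x.1.2‖ ≤ 1) :
    D.pmap x = rot (Real.pi * x.2 / D.C) •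
      cplx n (√(1 - ‖x.1.2‖ ^ 2 / 36) • x.1.1, (1 / 6 : ℝ) • x.1.2) := by
  have hl := Real.log_nonpos (norm_nonneg _) h
  have ha : D.angle x = 2 * (Real.pi * x.2 / D.C) := by
    rw [angle, D.U_of_le hl]
    ring
  have hp := Real.pi_pos
  rw [pmap, D.f_of_le hl, D.radius_of_le_one (norm_nonneg _) h, ha,
    show Real.pi * (2 * (Real.pi * x.2 / D.C)) / (2 * Real.pi) = Real.pi * x.2 / D.C by field_simp,
    ← rot_half_sq (2 * _), mul_div_cancel_left₀ _ two_ne_zero, mul_comm ((_ : ℝ) : ℂ), theta_smul (norm_rot _),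
    theta_real _ (by nlinarith [norm_nonneg x.1.2]) (by nlinarith [norm_nonneg x.1.2])]
  refine congrArg _ (congrArg _ (Prod.ext ?_ ?_))
  · simp only [unitDir]
    congr 2
    ring
  · rw [show (1 - (1 - ‖x.1.2‖ ^ 2 / 18)) / 2 = (‖x.1.2‖ / 6) ^ 2 by ring,
      Real.sqrt_sq (by positivity)]
    simp only [unitDir, smul_smul]
    rcases eq_or_ne x.1.2 0 with h0 | h0
    · simp [h0]
    · have := norm_ne_zero_iff.2 h0
      congr 1
      field_simp

theorem norm_radius_rot_lt {x : (Euc n × Euc n) × ℝ} (h : x.1.2 ≠ 0) (h' : ‖x.1.2‖ < Real.exp 1) :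
    ‖(D.radius ‖x.1.2‖ * rot (D.angle x) : ℂ)‖ < 1 := by
  rw [norm_mul, norm_rot, mul_one, Complex.norm_real,
    Real.norm_of_nonneg (D.radius_pos (norm_nonneg _) h').le]
  exact D.radius_lt_one (norm_pos_iff.2 h)

theorem contDiffAt_pmap {x : (Euc n × Euc n) × ℝ} (h : ‖x.1.2‖ < Real.exp 1) :
    ContDiffAt ℝ ∞ (D.pmap (n := n)) x := by
  have hp : ContDiff ℝ ∞ fun x : (Euc n × Euc n) × ℝ => x.1.2 := by fun_prop
  have hq : ContDiff ℝ ∞ fun x : (Euc n × Euc n) × ℝ => x.1.1 := by fun_prop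
  rcases eq_or_ne x.1.2 0 with h0 | h0
  · have hev : ∀ᶠ y : (Euc n × Euc n) × ℝ in 𝓝 x, ‖y.1.2‖ < 1 :=
      (hp.continuous.norm.continuousAt (x := x)).eventually_lt_const (by simp [h0])
    have hev2 := hev.mono fun y hy => D.pmap_of_le_one hy.le
    refine ContDiffAt.congr_of_eventuallyEq ?_ hev2
    have h1 : ContDiffAt ℝ ∞ (fun y : (Euc n × Euc n) × ℝ => √(1 - ‖y.1.2‖ ^ 2 / 36)) x :=
      (contDiffAt_const.sub ((hp.norm_sq ℝ).contDiffAt.div_const _)).sqrt (by simp [h0])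
    refine ContDiffAt.smul (contDiff_rot.contDiffAt.comp x (by fun_prop))
      ((cplx n).contDiff.contDiffAt.comp x ((h1.smul hq.contDiffAt).prodMk ?_))
    exact hp.contDiffAt.const_smul (1 / 6 : ℝ)
  · have hn : ContDiffAt ℝ ∞ (fun y : (Euc n × Euc n) × ℝ => ‖y.1.2‖) x := hp.contDiffAt.norm ℝ h0
    have hn0 := norm_ne_zero_iff.2 h0
    have hl : ContDiffAt ℝ ∞ (fun y : (Euc n × Euc n) × ℝ => Real.log ‖y.1.2‖) x := hn.log hn0
    have hU : ContDiffAt ℝ ∞ (fun y : (Euc n × Euc n) × ℝ => D.U (Real.log ‖y.1.2‖)) x :=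
      D.contDiff_U.contDiffAt.comp x hl
    have hf : ContDiffAt ℝ ∞ (fun y : (Euc n × Euc n) × ℝ => D.f (Real.log ‖y.1.2‖)) x :=
      D.f_smooth.contDiffAt.comp x hl
    have ha : ContDiffAt ℝ ∞ (D.angle (n := n)) x :=
      (contDiffAt_const.mul contDiffAt_snd).div hU (D.U_pos _).ne'
    have hr : ContDiffAt ℝ ∞ (fun y : (Euc n × Euc n) × ℝ => D.radius ‖y.1.2‖) x := by
      refine (D.contDiff_sig.contDiffAt.comp x hl).congr_of_eventuallyEq ?_
      filter_upwards [hn.continuousAt.eventually_ne hn0] with y hy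
      exact D.radius_of_pos ((norm_nonneg _).lt_of_ne' hy)
    have hu : ContDiffAt ℝ ∞ (fun y : (Euc n × Euc n) × ℝ => cplx n (unitDir y.1)) x :=
      (cplx n).contDiff.contDiffAt.comp x (hq.contDiffAt.prodMk ((hn.inv hn0).smul hp.contDiffAt))
    exact contDiffAt_theta_comp
      (ContDiffAt.smul (contDiff_rot.contDiffAt.comp x ((hf.mul ha).div_const _)) hu)
      ((Complex.ofRealCLM.contDiff.contDiffAt.comp x hr).mul (contDiff_rot.contDiffAt.comp x ha))
      (D.norm_radius_rot_lt h0 h)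

theorem dot_bmap (b : bindingPiece D n) : dot (D.bmap b.1) (D.bmap b.1) = D.expand b.1.2 :=
  dot_theta (isFrame_cplx.2 b.2.1) _

theorem isFrame_page {m : pagePiece n} (h : m.1.1.2 ≠ 0) :
    IsFrame (rot (D.f (Real.log ‖m.1.1.2‖) * D.angle m.1 / (2 * Real.pi)) • cplx n (unitDir m.1.1)) :=
  (isFrame_unitDir m.2.1 m.2.2.1 h).rot _

theorem dot_pmap (m : pagePiece n) : dot (D.pmap m.1) (D.pmap m.1) =
    D.radius ‖m.1.1.2‖ * rot (D.angle m.1) := by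
  rcases eq_or_ne m.1.1.2 0 with h | h
  · have hq := m.2.1
    rw [D.pmap_of_le_one (by simp [h]), dot_smul_left, dot_smul_right, dot_cplx, h, norm_zero,
      D.radius_zero, angle, h, norm_zero, Real.log_zero, D.U_of_le le_rfl,
      ← rot_half_sq (2 * Real.pi * m.1.2 / D.C)]
    rw [show 2 * Real.pi * m.1.2 / D.C / 2 = Real.pi * m.1.2 / D.C by ring]
    have : (⟨1, 0⟩ : ℂ) = 1 := rfl
    simp [hq, pow_two, this]
  · exact dot_theta (D.isFrame_page h) _

theorem norm_dot_pmap (m : pagePiece n) : ‖dot (D.pmap m.1) (D.pmap m.1)‖ = D.radius ‖m.1.1.2‖ := by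
  rw [D.dot_pmap, norm_mul, norm_rot, mul_one, Complex.norm_real,
    Real.norm_of_nonneg (D.radius_pos (norm_nonneg _) m.2.2.2).le]

theorem norm_bmap (b : bindingPiece D n) : ‖D.bmap b.1‖ = 1 :=
  norm_theta (isFrame_cplx.2 b.2.1) (D.norm_expand_lt _).le

theorem norm_cplx_sq (x : Euc n × Euc n) : ‖cplx n x‖ ^ 2 = ‖x.1‖ ^ 2 + ‖x.2‖ ^ 2 := by
  have h := dot_cj_self (cplx n x)
  rw [dot_cj_cplx, real_inner_self_eq_norm_sq, real_inner_self_eq_norm_sq] at h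
  have h2 := congrArg Complex.re h
  rw [← Complex.ofReal_pow, Complex.ofReal_re] at h2
  exact h2.symm

theorem norm_pmap (m : pagePiece n) : ‖D.pmap m.1‖ = 1 := by
  rcases eq_or_ne m.1.1.2 0 with h | h
  · have hq := m.2.1
    have h2 := norm_cplx_sq (m.1.1.1, (0 : Euc n))
    rw [hq] at h2
    rw [D.pmap_of_le_one (by simp [h]), norm_smul, norm_rot, one_mul, h]
    refine (pow_eq_one_iff_of_nonneg (norm_nonneg _) two_ne_zero).1 ?_
    simpa using h2
  · exact norm_theta (D.isFrame_page h) (D.norm_radius_rot_lt h m.2.2.2).le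

/-- The map from `P × D²` to the sphere. -/
def bindingMap (b : bindingPiece D n) : OddSphere n :=
  ⟨D.bmap b.1, mem_sphere_zero_iff_norm.2 (D.norm_bmap b)⟩

/-- The map from `W × ℝ` to the sphere. -/
def pageMap (m : pagePiece n) : OddSphere n :=
  ⟨D.pmap m.1, mem_sphere_zero_iff_norm.2 (D.norm_pmap m)⟩

theorem contMDiff_bindingMap : ContMDiff (𝓡 (2 * n + 1)) (𝓡 (2 * n + 1)) ∞ (D.bindingMap (n := n)) :=
  ContMDiff.codRestrict_sphere (f := fun b : bindingPiece D n => D.bmap b.1)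
    (D.contDiff_bmap.contMDiff.comp (bindingPiece_regular D n).contMDiff_val) _

theorem contMDiff_pageMap : ContMDiff (𝓡 (2 * n + 1)) (𝓡 (2 * n + 1)) ∞ (D.pageMap (n := n)) :=
  ContMDiff.codRestrict_sphere (f := fun m : pagePiece n => D.pmap m.1)
    (fun m => (D.contDiffAt_pmap m.2.2.2).contMDiffAt.comp m ((pagePiece_regular n).contMDiff_val m)) _

/-! ### Identifications -/

theorem bindingMap_injective : Function.Injective (D.bindingMap (n := n)) := by
  intro b b' h
  have h1 : D.bmap b.1 = D.bmap b'.1 := congrArg Subtype.val h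
  have h2 : D.expand b.1.2 = D.expand b'.1.2 := by rw [← D.dot_bmap, h1, D.dot_bmap]
  have h3 : b.1.2 = b'.1.2 := by rw [← D.shrink_expand b.1.2, h2, D.shrink_expand]
  have h4 := congrArg frame h1
  rw [bmap, bmap, frame_theta (isFrame_cplx.2 b.2.1) (D.norm_expand_lt _),
    frame_theta (isFrame_cplx.2 b'.2.1) (D.norm_expand_lt _)] at h4
  exact Subtype.ext (Prod.ext ((cplx n).injective h4) h3)

theorem norm_eq_of_radius_eq {ρ ρ' : ℝ} (h : 0 ≤ ρ) (h' : 0 ≤ ρ') (he : D.radius ρ = D.radius ρ') :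
    ρ = ρ' := by
  rcases h.eq_or_lt with rfl | h <;> rcases h'.eq_or_lt with rfl | h'
  · rfl
  · have := D.radius_lt_one h'
    rw [← he, D.radius_zero] at this
    exact absurd this (lt_irrefl _)
  · have := D.radius_lt_one h
    rw [he, D.radius_zero] at this
    exact absurd this (lt_irrefl _)
  · rw [D.radius_of_pos h, D.radius_of_pos h'] at he
    exact Real.log_injOn_pos h h' (D.strictAnti_sig.injective he)

/-- The `k`-th deck transformation adds 2πk to θ, so the rotation angle fθ/2π of the frame grows by
kf; the geodesic flow for time kf turns the frame by -kf. -/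
theorem pageMap_deck (k : ℤ) (m : pagePiece n) : D.pageMap (D.deck k m) = D.pageMap m := by
  have hn : ‖(D.deck k m).1.1.2‖ = ‖m.1.1.2‖ := norm_geodesicFlow_snd _ m.2.1 m.2.2.1
  have hU := (D.U_pos (Real.log ‖m.1.1.2‖)).ne'
  have hp := Real.pi_pos
  have ha : D.angle (D.deck k m).1 = D.angle m.1 + k * (2 * Real.pi) := by
    rw [angle, hn]
    change 2 * Real.pi * (m.1.2 + k * D.U (Real.log ‖m.1.1.2‖)) / _ = _
    rw [angle]
    field_simp
  have hu : cplx n (unitDir (D.deck k m).1.1) =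
      rot (-(k * D.f (Real.log ‖m.1.1.2‖))) • cplx n (unitDir m.1.1) :=
    unitDir_geodesicFlow _ m.2.1 m.2.2.1 (D.ne_zero_or_sin k _)
  apply Subtype.ext
  change D.pmap (D.deck k m).1 = D.pmap m.1
  rw [pmap, pmap, hn, ha, rot_add_int, hu, smul_smul, ← rot_add]
  congr 3
  field_simp
  ring

/-- The norm and φ determine the rotation applied to the frame, and removing it recovers q and
p/|p|. This singles out one point in a deck orbit. -/
theorem eq_of_pageMap_eq {m m' : pagePiece n} (h : D.pageMap m = D.pageMap m')
    (hn : ‖m.1.1.2‖ = ‖m'.1.1.2‖) (hφ : m.1.2 = m'.1.2) : m = m' := by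
  have h1 : D.pmap m.1 = D.pmap m'.1 := congrArg Subtype.val h
  refine Subtype.ext (Prod.ext ?_ hφ)
  rcases eq_or_ne m.1.1.2 0 with h0 | h0
  · have h0' : m'.1.1.2 = 0 := by rw [← norm_eq_zero, ← hn, h0, norm_zero]
    rw [D.pmap_of_le_one (by simp [h0]), D.pmap_of_le_one (by simp [h0']), hφ, h0, h0'] at h1
    have h2 := (cplx n).injective (rot_smul_injective _ h1)
    refine Prod.ext ?_ (h0.trans h0'.symm)
    simpa using congrArg Prod.fst h2
  · have h0' : m'.1.1.2 ≠ 0 := by rwa [← norm_ne_zero_iff, ← hn, norm_ne_zero_iff]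
    have hr := D.norm_radius_rot_lt (x := m.1) h0 m.2.2.2
    have hr' := D.norm_radius_rot_lt (x := m'.1) h0' m'.2.2.2
    have h2 := congrArg frame h1
    rw [pmap, pmap, frame_theta (D.isFrame_page h0) hr, frame_theta (D.isFrame_page h0') hr', angle,
      angle, hn, hφ] at h2
    have h3 := (cplx n).injective (rot_smul_injective _ h2)
    have hq := congrArg Prod.fst h3
    have hp := congrArg Prod.snd h3
    simp only [unitDir, hn] at hp
    have := norm_ne_zero_iff.2 h0'
    exact Prod.ext hq (smul_right_injective _ (inv_ne_zero this) hp)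

theorem pageMap_eq_iff {m m' : pagePiece n} :
    D.pageMap m = D.pageMap m' ↔ ∃ k : ℤ, D.deck k m = m' := by
  constructor
  · intro h
    have h1 : D.pmap m.1 = D.pmap m'.1 := congrArg Subtype.val h
    have hn : ‖m.1.1.2‖ = ‖m'.1.1.2‖ := by
      refine D.norm_eq_of_radius_eq (norm_nonneg _) (norm_nonneg _) ?_
      rw [← D.norm_dot_pmap, h1, D.norm_dot_pmap]
    have h2 := D.dot_pmap m
    rw [h1, D.dot_pmap, hn] at h2
    have h3 := mul_left_cancel₀
      (by exact_mod_cast (D.radius_pos (norm_nonneg _) m'.2.2.2).ne') h2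
    -- Equal squares have equal angles modulo 2π, and the integer that appears is the power of the
    -- deck transformation.
    obtain ⟨k, hk⟩ := rot_eq_rot h3
    refine ⟨k, D.eq_of_pageMap_eq ((D.pageMap_deck k m).trans h) ?_ ?_⟩
    · rw [← hn]
      exact norm_geodesicFlow_snd _ m.2.1 m.2.2.1
    · change m.1.2 + k * D.U (Real.log ‖m.1.1.2‖) = _
      have hU := (D.U_pos (Real.log ‖m'.1.1.2‖)).ne'
      have hp := Real.pi_pos
      rw [angle, angle, hn] at hk
      rw [hn]
      field_simp at hk
      linarith
  · rintro ⟨k, rfl⟩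
    exact (D.pageMap_deck k m).symm

/-- Comparing |Q| gives log |p| = 1 + r₀ - |z|. The bounds |z| < r₀ + δ and |p| < e then put the
point in the collar, where f = 0 and U is constant, so frames and arguments match without any twist.
-/
theorem bindingMap_eq_pageMap_iff {b : bindingPiece D n} {m : pagePiece n} :
    D.bindingMap b = D.pageMap m ↔ D.Glue b m := by
  constructor
  · intro h
    have h1 : D.bmap b.1 = D.pmap m.1 := congrArg Subtype.val h
    have h2 : D.expand b.1.2 = D.radius ‖m.1.1.2‖ * rot (D.angle m.1) := by
      rw [← D.dot_bmap, h1, D.dot_pmap]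
    have h3 : ‖D.expand b.1.2‖ = D.radius ‖m.1.1.2‖ := by
      rw [← D.dot_bmap, h1, D.norm_dot_pmap]
    have hp : m.1.1.2 ≠ 0 := by
      intro h0
      have := D.norm_expand_lt b.1.2
      rw [h3, h0, norm_zero, D.radius_zero] at this
      exact lt_irrefl _ this
    have hp' := norm_pos_iff.2 hp
    have hl : 1 + D.r₀ - ‖b.1.2‖ = Real.log ‖m.1.1.2‖ := by
      rw [D.norm_expand, D.radius_of_pos hp'] at h3
      exact D.strictAnti_sig.injective h3
    have hb := b.2.2
    have hδ : 1 - D.δ ≤ Real.log ‖m.1.1.2‖ := by linarith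
    have hl1 : Real.log ‖m.1.1.2‖ < 1 := (Real.log_lt_iff_lt_exp hp').2 m.2.2.2
    have hr : D.r₀ < ‖b.1.2‖ := by linarith
    have he : Real.exp (1 + D.r₀ - ‖b.1.2‖) = ‖m.1.1.2‖ := by rw [hl, Real.exp_log hp']
    refine ⟨hr, ?_, ?_⟩
    · have h4 := congrArg frame h1
      rw [bmap, pmap, frame_theta (isFrame_cplx.2 b.2.1) (D.norm_expand_lt _),
        frame_theta (D.isFrame_page hp) (D.norm_radius_rot_lt hp m.2.2.2), D.f_collar _ hδ, zero_mul,
        zero_div, rot_zero, one_smul] at h4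
      have h5 := (cplx n).injective h4
      rw [he, h5]
      simp [unitDir, smul_smul, hp'.ne']
    · have ha : D.angle m.1 = 2 * Real.pi * m.1.2 / D.U 1 := by rw [angle, D.U_collar hδ]
      have hs : 0 < D.sig (1 + D.r₀ - ‖b.1.2‖) := by
        rw [hl, ← D.radius_of_pos hp']
        exact D.radius_pos hp'.le m.2.2.2
      rw [expand, D.radius_of_pos hp', ← hl, ha] at h2
      have hz : (‖b.1.2‖ : ℂ) ≠ 0 := by
        have := D.r₀_pos
        exact_mod_cast (by linarith : (0 : ℝ) < ‖b.1.2‖).ne'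
      have hs' : (D.sig (1 + D.r₀ - ‖b.1.2‖) : ℂ) ≠ 0 := by exact_mod_cast hs.ne'
      push_cast at h2
      field_simp at h2
      exact h2
  · intro h
    have hl := h.log_norm
    have hδ := h.collar
    have hr := D.r₀_pos.trans h.1
    have hn : ‖m.1.1.2‖ = Real.exp (1 + D.r₀ - ‖b.1.2‖) := by
      rw [h.2.1]
      change ‖Real.exp (1 + D.r₀ - ‖b.1.2‖) • b.1.1.2‖ = _
      rw [norm_smul, b.2.1.2.1, mul_one, Real.norm_of_nonneg (Real.exp_pos _).le]
    have hu : unitDir m.1.1 = b.1.1 := by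
      rw [unitDir, hn, h.2.1]
      simp [smul_smul]
    apply Subtype.ext
    change D.bmap b.1 = D.pmap m.1
    rw [bmap, pmap, D.f_collar _ hδ, zero_mul, zero_div, rot_zero, one_smul, hu, hn]
    congr 1
    rw [expand, angle, D.U_collar hδ]
    conv_lhs => rw [h.2.2]
    have hz : (‖b.1.2‖ : ℂ) ≠ 0 := by exact_mod_cast hr.ne'
    have hnn : ‖(‖b.1.2‖ : ℂ) * Complex.exp (((2 * Real.pi * m.1.2 / D.U 1 : ℝ) : ℂ) * Complex.I)‖ =
        ‖b.1.2‖ := by rw [← h.2.2]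
    rw [hnn, sig]
    push_cast
    simp only [rot]
    push_cast
    field_simp

end OpenBookData

/-! ### Local sections of the maps to the sphere, and the diffeomorphism -/

theorem IsRegularLevel.exists_lift {V F : Type*} [NormedAddCommGroup V] [NormedSpace ℝ V]
    [FiniteDimensional ℝ V] [NormedAddCommGroup F] [NormedSpace ℝ F] [FiniteDimensional ℝ F]
    {S Ω : Set V} {f : V → F} {d : ℕ} {E H M : Type*} [NormedAddCommGroup E] [NormedSpace ℝ E]
    [TopologicalSpace H] [TopologicalSpace M] [ChartedSpace H M] {I : ModelWithCorners ℝ E H}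
    (hS : IsRegularLevel S Ω f d) {G : M → V} {x : M} (hG : ContMDiffAt I 𝓘(ℝ, V) ∞ G x)
    (hev : ∀ᶠ y in 𝓝 x, G y ∈ S) :
    letI := levelChartedSpace hS
    ∃ j : M → S, ContMDiffAt I (𝓡 d) ∞ j x ∧ ∀ᶠ y in 𝓝 x, (j y : V) = G y := by
  classical
  let := levelChartedSpace hS
  let j : M → S := fun y => if h : G y ∈ S then ⟨G y, h⟩ else ⟨G x, hev.self_of_nhds⟩
  have hj : ∀ᶠ y in 𝓝 x, (j y : V) = G y := by
    filter_upwards [hev] with y hy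
    simp [j, hy]
  exact ⟨j, hS.contMDiffAt_of_val (hG.congr_of_eventuallyEq hj), hj⟩

variable {n : ℕ}

/-- A smooth local choice of the argument of `dot w w`. -/
def localArg (θ₀ : ℝ) (w₀ w : Cx n) : ℝ := θ₀ + Complex.arg (dot w w / dot w₀ w₀)

theorem localArg_self {θ₀ : ℝ} {w₀ : Cx n} (h : dot w₀ w₀ ≠ 0) : localArg θ₀ w₀ w₀ = θ₀ := by
  simp [localArg, div_self h]

theorem contDiffAt_localArg {θ₀ : ℝ} {w₀ : Cx n} (h : dot w₀ w₀ ≠ 0) :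
    ContDiffAt ℝ ∞ (localArg θ₀ w₀) w₀ := by
  have h1 : ContDiffAt ℝ ∞ (fun w : Cx n => dot w w / dot w₀ w₀) w₀ := by
    simp only [div_eq_mul_inv]
    exact contDiff_dot.contDiffAt.mul contDiffAt_const
  have h2 : ContDiffAt ℝ ∞ Complex.log (dot w₀ w₀ / dot w₀ w₀) :=
    (Complex.contDiffAt_log (by simp [div_self h])).restrict_scalars ℝ
  have h3 := Complex.imCLM.contDiff.contDiffAt.comp w₀
    (ContDiffAt.comp (f := fun w : Cx n => dot w w / dot w₀ w₀) w₀ h2 h1)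
  have h4 : localArg θ₀ w₀ = fun w => θ₀ + (Complex.log (dot w w / dot w₀ w₀)).im := by
    funext w
    simp [localArg, Complex.log_im]
  rw [h4]
  exact contDiffAt_const.add h3

theorem norm_mul_rot_localArg {θ₀ : ℝ} {w₀ : Cx n} (h : dot w₀ w₀ ≠ 0)
    (hθ : dot w₀ w₀ = ‖dot w₀ w₀‖ * rot θ₀) (w : Cx n) :
    ‖dot w w‖ * rot (localArg θ₀ w₀ w) = dot w w := by
  have h1 := Complex.norm_mul_exp_arg_mul_I (dot w w / dot w₀ w₀)
  have h2 : (‖dot w₀ w₀‖ : ℂ) ≠ 0 := by simpa using h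
  rw [localArg, rot_add]
  rw [norm_div] at h1
  push_cast at h1
  change (‖dot w w‖ / ‖dot w₀ w₀‖ : ℂ) * rot (Complex.arg (dot w w / dot w₀ w₀)) = _ at h1
  set e := rot (Complex.arg (dot w w / dot w₀ w₀))
  field_simp at h1
  apply mul_left_cancel₀ h2
  linear_combination h1 - ‖dot w w‖ * e * hθ

theorem continuous_norm_dot : Continuous fun w : OddSphere n => ‖dot w.1 w.1‖ :=
  ((contDiff_dot (m := 0)).continuous.comp continuous_subtype_val).norm

theorem norm_coe_sphere (w : OddSphere n) : ‖(w : Cx n)‖ = 1 := mem_sphere_zero_iff_norm.1 w.2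

theorem norm_dot_le_one (w : OddSphere n) : ‖dot w.1 w.1‖ ≤ 1 := by
  simpa [norm_coe_sphere w] using norm_dot_self_le w.1

theorem contMDiffAt_sphere_of_contDiffAt {V : Type*} [NormedAddCommGroup V] [NormedSpace ℝ V]
    {G : Cx n → V} {w : OddSphere n} (hG : ContDiffAt ℝ ∞ G w) :
    ContMDiffAt (𝓡 (2 * n + 1)) 𝓘(ℝ, V) ∞ (fun w : OddSphere n => G w) w :=
  hG.contMDiffAt.comp w (contMDiff_coe_sphere w)

namespace OpenBookData
variable (D : OpenBookData)

/-- The bound is the value of |Q| on the rim |z| = r₀ + δ of the disk, where t = 1 - δ. Inside it,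
`frame` and `shrink` invert the binding map. -/
theorem exists_binding_section {w₀ : OddSphere n} (h : ‖dot w₀.1 w₀.1‖ < D.sig (1 - D.δ)) :
    ∃ j : OddSphere n → bindingPiece D n, ContMDiffAt (𝓡 (2 * n + 1)) (𝓡 (2 * n + 1)) ∞ j w₀ ∧
      ∀ᶠ w in 𝓝 w₀, D.bindingMap (j w) = w := by
  have h1 := h.trans (D.sig_lt_one _)
  let G : Cx n → (Euc n × Euc n) × ℂ := fun w => ((cplx n).symm (frame w), D.shrink (dot w w))
  have hG : ContDiffAt ℝ ∞ G w₀ :=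
    ((cplx n).symm.contDiff.contDiffAt.comp _ (contDiffAt_frame h1)).prodMk
      (ContDiffAt.comp (f := fun w : Cx n => dot w w) _ (D.contDiffAt_shrink h1) contDiff_dot.contDiffAt)
  have hev : ∀ᶠ w in 𝓝 w₀, ‖dot w.1 w.1‖ < D.sig (1 - D.δ) :=
    continuous_norm_dot.continuousAt.eventually_lt_const h
  obtain ⟨j, hj, hjG⟩ := (bindingPiece_regular D n).exists_lift (contMDiffAt_sphere_of_contDiffAt hG) (by
    filter_upwards [hev] with w hw
    have hw1 := hw.trans (D.sig_lt_one _)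
    refine ⟨?_, ?_⟩
    · rw [← isFrame_cplx]
      simpa [G] using isFrame_frame (norm_coe_sphere w) hw1
    · change ‖D.shrink (dot w.1 w.1)‖ < _
      rw [D.norm_shrink hw1]
      linarith [(D.lt_tinv_iff hw1).2 hw])
  refine ⟨j, hj, ?_⟩
  filter_upwards [hjG, hev] with w hw hw'
  have hw1 := hw'.trans (D.sig_lt_one _)
  apply Subtype.ext
  change D.bmap (j w).1 = w.1
  rw [hw, bmap]
  simp only [G, ContinuousLinearEquiv.apply_symm_apply, D.expand_shrink hw1, theta_frame hw1]

theorem pmap_exp_smul {t : ℝ} {u : Euc n × Euc n} (hu : ‖u.2‖ = 1) (θ : ℝ) :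
    D.pmap ((u.1, Real.exp t • u.2), D.U t * θ / (2 * Real.pi)) =
      theta (rot (D.f t * θ / (2 * Real.pi)) • cplx n u) (D.sig t * rot θ) := by
  have hn : ‖Real.exp t • u.2‖ = Real.exp t := by
    rw [norm_smul, hu, mul_one, Real.norm_of_nonneg (Real.exp_pos _).le]
  have hU := (D.U_pos t).ne'
  have hp := Real.pi_pos
  have ha : D.angle ((u.1, Real.exp t • u.2), D.U t * θ / (2 * Real.pi)) = θ := by
    simp only [angle, hn, Real.log_exp]
    field_simp
  have hd : unitDir (u.1, Real.exp t • u.2) = u := by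
    simp only [unitDir, hn, smul_smul, inv_mul_cancel₀ (Real.exp_pos t).ne', one_smul]
  rw [pmap, ha]
  simp only [hn, Real.log_exp, hd]
  rfl

/-- A branch θ of arg Q and t = `tinv` |Q| determine φ = Uθ/2π and the rotation to be undone on the
frame. The last clause records the branch, so that the section can be made to pass through a
prescribed point over `w₀`. -/
theorem exists_page_section_of_lt_one {w₀ : OddSphere n} {θ₀ : ℝ}
    (hθ : dot w₀.1 w₀.1 = ‖dot w₀.1 w₀.1‖ * rot θ₀) (h : D.sig 1 < ‖dot w₀.1 w₀.1‖)
    (h1 : ‖dot w₀.1 w₀.1‖ < 1) :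
    ∃ j : OddSphere n → pagePiece n, ContMDiffAt (𝓡 (2 * n + 1)) (𝓡 (2 * n + 1)) ∞ j w₀ ∧
      (∀ᶠ w in 𝓝 w₀, D.pageMap (j w) = w) ∧
      (j w₀).1.2 = D.U (Real.log ‖(j w₀).1.1.2‖) * θ₀ / (2 * Real.pi) := by
  have hs1 : 0 < D.sig 1 := by
    rw [← D.sig_zero]
    exact D.strictAnti_sig (by linarith [D.r₀_pos])
  have h0 : dot w₀.1 w₀.1 ≠ 0 := norm_pos_iff.1 (hs1.trans h)
  let t : Cx n → ℝ := fun w => D.tinv ‖dot w w‖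
  let θ : Cx n → ℝ := localArg θ₀ w₀.1
  let u : Cx n → Euc n × Euc n := fun w =>
    (cplx n).symm (rot (-(D.f (t w) * θ w / (2 * Real.pi))) • frame w)
  let G : Cx n → (Euc n × Euc n) × ℝ := fun w =>
    (((u w).1, Real.exp (t w) • (u w).2), D.U (t w) * θ w / (2 * Real.pi))
  have ht : ContDiffAt ℝ ∞ t w₀ :=
    ContDiffAt.comp (f := fun w : Cx n => ‖dot w w‖) _ (D.contDiffAt_tinv h1)
      (contDiff_dot.contDiffAt.norm ℝ h0)
  have hθd : ContDiffAt ℝ ∞ θ w₀ := contDiffAt_localArg h0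
  have hf : ContDiffAt ℝ ∞ (fun w => D.f (t w)) w₀ := D.f_smooth.contDiffAt.comp _ ht
  have hU : ContDiffAt ℝ ∞ (fun w => D.U (t w)) w₀ := D.contDiff_U.contDiffAt.comp _ ht
  have hu : ContDiffAt ℝ ∞ u w₀ := (cplx n).symm.contDiff.contDiffAt.comp _
    (ContDiffAt.smul (contDiff_rot.contDiffAt.comp _ ((hf.mul hθd).div_const _).neg)
      (contDiffAt_frame h1))
  have hG : ContDiffAt ℝ ∞ G w₀ := (hu.fst.prodMk (ht.exp.smul hu.snd)).prodMk
    ((hU.mul hθd).div_const _)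
  have hev : ∀ᶠ w in 𝓝 w₀, D.sig 1 < ‖dot w.1 w.1‖ ∧ ‖dot w.1 w.1‖ < 1 :=
    (continuous_norm_dot.continuousAt.eventually_const_lt h).and
      (continuous_norm_dot.continuousAt.eventually_lt_const h1)
  have hmem : ∀ w : OddSphere n, ‖dot w.1 w.1‖ < 1 → u w ∈ unitCotangentSphere n := fun w hw => by
    rw [← isFrame_cplx]
    simpa [u] using (isFrame_frame (norm_coe_sphere w) hw).rot _
  obtain ⟨j, hj, hjG⟩ := (pagePiece_regular n).exists_lift (contMDiffAt_sphere_of_contDiffAt hG) (by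
    filter_upwards [hev] with w hw
    have := hmem w hw.2
    refine ⟨this.1, ?_, ?_⟩
    · simp only [G, inner_smul_right, this.2.2, mul_zero]
    · simp only [G, norm_smul, this.2.1, mul_one, Real.norm_of_nonneg (Real.exp_pos _).le]
      exact Real.exp_lt_exp.2 ((D.tinv_lt_iff hw.2).2 hw.1))
  refine ⟨j, hj, ?_, ?_⟩
  · filter_upwards [hjG, hev] with w hw hw'
    apply Subtype.ext
    change D.pmap (j w).1 = w.1
    rw [hw, D.pmap_exp_smul (hmem w hw'.2).2.1]
    simp only [u, ContinuousLinearEquiv.apply_symm_apply, smul_smul, ← rot_add, add_neg_cancel, rot_zero,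
      one_smul, t, D.sig_tinv hw'.2]
    rw [norm_mul_rot_localArg h0 hθ, theta_frame hw'.2]
  · rw [hjG.self_of_nhds]
    simp only [G, norm_smul, (hmem w₀ h1).2.1, mul_one, Real.norm_of_nonneg (Real.exp_pos _).le,
      Real.log_exp, θ, localArg_self h0]

/-- There is no frame at `w₀`, but e^{-iθ/2} w has orthogonal real and imaginary parts v₁, v₂ with
v₂ = 0 at `w₀`. Inverting `pmap_of_le_one` gives q = v₁/|v₁| and p = 6 v₂, where |v₁| = √(1 -
|v₂|²). -/
theorem exists_page_section_of_eq_one {w₀ : OddSphere n} {θ₀ : ℝ}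
    (hθ : dot w₀.1 w₀.1 = ‖dot w₀.1 w₀.1‖ * rot θ₀) (h1 : ‖dot w₀.1 w₀.1‖ = 1) :
    ∃ j : OddSphere n → pagePiece n, ContMDiffAt (𝓡 (2 * n + 1)) (𝓡 (2 * n + 1)) ∞ j w₀ ∧
      (∀ᶠ w in 𝓝 w₀, D.pageMap (j w) = w) ∧
      (j w₀).1.2 = D.U (Real.log ‖(j w₀).1.1.2‖) * θ₀ / (2 * Real.pi) := by
  have h0 : dot w₀.1 w₀.1 ≠ 0 := norm_pos_iff.1 (h1 ▸ one_pos)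
  let θ : Cx n → ℝ := localArg θ₀ w₀.1
  let v : Cx n → Euc n × Euc n := fun w => (cplx n).symm (rot (-(θ w / 2)) • w)
  let G : Cx n → (Euc n × Euc n) × ℝ := fun w =>
    (((√(1 - ‖(v w).2‖ ^ 2))⁻¹ • (v w).1, (6 : ℝ) • (v w).2), D.C * θ w / (2 * Real.pi))
  have hv : ∀ w : OddSphere n, ‖(v w).1‖ ^ 2 + ‖(v w).2‖ ^ 2 = 1 ∧
      ‖(v w).1‖ ^ 2 - ‖(v w).2‖ ^ 2 = ‖dot w.1 w.1‖ ∧ ⟪(v w).1, (v w).2⟫_ℝ = 0 := fun w => by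
    have e1 : cplx n (v w) = rot (-(θ w / 2)) • w.1 := by simp [v]
    have e2 := norm_cplx_sq (v w)
    rw [e1, norm_smul, norm_rot, norm_coe_sphere] at e2
    have e3 := dot_cplx (v w) (v w)
    have e4 : rot (-(θ w / 2)) * rot (-(θ w / 2)) * rot (θ w) = 1 := by
      rw [← rot_add, ← rot_add, ← rot_zero]
      congr 1
      ring
    rw [e1, dot_smul_left, dot_smul_right, ← norm_mul_rot_localArg h0 hθ w.1] at e3
    have e5 : (‖dot w.1 w.1‖ : ℂ) = ⟨⟪(v w).1, (v w).1⟫_ℝ - ⟪(v w).2, (v w).2⟫_ℝ,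
        ⟪(v w).1, (v w).2⟫_ℝ + ⟪(v w).2, (v w).1⟫_ℝ⟩ := by
      rw [← e3]
      linear_combination -(‖dot w.1 w.1‖ : ℂ) * e4
    have e6 := congrArg Complex.re e5
    have e7 := congrArg Complex.im e5
    simp only [Complex.ofReal_re, Complex.ofReal_im, real_inner_self_eq_norm_sq,
      real_inner_comm (v w).1 (v w).2] at e6 e7
    exact ⟨by linarith, by linarith, by linarith⟩
  have hv0 : (v w₀).2 = 0 := by
    obtain ⟨e1, e2, -⟩ := hv w₀
    rw [h1] at e2
    exact norm_eq_zero.1 (pow_eq_zero_iff two_ne_zero |>.1 (by linarith))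
  have hθd : ContDiffAt ℝ ∞ θ w₀ := contDiffAt_localArg h0
  have hvd : ContDiffAt ℝ ∞ v w₀ := (cplx n).symm.contDiff.contDiffAt.comp _
    (ContDiffAt.smul (contDiff_rot.contDiffAt.comp _ (hθd.div_const _).neg) contDiffAt_id)
  have hG : ContDiffAt ℝ ∞ G w₀ := by
    have e1 : ContDiffAt ℝ ∞ (fun w => √(1 - ‖(v w).2‖ ^ 2)) w₀ :=
      (contDiffAt_const.sub (hvd.snd.norm_sq ℝ)).sqrt (by simp [hv0])
    exact (((e1.inv (by simp [hv0])).smul hvd.fst).prodMk (hvd.snd.const_smul (6 : ℝ))).prodMk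
      ((contDiffAt_const.mul hθd).div_const _)
  -- This bound means |p| < 1, the range in which `pmap_of_le_one` applies.
  have hev : ∀ᶠ w : OddSphere n in 𝓝 w₀, ‖(v w).2‖ < 1 / 6 := by
    have : ContinuousAt (fun w : OddSphere n => ‖(v w).2‖) w₀ :=
      (ContinuousAt.comp (f := fun w : OddSphere n => (w : Cx n)) (g := fun w => ‖(v w).2‖)
        hvd.continuousAt.snd.norm continuous_subtype_val.continuousAt)
    exact this.eventually_lt_const (by simp [hv0])
  obtain ⟨j, hj, hjG⟩ := (pagePiece_regular n).exists_lift (contMDiffAt_sphere_of_contDiffAt hG) (by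
    filter_upwards [hev] with w hw
    obtain ⟨e1, e2, e3⟩ := hv w
    have hpos : 0 < ‖(v w).1‖ := by
      by_contra! hle
      have : ‖(v w).1‖ = 0 := le_antisymm hle (norm_nonneg _)
      rw [this] at e1
      nlinarith [norm_nonneg (v w).2]
    refine ⟨?_, ?_, ?_⟩
    · have : √(1 - ‖(v w).2‖ ^ 2) = ‖(v w).1‖ := by
        rw [show 1 - ‖(v w).2‖ ^ 2 = ‖(v w).1‖ ^ 2 by linarith, Real.sqrt_sq hpos.le]
      simp only [G, this, norm_smul, norm_inv, norm_norm, inv_mul_cancel₀ hpos.ne']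
    · simp only [G, inner_smul_left, inner_smul_right, e3, mul_zero]
    · have := Real.add_one_le_exp (1 : ℝ)
      simp only [G, norm_smul, Real.norm_ofNat]
      linarith)
  refine ⟨j, hj, ?_, ?_⟩
  · filter_upwards [hjG, hev] with w hw hw'
    have hn : ‖(G w).1.2‖ = 6 * ‖(v w).2‖ := by simp only [G, norm_smul, Real.norm_ofNat]
    apply Subtype.ext
    change D.pmap (j w).1 = w.1
    rw [hw, D.pmap_of_le_one (by rw [hn]; linarith), hn]
    have hC := D.C_pos
    have hp := Real.pi_pos
    have e1 : 0 < √(1 - ‖(v w).2‖ ^ 2) := Real.sqrt_pos.2 (by nlinarith [norm_nonneg (v w).2])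
    have e2 : 1 - (6 * ‖(v w).2‖) ^ 2 / 36 = 1 - ‖(v w).2‖ ^ 2 := by ring
    have e3 : Real.pi * (D.C * θ w / (2 * Real.pi)) / D.C = θ w / 2 := by field_simp
    have e4 : ((√(1 - ‖(v w).2‖ ^ 2)) • (√(1 - ‖(v w).2‖ ^ 2))⁻¹ • (v w).1,
        (1 / 6 : ℝ) • (6 : ℝ) • (v w).2) = v w := by
      rw [smul_smul, smul_smul, mul_inv_cancel₀ e1.ne']
      norm_num
    rw [e2]
    change rot (Real.pi * (D.C * θ w / (2 * Real.pi)) / D.C) • cplx n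
      ((√(1 - ‖(v w).2‖ ^ 2)) • (√(1 - ‖(v w).2‖ ^ 2))⁻¹ • (v w).1,
        (1 / 6 : ℝ) • (6 : ℝ) • (v w).2) = _
    rw [e3, e4]
    simp only [v, ContinuousLinearEquiv.apply_symm_apply, smul_smul, ← rot_add, add_neg_cancel, rot_zero,
      one_smul]
  · rw [hjG.self_of_nhds]
    have hn : ‖(G w₀).1.2‖ = 0 := by simp only [G, norm_smul, hv0, norm_zero, mul_zero]
    rw [hn, Real.log_zero, D.U_of_le le_rfl]
    simp only [G, θ, localArg_self h0]

theorem exists_page_section {w₀ : OddSphere n} {θ₀ : ℝ}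
    (hθ : dot w₀.1 w₀.1 = ‖dot w₀.1 w₀.1‖ * rot θ₀) (h : D.sig 1 < ‖dot w₀.1 w₀.1‖) :
    ∃ j : OddSphere n → pagePiece n, ContMDiffAt (𝓡 (2 * n + 1)) (𝓡 (2 * n + 1)) ∞ j w₀ ∧
      (∀ᶠ w in 𝓝 w₀, D.pageMap (j w) = w) ∧
      (j w₀).1.2 = D.U (Real.log ‖(j w₀).1.1.2‖) * θ₀ / (2 * Real.pi) := by
  rcases (norm_dot_le_one w₀).lt_or_eq with h1 | h1
  · exact D.exists_page_section_of_lt_one hθ h h1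
  · exact D.exists_page_section_of_eq_one hθ h1

/-- Every point of the sphere is in the domain of a local section over one of the two pieces. -/
theorem binding_or_page (w : OddSphere n) :
    ‖dot w.1 w.1‖ < D.sig (1 - D.δ) ∨ D.sig 1 < ‖dot w.1 w.1‖ := by
  by_contra! h
  have := D.strictAnti_sig (show 1 - D.δ < 1 by linarith [D.δ_pos])
  linarith

theorem exists_arg (w : OddSphere n) : ∃ θ₀, dot w.1 w.1 = ‖dot w.1 w.1‖ * rot θ₀ :=
  ⟨_, (Complex.norm_mul_exp_arg_mul_I _).symm⟩

/-- The map from the pieces of the open book to the sphere. -/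
def toSphere : D.Pieces n → OddSphere n := Sum.elim D.bindingMap D.pageMap

theorem toSphere_eq_iff {x y : D.Pieces n} : D.toSphere x = D.toSphere y ↔ D.Rel x y := by
  rcases x with b | m <;> rcases y with b' | m'
  · exact D.bindingMap_injective.eq_iff
  · exact D.bindingMap_eq_pageMap_iff
  · exact eq_comm.trans D.bindingMap_eq_pageMap_iff
  · exact D.pageMap_eq_iff

theorem toSphere_surjective : Function.Surjective (D.toSphere (n := n)) := by
  intro w
  rcases D.binding_or_page w with h | h
  · obtain ⟨j, -, hj⟩ := D.exists_binding_section h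
    exact ⟨.inl (j w), hj.self_of_nhds⟩
  · obtain ⟨θ₀, hθ⟩ := exists_arg w
    obtain ⟨j, -, hj, -⟩ := D.exists_page_section hθ h
    exact ⟨.inr (j w), hj.self_of_nhds⟩

theorem contMDiff_toSphere : ContMDiff (𝓡 (2 * n + 1)) (𝓡 (2 * n + 1)) ∞ (D.toSphere (n := n)) :=
  ContMDiff.sumElim D.contMDiff_bindingMap D.contMDiff_pageMap

/-- The local sections of the map to the sphere. -/
theorem exists_section (x : D.Pieces n) : ∃ j : OddSphere n → D.Pieces n, j (D.toSphere x) = x ∧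
    ContMDiffAt (𝓡 (2 * n + 1)) (𝓡 (2 * n + 1)) ∞ j (D.toSphere x) ∧
    ∀ᶠ w in 𝓝 (D.toSphere x), D.toSphere (j w) = w := by
  rcases x with b | m
  · have h : ‖dot (D.bindingMap b).1 (D.bindingMap b).1‖ < D.sig (1 - D.δ) := by
      change ‖dot (D.bmap b.1) (D.bmap b.1)‖ < _
      rw [D.dot_bmap, D.norm_expand]
      exact D.strictAnti_sig (by linarith [b.2.2])
    obtain ⟨j, hj, hj'⟩ := D.exists_binding_section h
    refine ⟨Sum.inl ∘ j, congrArg Sum.inl (D.bindingMap_injective hj'.self_of_nhds),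
      ContMDiff.inl.contMDiffAt.comp _ hj, hj'⟩
  · have h : D.sig 1 < ‖dot (D.pageMap m).1 (D.pageMap m).1‖ := by
      change _ < ‖dot (D.pmap m.1) (D.pmap m.1)‖
      rw [D.norm_dot_pmap]
      rcases (norm_nonneg m.1.1.2).eq_or_lt with h0 | h0
      · rw [← h0, D.radius_zero]
        exact D.sig_lt_one 1
      · rw [D.radius_of_pos h0]
        exact D.strictAnti_sig ((Real.log_lt_iff_lt_exp h0).2 m.2.2.2)
    have hθ : dot (D.pageMap m).1 (D.pageMap m).1 =
        ‖dot (D.pageMap m).1 (D.pageMap m).1‖ * rot (D.angle m.1) := by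
      change dot (D.pmap m.1) (D.pmap m.1) = ‖dot (D.pmap m.1) (D.pmap m.1)‖ * _
      rw [D.norm_dot_pmap, D.dot_pmap]
    -- Starting the branch of the argument at the angle of `m` makes the section pass through `m`
    -- itself, not through another point of its deck orbit.
    obtain ⟨j, hj, hj', hφ⟩ := D.exists_page_section hθ h
    have hjm := hj'.self_of_nhds
    have hn : ‖(j (D.pageMap m)).1.1.2‖ = ‖m.1.1.2‖ := by
      have e : D.pmap (j (D.pageMap m)).1 = D.pmap m.1 := congrArg Subtype.val hjm
      refine D.norm_eq_of_radius_eq (norm_nonneg _) (norm_nonneg _) ?_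
      rw [← D.norm_dot_pmap, e, D.norm_dot_pmap]
    refine ⟨Sum.inr ∘ j, congrArg Sum.inr (D.eq_of_pageMap_eq hjm hn ?_),
      ContMDiff.inr.contMDiffAt.comp _ hj, hj'⟩
    have hU := (D.U_pos (Real.log ‖m.1.1.2‖)).ne'
    have hp := Real.pi_pos
    change (j (D.pageMap m)).1.2 = m.1.2
    rw [hφ, hn, angle]
    field_simp

/-- The diffeomorphism from the open book to the sphere. -/
def obDiffeo (n : ℕ) : D.OB n ≃ₘ⟮𝓡 (2 * n + 1), 𝓡 (2 * n + 1)⟯ OddSphere n where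
  toFun := Quotient.lift D.toSphere fun _ _ h => D.toSphere_eq_iff.2 h
  invFun w := D.proj (D.toSphere_surjective w).choose
  left_inv x := by
    induction x using Quotient.inductionOn with
    | h x => exact D.proj_eq_iff.2 (D.toSphere_eq_iff.1 (D.toSphere_surjective _).choose_spec)
  right_inv w := (D.toSphere_surjective w).choose_spec
  contMDiff_toFun :=
    IsLocalHomeomorph.contMDiff_of_comp D.isLocalHomeomorph_proj Quotient.mk_surjective
      D.contMDiff_toSphere
  contMDiff_invFun w := by
    refine IsLocalHomeomorph.contMDiffAt_of_lift D.isLocalHomeomorph_proj Quotient.mk_surjective ?_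
    intro x hx
    have hxw : D.toSphere x = w :=
      (D.toSphere_eq_iff.2 (D.proj_eq_iff.1 hx)).trans (D.toSphere_surjective w).choose_spec
    obtain ⟨j, h1, h2, h3⟩ := D.exists_section x
    rw [hxw] at h1 h2 h3
    refine ⟨j, h1, h2, ?_⟩
    filter_upwards [h3] with w' hw'
    exact D.proj_eq_iff.2 (D.toSphere_eq_iff.1 (hw'.trans (D.toSphere_surjective w').choose_spec.symm))

end OpenBookData

/-! ### The contact form on the sphere -/

/-- Im(Q̄ dQ) is |Q|² d(arg Q). A real factor scales the modulus, and its derivative contributes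
only to the real part. -/
theorem im_conj_mul_of_smul {g : ℝ → ℝ} {z : ℝ → ℂ} {g' : ℝ} {z' Q' : ℂ} (hg : HasDerivAt g g' 0)
    (hz : HasDerivAt z z' 0) (hQ : HasDerivAt (fun τ => (g τ : ℂ) * z τ) Q' 0) :
    (conj ((g 0 : ℂ) * z 0) * Q').im = g 0 ^ 2 * (conj (z 0) * z').im := by
  rw [hQ.unique (hg.ofReal_comp.mul hz)]
  have : conj ((g 0 : ℂ) * z 0) * ((g' : ℂ) * z 0 + (g 0 : ℂ) * z') =
      ((g 0 * g' * ‖z 0‖ ^ 2 : ℝ) : ℂ) + ((g 0 ^ 2 : ℝ) : ℂ) * (conj (z 0) * z') := by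
    push_cast
    rw [← Complex.mul_conj' (z 0)]
    simp
    ring
  rw [this, Complex.add_im, Complex.ofReal_im, Complex.im_ofReal_mul, zero_add]

theorem hasDerivAt_fst {X Y : Type*} [NormedAddCommGroup X] [NormedSpace ℝ X] [NormedAddCommGroup Y]
    [NormedSpace ℝ Y] {c : ℝ → X × Y} {c' : X × Y} {τ : ℝ} (h : HasDerivAt c c' τ) :
    HasDerivAt (fun τ => (c τ).1) c'.1 τ :=
  (ContinuousLinearMap.fst ℝ X Y).hasFDerivAt.comp_hasDerivAt τ h

theorem hasDerivAt_snd {X Y : Type*} [NormedAddCommGroup X] [NormedSpace ℝ X] [NormedAddCommGroup Y]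
    [NormedSpace ℝ Y] {c : ℝ → X × Y} {c' : X × Y} {τ : ℝ} (h : HasDerivAt c c' τ) :
    HasDerivAt (fun τ => (c τ).2) c'.2 τ :=
  (ContinuousLinearMap.snd ℝ X Y).hasFDerivAt.comp_hasDerivAt τ h

theorem hasDerivAt_rot_comp {γ : ℝ → ℝ} {γ' τ : ℝ} (h : HasDerivAt γ γ' τ) :
    HasDerivAt (fun τ => rot (γ τ)) (γ' * (rot (γ τ) * Complex.I)) τ :=
  ((hasDerivAt_rot (γ τ)).scomp τ h).congr_deriv (by simp)

/-- Rotating a frame by γ adds |u|² dγ = 2 dγ to Im⟨u, du⟩. -/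
theorem im_dot_cj_rot_smul {u : Cx n} (hu : IsFrame u) (u' : Cx n) (γ γ' : ℝ) :
    (dot (cj (rot γ • u)) (rot γ • u' + (γ' * (rot γ * Complex.I)) • u)).im =
      2 * γ' + (dot (cj u) u').im := by
  have h := conj_rot_mul γ
  have e : dot (cj (rot γ • u)) (rot γ • u' + (γ' * (rot γ * Complex.I)) • u) =
      ((2 * γ' : ℝ) : ℂ) * Complex.I + dot (cj u) u' := by
    simp only [cj_smul, dot_smul_left, dot_add_right, dot_smul_right, hu.cj_dot]
    push_cast
    linear_combination (dot (cj u) u' + 2 * γ' * Complex.I) * h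
  rw [e, Complex.add_im, Complex.im_ofReal_mul, Complex.I_im, mul_one]

/-- The hypothesis is the derivative of ⟨q, p⟩ = 0; with it the two halves of Im⟨u, du⟩ = ⟨q, dp⟩ -
⟨p, dq⟩ coincide. -/
theorem im_dot_cj_cplx {x y : Euc n × Euc n} (h : ⟪x.1, y.2⟫_ℝ + ⟪y.1, x.2⟫_ℝ = 0) :
    (dot (cj (cplx n x)) (cplx n y)).im = -2 * ⟪x.2, y.1⟫_ℝ := by
  rw [dot_cj_cplx]
  simp only [real_inner_comm x.2 y.1] at h ⊢
  linarith

namespace OpenBookData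
variable (D : OpenBookData)

/-- The coefficient of `Im ⟨w, dw⟩`, as a function of `|Q|` with `Q = dot w w`. -/
def coefF (s : ℝ) : ℝ := if s < 1 then -(D.H₁ (D.tinv s) / √(1 - s ^ 2)) else -3

/-- The coefficient of `Im (Q̄ dQ)`, as a function of `|Q|`. -/
def coefG (s : ℝ) : ℝ :=
  if s < 1 then D.H₂ (D.tinv s) / s ^ 2 + D.H₁ (D.tinv s) / (2 * √(1 - s ^ 2) * (1 + √(1 - s ^ 2)))
  else D.C / (2 * Real.pi) + 3 / 2

/-- The ambient one-form `F Im ⟨w, dw⟩ + G Im (Q̄ dQ)`. -/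
def sphereForm (w : Cx n) : Cx n →L[ℝ] ℝ :=
  D.coefF ‖dot w w‖ • Complex.imCLM.comp ((innerSL ℂ w).restrictScalars ℝ) +
    D.coefG ‖dot w w‖ • Complex.imCLM.comp
      (((2 * conj (dot w w)) • innerSL ℂ (cj w)).restrictScalars ℝ)

theorem sphereForm_apply (w v : Cx n) : D.sphereForm w v =
    D.coefF ‖dot w w‖ * (dot (cj w) v).im + D.coefG ‖dot w w‖ * (conj (dot w w) * (2 * dot w v)).im := by
  simp only [sphereForm, inner_eq_dot, add_apply, smul_apply,
    ContinuousLinearMap.comp_apply, ContinuousLinearMap.coe_restrictScalars', innerSL_apply_apply,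
    Complex.imCLM_apply, smul_eq_mul, cj_cj]
  ring_nf

/-- The contact form on the sphere. -/
def alpha (n : ℕ) : OneForm (𝓡 (2 * n + 1)) (OddSphere n) := fun z =>
  (D.sphereForm (z : Cx n)).comp (tderiv (V := Cx n) (𝓡 (2 * n + 1)) (fun z : OddSphere n => (z : Cx n)) z)

/-- The contact form along a curve `theta u Q`. -/
theorem sphereForm_theta {u : ℝ → Cx n} {Q : ℝ → ℂ} {u' : Cx n} {Q' : ℂ} (hu : HasDerivAt u u' 0)
    (hQ : HasDerivAt Q Q' 0) (hf : ∀ᶠ τ in 𝓝 0, IsFrame (u τ)) (hQ1 : ‖Q 0‖ < 1) {w' : Cx n}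
    (hw : HasDerivAt (fun τ => theta (u τ) (Q τ)) w' 0) :
    D.sphereForm (theta (u 0) (Q 0)) w' = -(D.H₁ (D.tinv ‖Q 0‖) / 2) * (dot (cj (u 0)) u').im +
      D.H₂ (D.tinv ‖Q 0‖) / ‖Q 0‖ ^ 2 * (conj (Q 0) * Q').im := by
  obtain ⟨h1, h2⟩ := hasDerivAt_theta hu hQ hf hQ1 hw
  have hc := cosq_pos hQ1
  -- With c = `cosq Q`, the factor c/2 of Im⟨u, du⟩ in Im⟨w, dw⟩ is absorbed by dividing by c in
  -- `coefF`, and the second summand of `coefG` cancels the remaining multiple of Im(Q̄ dQ).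
  rw [sphereForm_apply, dot_theta hf.self_of_nhds, h1, h2, coefF, coefG, if_pos hQ1, if_pos hQ1]
  change -(_ / cosq (Q 0)) * _ + (_ + _ / (2 * cosq (Q 0) * (1 + cosq (Q 0)))) * _ = _
  field_simp
  ring

/-- Both sides are H₂ times the differential of the argument, which `expand` preserves. At z = 0
both are zero because of the vanishing conjugate factor. -/
theorem im_conj_expand {z : ℝ → ℂ} {z' Q' : ℂ} (hz : HasDerivAt z z' 0)
    (hQ : HasDerivAt (fun τ => D.expand (z τ)) Q' 0) :
    D.H₂ (1 + D.r₀ - ‖z 0‖) / ‖D.expand (z 0)‖ ^ 2 * (conj (D.expand (z 0)) * Q').im =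
      D.H₂ (1 + D.r₀ - ‖z 0‖) / ‖z 0‖ ^ 2 * (conj (z 0) * z').im := by
  rcases eq_or_ne (z 0) 0 with h0 | h0
  · simp [h0, expand]
  · have hn := norm_pos_iff.2 h0
    have hd : DifferentiableAt ℝ (fun τ => D.sig (1 + D.r₀ - ‖z τ‖) / ‖z τ‖) 0 := by
      have h1 : DifferentiableAt ℝ (fun τ => ‖z τ‖) 0 := hz.differentiableAt.norm ℝ h0
      exact ((D.contDiff_sig.differentiable (by simp) _).comp 0 (h1.const_sub _)).div h1 hn.ne'
    have h2 := im_conj_mul_of_smul hd.hasDerivAt hz hQ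
    have hs : 0 < D.sig (1 + D.r₀ - ‖z 0‖) := by
      have := D.strictAnti_sig (show 1 + D.r₀ - ‖z 0‖ < 1 + D.r₀ by linarith)
      rwa [D.sig_zero] at this
    change (conj (D.expand (z 0)) * Q').im = _ at h2
    rw [h2, D.norm_expand]
    field_simp

theorem norm_dot_bmap (b : bindingPiece D n) : D.tinv ‖D.expand b.1.2‖ = 1 + D.r₀ - ‖b.1.2‖ := by
  rw [D.norm_expand, D.tinv_sig]

/-- The binding form, in ambient coordinates. -/
def bindingAmb (x : (Euc n × Euc n) × ℂ) : (Euc n × Euc n) × ℂ →L[ℝ] ℝ :=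
  D.h (‖x.2‖ ^ 2) • (liouville x.1).comp (ContinuousLinearMap.fst ℝ (Euc n × Euc n) ℂ) +
    D.k (‖x.2‖ ^ 2) • (x.2.re • Complex.imCLM - x.2.im • Complex.reCLM).comp
      (ContinuousLinearMap.snd ℝ (Euc n × Euc n) ℂ)

theorem bindingAmb_apply (x ξ : (Euc n × Euc n) × ℂ) : D.bindingAmb x ξ =
    D.h (‖x.2‖ ^ 2) * ⟪x.1.2, ξ.1.1⟫_ℝ + D.k (‖x.2‖ ^ 2) * (x.2.re * ξ.2.im - x.2.im * ξ.2.re) := by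
  simp [bindingAmb, liouville]

/-- The page form, in ambient coordinates. -/
def pageAmb (x : (Euc n × Euc n) × ℝ) : (Euc n × Euc n) × ℝ →L[ℝ] ℝ :=
  ContinuousLinearMap.snd ℝ (Euc n × Euc n) ℝ +
    (liouville x.1).comp (ContinuousLinearMap.fst ℝ (Euc n × Euc n) ℝ)

theorem pageAmb_apply (x ξ : (Euc n × Euc n) × ℝ) : pageAmb x ξ = ξ.2 + ⟪x.1.2, ξ.1.1⟫_ℝ := by
  simp [pageAmb, liouville]

/-- The contact form of the sphere restricts to the binding form. -/
theorem sphereForm_bmap (b : bindingPiece D n) (v : EuclideanSpace ℝ (Fin (2 * n + 1))) :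
    D.sphereForm (D.bmap b.1) (tderiv (𝓡 (2 * n + 1)) (fun b : bindingPiece D n => D.bmap b.1) b v) =
      D.bindingAmb b.1 (tderiv (𝓡 (2 * n + 1)) (Subtype.val : bindingPiece D n → _) b v) := by
  obtain ⟨c, hc⟩ := exists_hasVelocity (I := 𝓡 (2 * n + 1)) b v
  have hval := (bindingPiece_regular D n).contMDiff_val
  have hx := hc.hasDerivAt_comp (hval.mdifferentiable (by simp) b)
  have hw := hc.hasDerivAt_comp ((D.contDiff_bmap.contMDiff.comp hval).mdifferentiable (by simp) b)
  set ξ := tderiv (𝓡 (2 * n + 1)) (Subtype.val : bindingPiece D n → _) b v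
  have h0 : c 0 = b := hc.zero
  have hxp : HasDerivAt (fun τ => (c τ).1.1) ξ.1 0 :=
    hasDerivAt_fst hx
  have hz : HasDerivAt (fun τ => (c τ).1.2) ξ.2 0 :=
    hasDerivAt_snd hx
  have hq : HasDerivAt (fun τ => (c τ).1.1.1) ξ.1.1 0 :=
    hasDerivAt_fst hxp
  have hp : HasDerivAt (fun τ => (c τ).1.1.2) ξ.1.2 0 :=
    hasDerivAt_snd hxp
  have hu : HasDerivAt (fun τ => cplx n (c τ).1.1) (cplx n ξ.1) 0 :=
    (cplx n).toContinuousLinearMap.hasFDerivAt.comp_hasDerivAt 0 hxp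
  have hQ : HasDerivAt (fun τ => D.expand (c τ).1.2) _ 0 :=
    (D.contDiff_expand.differentiable (by simp) _).hasFDerivAt.comp_hasDerivAt 0 hz
  have hqp := hq.inner ℝ hp
  simp only [(c _).2.1.2.2] at hqp
  have hqp0 := hqp.unique (hasDerivAt_const (0 : ℝ) (0 : ℝ))
  have key := D.sphereForm_theta hu hQ (.of_forall fun τ => isFrame_cplx.2 (c τ).2.1) (D.norm_expand_lt _) hw
  have hexp := D.im_conj_expand hz hQ
  rw [D.norm_dot_bmap, hexp, im_dot_cj_cplx hqp0] at key
  rw [h0] at key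
  refine Eq.trans key ?_
  have hδ : 1 - D.δ < 1 + D.r₀ - ‖b.1.2‖ := by linarith [b.2.2]
  rw [D.H₁_binding hδ, D.H₂_binding hδ, sub_sub_cancel, bindingAmb_apply]
  have him : (conj b.1.2 * ξ.2).im = b.1.2.re * ξ.2.im - b.1.2.im * ξ.2.re := by
    simp; ring
  rw [him]
  rcases eq_or_ne b.1.2 0 with hz0 | hz0
  · simp [hz0]
    ring
  · have := norm_ne_zero_iff.2 hz0
    field_simp

theorem norm_dot_page (m : pagePiece n) :
    ‖(D.radius ‖m.1.1.2‖ * rot (D.angle m.1) : ℂ)‖ = D.radius ‖m.1.1.2‖ := by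
  rw [← D.dot_pmap, D.norm_dot_pmap]

/-- The contact form of the sphere restricts to the page form, off the zero section. -/
theorem sphereForm_pmap_of_ne {m : pagePiece n} (hm : m.1.1.2 ≠ 0) (v : EuclideanSpace ℝ (Fin (2 * n + 1))) :
    D.sphereForm (D.pmap m.1) (tderiv (𝓡 (2 * n + 1)) (fun m : pagePiece n => D.pmap m.1) m v) =
      pageAmb m.1 (tderiv (𝓡 (2 * n + 1)) (Subtype.val : pagePiece n → _) m v) := by
  obtain ⟨c, hc⟩ := exists_hasVelocity (I := 𝓡 (2 * n + 1)) m v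
  have hval := (pagePiece_regular n).contMDiff_val
  have hx := hc.hasDerivAt_comp (hval.mdifferentiable (by simp) m)
  have hw := hc.hasDerivAt_comp (((D.contDiffAt_pmap m.2.2.2).contMDiffAt.comp m
    (hval m)).mdifferentiableAt (by simp))
  set ξ := tderiv (𝓡 (2 * n + 1)) (Subtype.val : pagePiece n → _) m v
  have h0 : c 0 = m := hc.zero
  have hxp : HasDerivAt (fun τ => (c τ).1.1) ξ.1 0 := hasDerivAt_fst hx
  have hφ : HasDerivAt (fun τ => (c τ).1.2) ξ.2 0 := hasDerivAt_snd hx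
  have hq : HasDerivAt (fun τ => (c τ).1.1.1) ξ.1.1 0 := hasDerivAt_fst hxp
  have hp : HasDerivAt (fun τ => (c τ).1.1.2) ξ.1.2 0 := hasDerivAt_snd hxp
  have hp0 : (c 0).1.1.2 ≠ 0 := by rwa [h0]
  have hpos := norm_pos_iff.2 hp0
  have hev : ∀ᶠ τ in 𝓝 0, (c τ).1.1.2 ≠ 0 := hp.continuousAt.eventually_ne hp0
  have hnd : DifferentiableAt ℝ (fun τ => ‖(c τ).1.1.2‖) 0 := hp.differentiableAt.norm ℝ hp0
  obtain ⟨T', hT⟩ : ∃ T', HasDerivAt (fun τ => Real.log ‖(c τ).1.1.2‖) T' 0 :=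
    ⟨_, (hnd.log hpos.ne').hasDerivAt⟩
  set t := Real.log ‖(c 0).1.1.2‖ with ht
  have hexp : Real.exp t = ‖(c 0).1.1.2‖ := Real.exp_log hpos
  have ht1 : t < 1 := (Real.log_lt_iff_lt_exp hpos).2 (c 0).2.2.2
  have hf : HasDerivAt (fun τ => D.f (Real.log ‖(c τ).1.1.2‖)) (deriv D.f t * T') 0 :=
    (D.f_smooth.differentiable (by simp) t).hasDerivAt.comp 0 hT
  have hU : HasDerivAt (fun τ => D.U (Real.log ‖(c τ).1.1.2‖)) (-(deriv D.f t * Real.exp t) * T') 0 :=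
    HasDerivAt.comp (h₂ := D.U) 0 (D.hasDerivAt_U t) hT
  have hU0 := D.U_pos t
  -- This is U dθ + θ dU = 2π dφ with U' = -f' eᵗ. At the end its term in f' cancels the one from
  -- d(fθ/2π), the rotation angle of the frame.
  obtain ⟨θ', hθ', hθ⟩ : ∃ θ', D.U t * θ' = 2 * Real.pi * ξ.2 +
      deriv D.f t * Real.exp t * T' * D.angle (c 0).1 ∧ HasDerivAt (fun τ => D.angle (c τ).1) θ' 0 := by
    refine ⟨_, ?_, (hφ.const_mul (2 * Real.pi)).div hU hU0.ne'⟩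
    rw [← ht, angle, ← ht]
    field_simp
    ring
  have hγ : HasDerivAt (fun τ => D.f (Real.log ‖(c τ).1.1.2‖) * D.angle (c τ).1 / (2 * Real.pi)) _ 0 :=
    (hf.mul hθ).div_const (2 * Real.pi)
  obtain ⟨P', hP⟩ : ∃ P', HasDerivAt (fun τ => (unitDir (c τ).1.1).2) P' 0 :=
    ⟨_, ((hnd.inv hpos.ne').smul hp.differentiableAt).hasDerivAt⟩
  have hud : HasDerivAt (fun τ => cplx n (unitDir (c τ).1.1)) (cplx n (ξ.1.1, P')) 0 :=
    (cplx n).toContinuousLinearMap.hasFDerivAt.comp_hasDerivAt 0 (hq.prodMk hP)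
  have hu : HasDerivAt (fun τ => rot (D.f (Real.log ‖(c τ).1.1.2‖) * D.angle (c τ).1 / (2 * Real.pi)) •
      cplx n (unitDir (c τ).1.1)) _ 0 := (hasDerivAt_rot_comp hγ).smul hud
  obtain ⟨R', hR⟩ : ∃ R', HasDerivAt (fun τ => D.radius ‖(c τ).1.1.2‖) R' 0 := by
    refine ⟨_, ((D.contDiff_sig.differentiable (by simp) t).hasDerivAt.comp 0 hT).congr_of_eventuallyEq ?_⟩
    filter_upwards [hev] with τ hτ
    exact D.radius_of_pos (norm_pos_iff.2 hτ)
  have hQ : HasDerivAt (fun τ => (D.radius ‖(c τ).1.1.2‖ * rot (D.angle (c τ).1) : ℂ)) _ 0 :=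
    hR.ofReal_comp.mul (hasDerivAt_rot_comp hθ)
  have hfr : ∀ᶠ τ in 𝓝 0, IsFrame (rot (D.f (Real.log ‖(c τ).1.1.2‖) * D.angle (c τ).1 / (2 * Real.pi)) •
      cplx n (unitDir (c τ).1.1)) := hev.mono fun τ hτ => D.isFrame_page hτ
  have key := D.sphereForm_theta hu hQ hfr (D.norm_radius_rot_lt hp0 (c 0).2.2.2) hw
  have hqp := hq.inner ℝ hP
  have hqP : ⟪(unitDir (c 0).1.1).1, P'⟫_ℝ + ⟪ξ.1.1, (unitDir (c 0).1.1).2⟫_ℝ = 0 := by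
    refine hqp.unique ((hasDerivAt_const (0 : ℝ) (0 : ℝ)).congr_of_eventuallyEq ?_)
    exact .of_forall fun τ => by simp [unitDir, inner_smul_right, (c τ).2.2.1]
  have him := im_conj_mul_of_smul hR (hasDerivAt_rot_comp hθ) hQ
  have hrr : (conj (rot (D.angle (c 0).1)) * (θ' * (rot (D.angle (c 0).1) * Complex.I))).im = θ' := by
    have : conj (rot (D.angle (c 0).1)) * (θ' * (rot (D.angle (c 0).1) * Complex.I)) =
        (θ' : ℂ) * Complex.I := by
      linear_combination θ' * Complex.I * conj_rot_mul (D.angle (c 0).1)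
    rw [this, Complex.im_ofReal_mul, Complex.I_im, mul_one]
  rw [hrr] at him
  simp only [D.norm_dot_page] at key
  rw [him, im_dot_cj_rot_smul (isFrame_unitDir (c 0).2.1 (c 0).2.2.1 hp0), im_dot_cj_cplx hqP,
    D.radius_of_pos hpos, ← ht, D.tinv_sig, D.H₁_page ht1, D.H₂_page ht1] at key
  have hs : D.sig t ≠ 0 := by
    rw [ht, ← D.radius_of_pos hpos]
    exact (D.radius_pos hpos.le (c 0).2.2.2).ne'
  have hin : Real.exp t * ⟪(unitDir (c 0).1.1).2, ξ.1.1⟫_ℝ = ⟪(c 0).1.1.2, ξ.1.1⟫_ℝ := by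
    rw [hexp]
    simp only [unitDir, inner_smul_left]
    simp
    field_simp
  have hval0 : D.sphereForm (D.pmap (c 0).1)
      (tderiv (𝓡 (2 * n + 1)) (fun m : pagePiece n => D.pmap m.1) m v) = ξ.2 + ⟪(c 0).1.1.2, ξ.1.1⟫_ℝ := by
    rw [pmap, D.radius_of_pos hpos]
    refine Eq.trans key ?_
    have hpi := Real.pi_pos
    rw [← hin]
    field_simp
    linear_combination hθ'
  rw [h0] at hval0
  rw [hval0, pageAmb_apply]

/-- The contact form of the sphere restricts to the page form at the zero section. -/
theorem sphereForm_pmap_of_eq {m : pagePiece n} (hm : m.1.1.2 = 0) (v : EuclideanSpace ℝ (Fin (2 * n + 1))) :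
    D.sphereForm (D.pmap m.1) (tderiv (𝓡 (2 * n + 1)) (fun m : pagePiece n => D.pmap m.1) m v) =
      pageAmb m.1 (tderiv (𝓡 (2 * n + 1)) (Subtype.val : pagePiece n → _) m v) := by
  obtain ⟨c, hc⟩ := exists_hasVelocity (I := 𝓡 (2 * n + 1)) m v
  have hval := (pagePiece_regular n).contMDiff_val
  have hx := hc.hasDerivAt_comp (hval.mdifferentiable (by simp) m)
  have hw := hc.hasDerivAt_comp (((D.contDiffAt_pmap m.2.2.2).contMDiffAt.comp m
    (hval m)).mdifferentiableAt (by simp))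
  set ξ := tderiv (𝓡 (2 * n + 1)) (Subtype.val : pagePiece n → _) m v
  have h0 : c 0 = m := hc.zero
  have hxp : HasDerivAt (fun τ => (c τ).1.1) ξ.1 0 := hasDerivAt_fst hx
  have hφ : HasDerivAt (fun τ => (c τ).1.2) ξ.2 0 := hasDerivAt_snd hx
  have hq : HasDerivAt (fun τ => (c τ).1.1.1) ξ.1.1 0 := hasDerivAt_fst hxp
  have hp : HasDerivAt (fun τ => (c τ).1.1.2) ξ.1.2 0 := hasDerivAt_snd hxp
  have hp0 : (c 0).1.1.2 = 0 := by rwa [h0]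
  have hev : ∀ᶠ τ in 𝓝 0, ‖(c τ).1.1.2‖ < 1 :=
    hp.continuousAt.norm.eventually_lt_const (by simp [hp0])
  obtain ⟨κ', hκ⟩ : ∃ κ', HasDerivAt (fun τ => √(1 - ‖(c τ).1.1.2‖ ^ 2 / 36)) κ' 0 :=
    ⟨_, (((hp.differentiableAt.norm_sq ℝ).div_const 36).const_sub 1 |>.sqrt (by simp [hp0])).hasDerivAt⟩
  have hu : HasDerivAt (fun τ => cplx n (√(1 - ‖(c τ).1.1.2‖ ^ 2 / 36) • (c τ).1.1.1,
      (1 / 6 : ℝ) • (c τ).1.1.2)) (cplx n (ξ.1.1 + κ' • (c 0).1.1.1, (1 / 6 : ℝ) • ξ.1.2)) 0 := by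
    refine (cplx n).toContinuousLinearMap.hasFDerivAt.comp_hasDerivAt 0
      (HasDerivAt.prodMk ((hκ.smul hq).congr_deriv ?_) (hp.const_smul (1 / 6 : ℝ)))
    simp [hp0]
  have hψ : HasDerivAt (fun τ => Real.pi * (c τ).1.2 / D.C) (Real.pi * ξ.2 / D.C) 0 :=
    (hφ.const_mul Real.pi).div_const D.C
  have hw2 := ((hasDerivAt_rot_comp hψ).smul hu).congr_of_eventuallyEq
    (hev.mono fun τ hτ => D.pmap_of_le_one hτ.le)
  have hw3 := hw.unique hw2
  have hqp := hq.inner ℝ hp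
  simp only [(c _).2.2.1] at hqp
  have hqp0 := hqp.unique (hasDerivAt_const (0 : ℝ) (0 : ℝ))
  rw [hp0, inner_zero_right, add_zero] at hqp0
  have hqn := (c 0).2.1
  set ψ := Real.pi * (c 0).1.2 / D.C
  set q := (c 0).1.1.1
  set y : Euc n × Euc n := (ξ.1.1 + κ' • q, (1 / 6 : ℝ) • ξ.1.2) with hy
  have hy2 : ⟪q, y.2⟫_ℝ = 0 := by simp [hy, inner_smul_right, hqp0]
  have hpm : D.pmap (c 0).1 = rot ψ • cplx n (q, 0) := by
    rw [D.pmap_of_le_one (by simp [hp0]), hp0]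
    simp [ψ, q]
  simp only [hp0, norm_zero, smul_zero] at hw3
  rw [show √(1 - (0 : ℝ) ^ 2 / 36) = 1 by simp, one_smul] at hw3
  have h1 : dot (cplx n (q, 0)) (cplx n (q, 0)) = 1 := by
    rw [dot_cplx]
    apply Complex.ext <;> simp [hqn]
  have h2 : dot (cj (cplx n (q, 0))) (cplx n (q, 0)) = 1 := by
    rw [dot_cj_cplx]
    apply Complex.ext <;> simp [hqn]
  have h3 : dot (cplx n (q, 0)) (cplx n y) = (⟪q, y.1⟫_ℝ : ℂ) := by
    rw [dot_cplx]
    apply Complex.ext <;> simp [hy2]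
  have h4 : dot (cj (cplx n (q, 0))) (cplx n y) = (⟪q, y.1⟫_ℝ : ℂ) := by
    rw [dot_cj_cplx]
    apply Complex.ext <;> simp [hy2]
  have hrr := conj_rot_mul ψ
  have e1 : dot (cj (D.pmap (c 0).1)) (tderiv (𝓡 (2 * n + 1)) (D.pmap ∘ Subtype.val) m v) =
      (⟪q, y.1⟫_ℝ : ℂ) + ((Real.pi * ξ.2 / D.C : ℝ) : ℂ) * Complex.I := by
    rw [hw3, hpm]
    simp only [cj_smul, dot_smul_left, dot_add_right, dot_smul_right, h2, h4]
    linear_combination ((⟪q, y.1⟫_ℝ : ℂ) + ((Real.pi * ξ.2 / D.C : ℝ) : ℂ) * Complex.I) * hrr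
  have e2 : conj (dot (D.pmap (c 0).1) (D.pmap (c 0).1)) *
      (2 * dot (D.pmap (c 0).1) (tderiv (𝓡 (2 * n + 1)) (D.pmap ∘ Subtype.val) m v)) =
      ((2 * ⟪q, y.1⟫_ℝ : ℝ) : ℂ) + ((2 * (Real.pi * ξ.2 / D.C) : ℝ) : ℂ) * Complex.I := by
    rw [hw3, hpm]
    simp only [dot_smul_left, dot_add_right, dot_smul_right, h1, h3, map_mul, mul_one]
    push_cast
    linear_combination 2 * ((⟪q, y.1⟫_ℝ : ℂ) + Real.pi * ξ.2 / D.C * Complex.I) *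
      (conj (rot ψ) * rot ψ + 1) * hrr
  have hn : ‖dot (D.pmap (c 0).1) (D.pmap (c 0).1)‖ = 1 := by
    rw [D.norm_dot_pmap, hp0, norm_zero, D.radius_zero]
  have hres : D.sphereForm (D.pmap (c 0).1)
      (tderiv (𝓡 (2 * n + 1)) (D.pmap ∘ Subtype.val) m v) = ξ.2 := by
    -- At the zero section only F + 2G matters, and the values of `coefF` and `coefG` at 1 are
    -- chosen so that it equals C/π.
    rw [sphereForm_apply, e1, e2, hn, coefF, coefG, if_neg (lt_irrefl _), if_neg (lt_irrefl _)]
    simp only [Complex.add_im, Complex.ofReal_im, Complex.im_ofReal_mul, Complex.I_im, mul_one, zero_add]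
    have hC := D.C_pos
    have hpi := Real.pi_pos
    field_simp
    ring
  rw [h0] at hres
  rw [pageAmb_apply, hm, inner_zero_left, add_zero]
  exact hres

/-- The contact form of the sphere restricts to the page form. -/
theorem sphereForm_pmap (m : pagePiece n) (v : EuclideanSpace ℝ (Fin (2 * n + 1))) :
    D.sphereForm (D.pmap m.1) (tderiv (𝓡 (2 * n + 1)) (fun m : pagePiece n => D.pmap m.1) m v) =
      pageAmb m.1 (tderiv (𝓡 (2 * n + 1)) (Subtype.val : pagePiece n → _) m v) := by
  by_cases hm : m.1.1.2 = 0
  · exact D.sphereForm_pmap_of_eq hm v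
  · exact D.sphereForm_pmap_of_ne hm v

end OpenBookData

/-! ### Transfer of the contact condition through local sections -/

theorem mdifferentiable_coe_sphere (w : OddSphere n) :
    MDifferentiableAt (𝓡 (2 * n + 1)) 𝓘(ℝ, Cx n) (fun w : OddSphere n => (w : Cx n)) w :=
  (contMDiff_coe_sphere (n := 2 * n + 1) (m := 1)).mdifferentiable one_ne_zero w

theorem tderiv_coe_sphere_injective (w : OddSphere n) :
    Function.Injective (tderiv (V := Cx n) (𝓡 (2 * n + 1)) (fun w : OddSphere n => (w : Cx n)) w) :=
  injective_mvfderiv_subtypeVal_sphere w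

/-- A map into a regular level set of the same dimension whose ambient differential is injective
has differential onto the tangent space. -/
theorem IsRegularLevel.exists_tderiv_eq {V F : Type*} [NormedAddCommGroup V] [NormedSpace ℝ V]
    [FiniteDimensional ℝ V] [NormedAddCommGroup F] [NormedSpace ℝ F] [FiniteDimensional ℝ F]
    {S Ω : Set V} {f : V → F} {d : ℕ} {H M : Type*} [TopologicalSpace H] [TopologicalSpace M]
    [ChartedSpace H M] {I : ModelWithCorners ℝ (EuclideanSpace ℝ (Fin d)) H}
    (hS : IsRegularLevel S Ω f d) {G : M → S} {x : M}
    (hG : MDifferentiableAt I 𝓘(ℝ, V) (fun y => (G y : V)) x)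
    (hinj : Function.Injective (tderiv I (fun y => (G y : V)) x)) {ξ : V}
    (hξ : fderiv ℝ f (G x) ξ = 0) : ∃ v, tderiv I (fun y => (G y : V)) x v = ξ := by
  set L := tderiv I (fun y => (G y : V)) x
  set A := fderiv ℝ f (G x : V)
  have hle : LinearMap.range (L : EuclideanSpace ℝ (Fin d) →ₗ[ℝ] V) ≤ LinearMap.ker (A : V →ₗ[ℝ] F) := by
    rintro _ ⟨v, rfl⟩
    exact hS.fderiv_tangent hG v
  have h1 := LinearMap.finrank_range_add_finrank_ker (A : V →ₗ[ℝ] F)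
  rw [LinearMap.range_eq_top.2 (hS.surj _ (G x).2), finrank_top, hS.dim _ (G x).2] at h1
  have h2 := LinearMap.finrank_range_of_inj (f := (L : EuclideanSpace ℝ (Fin d) →ₗ[ℝ] V)) hinj
  rw [finrank_euclideanSpace_fin] at h2
  have h3 := Submodule.eq_of_le_of_finrank_eq hle (by omega)
  have : ξ ∈ LinearMap.range (L : EuclideanSpace ℝ (Fin d) →ₗ[ℝ] V) := h3 ▸ hξ
  exact this

/-- The algebraic contact condition at a point of a level set: nonvanishing of the one-form `β` and
nondegeneracy of `dβ` on its kernel. -/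
structure IsContactAt {V F : Type*} [NormedAddCommGroup V] [NormedSpace ℝ V] [NormedAddCommGroup F]
    [NormedSpace ℝ F] (f : V → F) (β : V → V →L[ℝ] ℝ) (x : V) : Prop where
  contDiffAt : ContDiffAt ℝ ∞ β x
  exists_ne : ∃ ξ, fderiv ℝ f x ξ = 0 ∧ β x ξ ≠ 0
  nondegenerate : ∀ ξ, fderiv ℝ f x ξ = 0 → β x ξ = 0 → ξ ≠ 0 →
    ∃ ξ', fderiv ℝ f x ξ' = 0 ∧ β x ξ' = 0 ∧ fderiv ℝ β x ξ ξ' - fderiv ℝ β x ξ' ξ ≠ 0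

/-- Since `ψ ∘ j` is the inclusion of the sphere, `α` is the pullback of `β` by `j` near `w₀`. The
same identity makes the differential of `j` injective, hence onto the tangent space of `S` by
dimension, so the contact condition transfers from `β`. No smoothness of `γ` is needed, which
matters because `coefF` and `coefG` are defined by cases at |Q| = 1. -/
theorem contactForm_of_section {V F : Type*} [NormedAddCommGroup V] [NormedSpace ℝ V]
    [FiniteDimensional ℝ V] [NormedAddCommGroup F] [NormedSpace ℝ F] [FiniteDimensional ℝ F]
    {S Ω : Set V} {f : V → F} (hS : IsRegularLevel S Ω f (2 * n + 1)) {β : V → V →L[ℝ] ℝ}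
    {ψ : V → Cx n} {γ : Cx n → Cx n →L[ℝ] ℝ} {w₀ : OddSphere n} {j : OddSphere n → S}
    {α : OneForm (𝓡 (2 * n + 1)) (OddSphere n)}
    (hα : ∀ w (v : EuclideanSpace ℝ (Fin (2 * n + 1))), α w v =
      γ w (tderiv (𝓡 (2 * n + 1)) (fun w : OddSphere n => (w : Cx n)) w v))
    (hψ : ∀ x : S, ContDiffAt ℝ ∞ ψ x)
    (hj : letI := levelChartedSpace hS; ContMDiffAt (𝓡 (2 * n + 1)) (𝓡 (2 * n + 1)) ∞ j w₀)
    (hψj : ∀ᶠ w in 𝓝 w₀, ψ (j w) = w)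
    (hpull : letI := levelChartedSpace hS; ∀ (x : S) (v : EuclideanSpace ℝ (Fin (2 * n + 1))),
      γ (ψ x) (tderiv (𝓡 (2 * n + 1)) (fun x : S => ψ x) x v) =
        β x (tderiv (𝓡 (2 * n + 1)) (Subtype.val : S → V) x v))
    (hβ : IsContactAt f β (j w₀)) :
    ContMDiffAt (𝓡 (2 * n + 1)) ((𝓡 (2 * n + 1)).prod 𝓘(ℝ, EuclideanSpace ℝ (Fin (2 * n + 1)) →L[ℝ] ℝ)) ∞
      (fun x => Bundle.TotalSpace.mk' (EuclideanSpace ℝ (Fin (2 * n + 1)) →L[ℝ] ℝ)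
        (E := fun x : OddSphere n => TangentSpace (𝓡 (2 * n + 1)) x →L[ℝ] ℝ) x (α x)) w₀ ∧
    α w₀ ≠ 0 ∧ ∀ v, α w₀ v = 0 → v ≠ 0 → ∃ w, α w₀ w = 0 ∧ dForm α w₀ v w ≠ 0 := by
  let := levelChartedSpace hS
  have := levelIsManifold hS
  have hJ : ContMDiffAt (𝓡 (2 * n + 1)) 𝓘(ℝ, V) ∞ (fun w => (j w : V)) w₀ :=
    (hS.contMDiff_val (j w₀)).comp w₀ hj
  have hjd : ∀ᶠ w in 𝓝 w₀, MDifferentiableAt (𝓡 (2 * n + 1)) (𝓡 (2 * n + 1)) j w := by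
    have h1 : ContMDiffAt (𝓡 (2 * n + 1)) (𝓡 (2 * n + 1)) 1 j w₀ := hj.of_le (by simp)
    filter_upwards [(contMDiffAt_iff_contMDiffAt_nhds (by simp)).1 h1] with y hy
    exact hy.mdifferentiableAt (by simp)
  have hval : ∀ x : S, MDifferentiableAt (𝓡 (2 * n + 1)) 𝓘(ℝ, V) (Subtype.val : S → V) x :=
    hS.contMDiff_val.mdifferentiable (by simp)
  have hψd : ∀ x : S, MDifferentiableAt 𝓘(ℝ, V) 𝓘(ℝ, Cx n) ψ x := fun x =>
    ((hψ x).differentiableAt (by simp)).mdifferentiableAt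
  have hpb : ∀ᶠ w in 𝓝 w₀, ∀ v : EuclideanSpace ℝ (Fin (2 * n + 1)),
      α w v = β (j w) (tderiv (𝓡 (2 * n + 1)) (fun w => (j w : V)) w v) := by
    filter_upwards [hjd, hψj.eventually_nhds] with w hw hw' v
    let v' : EuclideanSpace ℝ (Fin (2 * n + 1)) := mfderiv (𝓡 (2 * n + 1)) (𝓡 (2 * n + 1)) j w v
    have e1 : tderiv (𝓡 (2 * n + 1)) (fun w => (j w : V)) w v =
        tderiv (𝓡 (2 * n + 1)) (Subtype.val : S → V) (j w) v' :=
      DFunLike.congr_fun (mfderiv_comp w (hval (j w)) hw) v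
    have e2 : tderiv (𝓡 (2 * n + 1)) (fun w => ψ (j w)) w v =
        tderiv (𝓡 (2 * n + 1)) (fun x : S => ψ x) (j w) v' :=
      DFunLike.congr_fun (mfderiv_comp w ((hψd (j w)).comp (j w) (hval (j w))) hw) v
    have e3 : tderiv (V := Cx n) (𝓡 (2 * n + 1)) (fun w => ψ (j w)) w =
        tderiv (V := Cx n) (𝓡 (2 * n + 1)) (fun w : OddSphere n => (w : Cx n)) w :=
      Filter.EventuallyEq.mfderiv_eq hw'
    rw [hα, e1, ← hpull (j w) v', ← e2, e3, hw'.self_of_nhds]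
  have hinj : Function.Injective (tderiv (𝓡 (2 * n + 1)) (fun w => (j w : V)) w₀) := by
    have e2 : tderiv (V := Cx n) (𝓡 (2 * n + 1)) (fun w => ψ (j w)) w₀ =
        (tderiv 𝓘(ℝ, V) ψ (j w₀)).comp (tderiv (𝓡 (2 * n + 1)) (fun w => (j w : V)) w₀) :=
      mfderiv_comp w₀ (hψd (j w₀)) (hJ.mdifferentiableAt (by simp))
    have e3 : tderiv (V := Cx n) (𝓡 (2 * n + 1)) (fun w => ψ (j w)) w₀ =
        tderiv (V := Cx n) (𝓡 (2 * n + 1)) (fun w : OddSphere n => (w : Cx n)) w₀ :=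
      Filter.EventuallyEq.mfderiv_eq hψj
    have h1 := tderiv_coe_sphere_injective w₀
    rw [← e3, e2] at h1
    exact Function.Injective.of_comp (f := tderiv 𝓘(ℝ, V) ψ (j w₀)) h1
  have hsurj : ∀ ξ : V, fderiv ℝ f (j w₀) ξ = 0 →
      ∃ v, tderiv (𝓡 (2 * n + 1)) (fun w => (j w : V)) w₀ v = ξ := fun ξ hξ =>
    hS.exists_tderiv_eq (hJ.mdifferentiableAt (by simp)) hinj hξ
  have hker := hS.fderiv_tangent (hJ.mdifferentiableAt (by simp))
  have hpb0 := hpb.self_of_nhds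
  refine ⟨contMDiffAt_of_eq_pullback hJ hβ.contDiffAt hpb, ?_, ?_⟩
  · intro h0
    obtain ⟨ξ, h1, h2⟩ := hβ.exists_ne
    obtain ⟨v, rfl⟩ := hsurj ξ h1
    apply h2
    rw [← hpb0 v, h0]
    rfl
  · intro v hv hv0
    have h1 : tderiv (𝓡 (2 * n + 1)) (fun w => (j w : V)) w₀ v ≠ 0 := fun h =>
      hv0 (hinj (h.trans (map_zero _).symm))
    obtain ⟨ξ', h2, h3, h4⟩ := hβ.nondegenerate _ (hker v) ((hpb0 v).symm.trans hv) h1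
    obtain ⟨v', rfl⟩ := hsurj ξ' h2
    refine ⟨v', (hpb0 v').trans h3, ?_⟩
    have h5 := dForm_of_eq_pullback hJ hβ.contDiffAt hpb v v'
    exact fun h => h4 (h5.symm.trans h)

theorem fderiv_eq_of_line {V W : Type*} [NormedAddCommGroup V] [NormedSpace ℝ V]
    [NormedAddCommGroup W] [NormedSpace ℝ W] {f : V → W} {x ξ : V} {d : W}
    (hf : DifferentiableAt ℝ f x) (h : HasDerivAt (fun τ : ℝ => f (x + τ • ξ)) d 0) :
    fderiv ℝ f x ξ = d :=
  (hf.hasFDerivAt.hasLineDerivAt ξ).unique h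

theorem fderiv_apply_eq_of_line {V W W' : Type*} [NormedAddCommGroup V] [NormedSpace ℝ V]
    [NormedAddCommGroup W] [NormedSpace ℝ W] [NormedAddCommGroup W'] [NormedSpace ℝ W']
    {β : V → W →L[ℝ] W'} {x ξ : V} {η : W} {d : W'} (hβ : DifferentiableAt ℝ β x)
    (h : HasDerivAt (fun τ : ℝ => β (x + τ • ξ) η) d 0) : fderiv ℝ β x ξ η = d := by
  have h1 := (ContinuousLinearMap.apply ℝ W' η).hasFDerivAt.comp_hasDerivAt (0 : ℝ)
    (hβ.hasFDerivAt.hasLineDerivAt ξ)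
  exact h1.unique h

theorem hasDerivAt_line {V : Type*} [NormedAddCommGroup V] [NormedSpace ℝ V] (x ξ : V) :
    HasDerivAt (fun τ : ℝ => x + τ • ξ) ξ 0 := by
  simpa using ((hasDerivAt_id (0 : ℝ)).smul_const ξ).const_add x

theorem contDiff_liouville : ContDiff ℝ ∞ (liouville (n := n)) :=
  ((innerSL ℝ).contDiff.comp contDiff_snd).clm_comp contDiff_const

/-! ### The contact condition on the page piece -/

section Page

theorem fderiv_cotangent (x ξ : (Euc n × Euc n) × ℝ) :
    fderiv ℝ (fun x : (Euc n × Euc n) × ℝ => (⟪x.1.1, x.1.1⟫_ℝ - 1, ⟪x.1.1, x.1.2⟫_ℝ)) x ξ =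
      (2 * ⟪x.1.1, ξ.1.1⟫_ℝ, ⟪x.1.1, ξ.1.2⟫_ℝ + ⟪ξ.1.1, x.1.2⟫_ℝ) := by
  refine fderiv_eq_of_line ((pagePiece_regular n).contDiff.differentiable (by simp) x) ?_
  have h := hasDerivAt_fst (hasDerivAt_line x ξ)
  have hq := hasDerivAt_fst h
  have hp := hasDerivAt_snd h
  refine (((hq.inner ℝ hq).sub_const 1).prodMk (hq.inner ℝ hp)).congr_deriv ?_
  simp [real_inner_comm, two_mul]

theorem contDiff_pageAmb : ContDiff ℝ ∞ (OpenBookData.pageAmb (n := n)) :=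
  contDiff_const.add ((contDiff_liouville.comp contDiff_fst).clm_comp contDiff_const)

theorem fderiv_pageAmb (x ξ η : (Euc n × Euc n) × ℝ) :
    fderiv ℝ OpenBookData.pageAmb x ξ η = ⟪ξ.1.2, η.1.1⟫_ℝ := by
  refine fderiv_apply_eq_of_line (contDiff_pageAmb.differentiable (by simp) x) ?_
  simp only [OpenBookData.pageAmb_apply]
  have hp := hasDerivAt_snd (hasDerivAt_fst (hasDerivAt_line x ξ))
  refine ((hp.inner ℝ (hasDerivAt_const 0 η.1.1)).const_add η.2).congr_deriv ?_
  simp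

theorem isContactAt_page {x : (Euc n × Euc n) × ℝ} (hq : ⟪x.1.1, x.1.1⟫_ℝ = 1)
    (hqp : ⟪x.1.1, x.1.2⟫_ℝ = 0) :
    IsContactAt (fun x : (Euc n × Euc n) × ℝ => (⟪x.1.1, x.1.1⟫_ℝ - 1, ⟪x.1.1, x.1.2⟫_ℝ))
      OpenBookData.pageAmb x := by
  refine ⟨contDiff_pageAmb.contDiffAt, ⟨((0, 0), 1), ?_, ?_⟩, ?_⟩
  · rw [fderiv_cotangent]; simp
  · rw [OpenBookData.pageAmb_apply]; simp
  obtain ⟨⟨q, p⟩, φ⟩ := x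
  rintro ⟨⟨ξq, ξp⟩, ξφ⟩ hξ hβ h0
  rw [fderiv_cotangent, Prod.mk_eq_zero] at hξ
  rw [OpenBookData.pageAmb_apply] at hβ
  simp only at hξ hβ hq hqp
  obtain ⟨h1, h2⟩ := hξ
  have h1 : ⟪q, ξq⟫_ℝ = 0 := by linarith
  have c1 := real_inner_comm q ξp
  have c2 := real_inner_comm q ξq
  have c3 := real_inner_comm p ξq
  have c4 := real_inner_comm p ξp
  have c5 := real_inner_comm q p
  set b := ⟪q, ξp⟫_ℝ with hb
  set e := ⟪p, ξp⟫_ℝ with he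
  have hpq : ⟪p, q⟫_ℝ = 0 := by rw [real_inner_comm]; exact hqp
  -- The partner of ξ is (ξp, -ξq), the image of ξ under a complex structure compatible with dp ∧
  -- dq. The multiples of q make it tangent, and the φ-component puts it in the kernel. The pairing
  -- with ξ is |ξp - bq|² + |ξq|².
  refine ⟨((ξp - b • q, -ξq - e • q), -e), ?_, ?_, ?_⟩
  · rw [fderiv_cotangent]
    simp only [inner_sub_left, inner_sub_right, inner_neg_right, inner_smul_left, inner_smul_right, hq,
      hqp, Prod.mk_eq_zero]
    constructor
    · simp [← hb]
    · simp only [conj_trivial]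
      rw [h1, real_inner_comm p ξp, ← he]
      ring
  · rw [OpenBookData.pageAmb_apply]
    simp only [inner_sub_right, inner_smul_right, hpq, ← he]
    ring
  · rw [fderiv_pageAmb, fderiv_pageAmb]
    simp only [inner_sub_left, inner_sub_right, inner_neg_left, inner_smul_left, inner_smul_right]
    simp only [conj_trivial]
    have e1 : ⟪ξp - b • q, ξp - b • q⟫_ℝ = ⟪ξp, ξp⟫_ℝ - b * ⟪ξp, q⟫_ℝ := by
      simp only [inner_sub_left, inner_sub_right, inner_smul_left, inner_smul_right, conj_trivial, hq, ← hb]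
      ring
    intro h3
    have h4 : ⟪ξp - b • q, ξp - b • q⟫_ℝ + ⟪ξq, ξq⟫_ℝ = 0 := by
      rw [e1]; rw [h1] at h3; linarith
    have h5 := real_inner_self_nonneg (x := ξp - b • q)
    have h6 := real_inner_self_nonneg (x := ξq)
    have h7 : ξq = 0 := inner_self_eq_zero.1 (show ⟪ξq, ξq⟫_ℝ = 0 by linarith)
    have h8 : ξp - b • q = 0 := inner_self_eq_zero.1 (show ⟪ξp - b • q, ξp - b • q⟫_ℝ = 0 by linarith)
    rw [h7, inner_zero_left, add_zero] at h2
    rw [h2, zero_smul, sub_zero] at h8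
    rw [h7, inner_zero_right, add_zero] at hβ
    exact h0 (by rw [h7, h8, hβ]; rfl)

end Page

/-! ### The contact condition on the binding piece -/

section Binding
variable (D : OpenBookData)

theorem fderiv_stiefel (x ξ : (Euc n × Euc n) × ℂ) :
    fderiv ℝ (fun x : (Euc n × Euc n) × ℂ =>
        (⟪x.1.1, x.1.1⟫_ℝ - 1, ⟪x.1.2, x.1.2⟫_ℝ - 1, ⟪x.1.1, x.1.2⟫_ℝ)) x ξ =
      (2 * ⟪x.1.1, ξ.1.1⟫_ℝ, 2 * ⟪x.1.2, ξ.1.2⟫_ℝ, ⟪x.1.1, ξ.1.2⟫_ℝ + ⟪ξ.1.1, x.1.2⟫_ℝ) := by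
  have hd : ContDiff ℝ ∞ (fun x : (Euc n × Euc n) × ℂ =>
      (⟪x.1.1, x.1.1⟫_ℝ - 1, ⟪x.1.2, x.1.2⟫_ℝ - 1, ⟪x.1.1, x.1.2⟫_ℝ)) := by
    have h1 : ContDiff ℝ ∞ fun x : (Euc n × Euc n) × ℂ => x.1.1 := contDiff_fst.fst
    have h2 : ContDiff ℝ ∞ fun x : (Euc n × Euc n) × ℂ => x.1.2 := contDiff_fst.snd
    exact ((h1.inner ℝ h1).sub contDiff_const).prodMk
      (((h2.inner ℝ h2).sub contDiff_const).prodMk (h1.inner ℝ h2))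
  refine fderiv_eq_of_line (hd.differentiable (by simp) x) ?_
  have h := hasDerivAt_fst (hasDerivAt_line x ξ)
  have hq := hasDerivAt_fst h
  have hp := hasDerivAt_snd h
  refine (((hq.inner ℝ hq).sub_const 1).prodMk
    (((hp.inner ℝ hp).sub_const 1).prodMk (hq.inner ℝ hp))).congr_deriv ?_
  simp [real_inner_comm, two_mul]

theorem contDiff_bindingAmb : ContDiff ℝ ∞ (D.bindingAmb (n := n)) := by
  have hz : ContDiff ℝ ∞ fun x : (Euc n × Euc n) × ℂ => x.2 := contDiff_snd
  have hs : ContDiff ℝ ∞ fun x : (Euc n × Euc n) × ℂ => ‖x.2‖ ^ 2 := hz.norm_sq ℝ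
  have hre : ContDiff ℝ ∞ fun x : (Euc n × Euc n) × ℂ => x.2.re := Complex.reCLM.contDiff.comp hz
  have him : ContDiff ℝ ∞ fun x : (Euc n × Euc n) × ℂ => x.2.im := Complex.imCLM.contDiff.comp hz
  exact ((D.h_smooth.comp hs).smul
      ((contDiff_liouville.comp contDiff_fst).clm_comp contDiff_const)).add
    ((D.k_smooth.comp hs).smul (((hre.smul contDiff_const).sub (him.smul contDiff_const)).clm_comp
      contDiff_const))

theorem fderiv_bindingAmb (x ξ η : (Euc n × Euc n) × ℂ) :
    fderiv ℝ D.bindingAmb x ξ η =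
      deriv D.h (‖x.2‖ ^ 2) * (2 * (x.2.re * ξ.2.re + x.2.im * ξ.2.im)) * ⟪x.1.2, η.1.1⟫_ℝ +
      D.h (‖x.2‖ ^ 2) * ⟪ξ.1.2, η.1.1⟫_ℝ +
      deriv D.k (‖x.2‖ ^ 2) * (2 * (x.2.re * ξ.2.re + x.2.im * ξ.2.im)) *
        (x.2.re * η.2.im - x.2.im * η.2.re) +
      D.k (‖x.2‖ ^ 2) * (ξ.2.re * η.2.im - ξ.2.im * η.2.re) := by
  refine fderiv_apply_eq_of_line ((contDiff_bindingAmb D).differentiable (by simp) x) ?_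
  simp only [OpenBookData.bindingAmb_apply]
  have h := hasDerivAt_line x ξ
  have hp := (hasDerivAt_snd (hasDerivAt_fst h)).inner ℝ (hasDerivAt_const 0 η.1.1)
  have hz := hasDerivAt_snd h
  have hre := Complex.reCLM.hasFDerivAt.comp_hasDerivAt (0 : ℝ) hz
  have him := Complex.imCLM.hasFDerivAt.comp_hasDerivAt (0 : ℝ) hz
  have hs : HasDerivAt (fun τ : ℝ => ‖(x + τ • ξ).2‖ ^ 2) (2 * (x.2.re * ξ.2.re + x.2.im * ξ.2.im)) 0 := by
    have h1 := hz.norm_sq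
    refine h1.congr_deriv ?_
    simp [Complex.inner]
    ring
  have e0 : (x + (0 : ℝ) • ξ) = x := by simp
  have hh : HasDerivAt (fun τ : ℝ => D.h (‖(x + τ • ξ).2‖ ^ 2)) _ 0 :=
    (D.h_smooth.differentiable (by simp) _).hasDerivAt.comp 0 hs
  have hk : HasDerivAt (fun τ : ℝ => D.k (‖(x + τ • ξ).2‖ ^ 2)) _ 0 :=
    (D.k_smooth.differentiable (by simp) _).hasDerivAt.comp 0 hs
  refine ((hh.mul hp).add (hk.mul ((hre.mul_const η.2.im).sub (him.mul_const η.2.re)))).congr_deriv ?_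
  simp
  ring

/-- The kernel splits into the contact hyperplane of P, where the differential is h₁ dλ_P, and a
plane made up of the disk directions corrected by multiples of the Reeb vector (p, -q). The
condition h₁h₂' - h₂h₁' > 0 is nondegeneracy on that plane. -/
theorem isContactAt_binding {x : (Euc n × Euc n) × ℂ} (hx : x ∈ bindingPiece D n) :
    IsContactAt (fun x : (Euc n × Euc n) × ℂ =>
        (⟪x.1.1, x.1.1⟫_ℝ - 1, ⟪x.1.2, x.1.2⟫_ℝ - 1, ⟪x.1.1, x.1.2⟫_ℝ)) D.bindingAmb x := by
  obtain ⟨⟨hnq, hnp, hqp⟩, hz⟩ := hx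
  have hsz : ‖x.2‖ ^ 2 < (D.r₀ + D.δ) ^ 2 := pow_lt_pow_left₀ hz (norm_nonneg _) two_ne_zero
  have hpos := D.h_pos _ (sq_nonneg ‖x.2‖) hsz
  have hcon := D.contact _ (sq_nonneg ‖x.2‖) hsz
  have hdk : deriv (fun s => s * D.k s) (‖x.2‖ ^ 2) =
      D.k (‖x.2‖ ^ 2) + ‖x.2‖ ^ 2 * deriv D.k (‖x.2‖ ^ 2) := by
    refine (((hasDerivAt_id _).mul (D.k_smooth.differentiable (by simp) (‖x.2‖ ^ 2)).hasDerivAt).congr_deriv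
      ?_).deriv
    simp
  rw [hdk] at hcon
  have hq : ⟪x.1.1, x.1.1⟫_ℝ = 1 := by rw [real_inner_self_eq_norm_sq, hnq, one_pow]
  have hp : ⟪x.1.2, x.1.2⟫_ℝ = 1 := by rw [real_inner_self_eq_norm_sq, hnp, one_pow]
  have hpq : ⟪x.1.2, x.1.1⟫_ℝ = 0 := by rw [real_inner_comm]; exact hqp
  refine ⟨(contDiff_bindingAmb D).contDiffAt, ⟨((x.1.2, -x.1.1), 0), ?_, ?_⟩, ?_⟩
  · rw [fderiv_stiefel]
    simp [hqp, hpq, hnq, hnp]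
  · rw [OpenBookData.bindingAmb_apply]
    simp only [hp, Complex.zero_im, Complex.zero_re]
    simpa using hpos.ne'
  obtain ⟨⟨q, p⟩, z⟩ := x
  rintro ⟨⟨ξq, ξp⟩, ζ⟩ hξ hβ h0
  rw [fderiv_stiefel, Prod.mk_eq_zero, Prod.mk_eq_zero] at hξ
  rw [OpenBookData.bindingAmb_apply] at hβ
  simp only at hξ hβ hq hqp hp hpq hpos hcon hnq hnp
  obtain ⟨h1, h2, h3⟩ := hξ
  have h1 : ⟪q, ξq⟫_ℝ = 0 := by linarith
  have h2 : ⟪p, ξp⟫_ℝ = 0 := by linarith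
  have c1 := real_inner_comm q ξp
  have c2 := real_inner_comm q ξq
  have c3 := real_inner_comm p ξq
  have c4 := real_inner_comm p ξp
  set a := ⟪p, ξq⟫_ℝ with ha
  have h3 : ⟪q, ξp⟫_ℝ = -a := by linarith
  -- Here a = λ_P(ξ), and the two vectors are the components of ξ - a (p, -q), its part in the
  -- contact hyperplane of P.
  by_cases hperp : ξq - a • p = 0 ∧ ξp + a • q = 0
  · have hξq : ξq = a • p := sub_eq_zero.1 hperp.1
    have hξp : ξp = -(a • q) := eq_neg_of_add_eq_zero_left hperp.2
    have hζ : ζ ≠ 0 := by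
      rintro rfl
      simp only [Complex.zero_im, Complex.zero_re] at hβ
      have : a = 0 := by simpa [hpos.ne'] using hβ
      rw [this, zero_smul] at hξq hξp
      exact h0 (by rw [hξq, hξp, neg_zero]; rfl)
    set s := ‖z‖ ^ 2 with hs
    have hs' : s = z.re ^ 2 + z.im ^ 2 := by rw [hs, Complex.sq_norm, Complex.normSq_apply]; ring
    -- The disk component is rotated by a right angle, and the Reeb multiple restores membership in
    -- the kernel. The pairing is 2|ζ|² times the contact expression, divided by h.
    refine ⟨(((-(D.k s * (z.re * ζ.re + z.im * ζ.im)) / D.h s) • p,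
      -((-(D.k s * (z.re * ζ.re + z.im * ζ.im)) / D.h s) • q)), Complex.I * ζ), ?_, ?_, ?_⟩
    · rw [fderiv_stiefel]
      simp [inner_smul_right, inner_smul_left, hqp, hpq, hnq, hnp]
    · rw [OpenBookData.bindingAmb_apply]
      simp only [inner_smul_right, hp, ← hs]
      simp
      field_simp
      ring
    · rw [fderiv_bindingAmb, fderiv_bindingAmb]
      simp only [← hs, hξp, hξq, inner_smul_right, inner_smul_left, inner_neg_left, hqp, hp]
      have hζ2 : 0 < ζ.re ^ 2 + ζ.im ^ 2 := by
        have := Complex.normSq_pos.2 hζ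
        rw [Complex.normSq_apply] at this
        linarith
      have ha' : a = -(D.k s * (z.re * ζ.im - z.im * ζ.re)) / D.h s := by
        rw [eq_div_iff hpos.ne']
        linarith
      rw [ha']
      have hfin := mul_pos (mul_pos two_pos hζ2) hcon
      rw [← div_pos_iff_of_pos_right hpos] at hfin
      refine ne_of_gt (hfin.trans_eq ?_)
      simp
      field_simp
      rw [hs']
      ring
  -- Otherwise the hyperplane part is paired with its rotated copy, and the value is h times its
  -- squared norm.
  · refine ⟨((ξp + a • q, -(ξq - a • p)), 0), ?_, ?_, ?_⟩
    · rw [fderiv_stiefel]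
      simp [inner_sub_right, inner_add_left, inner_add_right, inner_smul_right, inner_smul_left, hqp, hnq, hnp,
        h1, h3, ← ha]
      rw [c4, h2]
    · rw [OpenBookData.bindingAmb_apply]
      simp [inner_add_right, inner_smul_right, h2, hpq]
    · rw [fderiv_bindingAmb, fderiv_bindingAmb]
      simp only [Complex.zero_re, Complex.zero_im, inner_add_right, inner_smul_right, h2, hpq]
      have e1 : ⟪ξp + a • q, ξp + a • q⟫_ℝ = ⟪ξp, ξp⟫_ℝ + a * ⟪ξp, q⟫_ℝ := by
        simp only [inner_add_left, inner_add_right, inner_smul_left, inner_smul_right, conj_trivial, hq, h3]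
        ring
      have e2 : ⟪ξq - a • p, ξq - a • p⟫_ℝ = ⟪ξq - a • p, ξq⟫_ℝ := by
        simp only [inner_sub_left, inner_sub_right, inner_smul_left, inner_smul_right, conj_trivial, hp, c3,
          ← ha]
        ring
      have h5 := real_inner_self_nonneg (x := ξp + a • q)
      have h6 := real_inner_self_nonneg (x := ξq - a • p)
      have h7 : 0 < ⟪ξp + a • q, ξp + a • q⟫_ℝ + ⟪ξq - a • p, ξq - a • p⟫_ℝ := by
        refine lt_of_le_of_ne (add_nonneg h5 h6) fun h => hperp ⟨?_, ?_⟩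
        · exact inner_self_eq_zero.1 (show ⟪ξq - a • p, ξq - a • p⟫_ℝ = 0 by linarith)
        · exact inner_self_eq_zero.1 (show ⟪ξp + a • q, ξp + a • q⟫_ℝ = 0 by linarith)
      refine ne_of_gt ((mul_pos hpos h7).trans_eq ?_)
      rw [e1, e2, inner_neg_left]
      ring

end Binding

/-! ### The contact form of the sphere and the open book -/

namespace OpenBookData
variable (D : OpenBookData)

theorem tderiv_bindingMap (b : bindingPiece D n) (v : EuclideanSpace ℝ (Fin (2 * n + 1))) :
    tderiv (V := Cx n) (𝓡 (2 * n + 1)) (fun w : OddSphere n => (w : Cx n)) (D.bindingMap b)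
      (mfderiv (𝓡 (2 * n + 1)) (𝓡 (2 * n + 1)) D.bindingMap b v : EuclideanSpace ℝ (Fin (2 * n + 1))) =
    tderiv (𝓡 (2 * n + 1)) (fun b : bindingPiece D n => D.bmap b.1) b v :=
  (DFunLike.congr_fun (mfderiv_comp b (mdifferentiable_coe_sphere (D.bindingMap b))
    (D.contMDiff_bindingMap.mdifferentiable (by simp) b)) v).symm

theorem tderiv_pageMap (m : pagePiece n) (v : EuclideanSpace ℝ (Fin (2 * n + 1))) :
    tderiv (V := Cx n) (𝓡 (2 * n + 1)) (fun w : OddSphere n => (w : Cx n)) (D.pageMap m)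
      (mfderiv (𝓡 (2 * n + 1)) (𝓡 (2 * n + 1)) D.pageMap m v : EuclideanSpace ℝ (Fin (2 * n + 1))) =
    tderiv (𝓡 (2 * n + 1)) (fun m : pagePiece n => D.pmap m.1) m v :=
  (DFunLike.congr_fun (mfderiv_comp m (mdifferentiable_coe_sphere (D.pageMap m))
    (D.contMDiff_pageMap.mdifferentiable (by simp) m)) v).symm

/-- The chain rule needs `i` to be differentiable; this comes for free, as `i` is `ψ` followed by
the inverse diffeomorphism. -/
theorem pullback_obDiffeo {N : Type*} [TopologicalSpace N]
    [ChartedSpace (EuclideanSpace ℝ (Fin (2 * n + 1))) N] {i : N → D.OB n} {ψ : N → OddSphere n}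
    (hψ : ContMDiff (𝓡 (2 * n + 1)) (𝓡 (2 * n + 1)) ∞ ψ) (hi : ∀ x, D.obDiffeo n (i x) = ψ x)
    (α : OneForm (𝓡 (2 * n + 1)) (OddSphere n)) :
    pullback (𝓡 (2 * n + 1)) i (pullback (𝓡 (2 * n + 1)) (D.obDiffeo n) α) =
      pullback (𝓡 (2 * n + 1)) ψ α := by
  obtain rfl : (D.obDiffeo n) ∘ i = ψ := funext hi
  have hi' : ContMDiff (𝓡 (2 * n + 1)) (𝓡 (2 * n + 1)) ∞ i := by
    have h := (D.obDiffeo n).symm.contMDiff.comp hψ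
    have e : (D.obDiffeo n).symm ∘ (D.obDiffeo n) ∘ i = i := funext fun x =>
      (D.obDiffeo n).symm_apply_apply (i x)
    rwa [e] at h
  funext x
  ext v
  have h := mfderiv_comp x ((D.obDiffeo n).contMDiff.mdifferentiable (by simp) (i x))
    (hi'.mdifferentiable (by simp) x)
  have h2 := DFunLike.congr_fun h v
  simp only [pullback, ContinuousLinearMap.comp_apply]
  exact congrArg (α (D.obDiffeo n (i x))) h2.symm

/-- The contact form on the sphere defines the contact structure of the open book. -/
theorem definesContactStructure (n : ℕ) :
    D.DefinesContactStructure (pullback (𝓡 (2 * n + 1)) (D.obDiffeo n) (D.alpha n)) := by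
  refine ⟨fun b => ⟨1, one_pos, ?_⟩, fun m => ⟨1, one_pos, ?_⟩⟩
  · rw [D.pullback_obDiffeo D.contMDiff_bindingMap (fun b => rfl), one_smul]
    ext v
    refine (congrArg (D.sphereForm (D.bmap b.1)) (D.tderiv_bindingMap b v)).trans ?_
    exact D.sphereForm_bmap b v
  · rw [D.pullback_obDiffeo D.contMDiff_pageMap (fun b => rfl), one_smul]
    ext v
    refine (congrArg (D.sphereForm (D.pmap m.1)) (D.tderiv_pageMap m v)).trans ?_
    exact D.sphereForm_pmap m v

theorem alpha_contact_at (w : OddSphere n) :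
    ContMDiffAt (𝓡 (2 * n + 1)) ((𝓡 (2 * n + 1)).prod 𝓘(ℝ, EuclideanSpace ℝ (Fin (2 * n + 1)) →L[ℝ] ℝ)) ∞
      (fun x => Bundle.TotalSpace.mk' (EuclideanSpace ℝ (Fin (2 * n + 1)) →L[ℝ] ℝ)
        (E := fun x : OddSphere n => TangentSpace (𝓡 (2 * n + 1)) x →L[ℝ] ℝ) x (D.alpha n x)) w ∧
    D.alpha n w ≠ 0 ∧ ∀ v, D.alpha n w v = 0 → v ≠ 0 →
      ∃ v', D.alpha n w v' = 0 ∧ dForm (D.alpha n) w v v' ≠ 0 := by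
  rcases D.binding_or_page w with h | h
  · obtain ⟨j, hj, hjw⟩ := D.exists_binding_section h
    exact contactForm_of_section (bindingPiece_regular D n) (fun w v => rfl)
      (fun x => D.contDiff_bmap.contDiffAt) hj (hjw.mono fun w hw => congrArg Subtype.val hw)
      D.sphereForm_bmap (isContactAt_binding D (j w).2)
  · obtain ⟨θ₀, hθ⟩ := exists_arg w
    obtain ⟨j, hj, hjw, -⟩ := D.exists_page_section hθ h
    refine contactForm_of_section (pagePiece_regular n) (fun w v => rfl)
      (fun x => D.contDiffAt_pmap x.2.2.2) hj (hjw.mono fun w hw => congrArg Subtype.val hw)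
      D.sphereForm_pmap (isContactAt_page ?_ (j w).2.2.1)
    rw [real_inner_self_eq_norm_sq, (j w).2.1, one_pow]

theorem isContactForm_alpha (n : ℕ) : IsContactForm (D.alpha n) where
  smooth w := (D.alpha_contact_at w).1
  ne_zero w := (D.alpha_contact_at w).2.1
  nondegenerate w := (D.alpha_contact_at w).2.2

/-! ### Circle invariance -/

theorem sphereForm_smul {g : ℂ} (hg : ‖g‖ = 1) (w v : Cx n) :
    D.sphereForm (g • w) (g • v) = D.sphereForm w v := by
  have h : conj g * g = 1 := by
    rw [← Complex.normSq_eq_conj_mul_self, Complex.normSq_eq_norm_sq, hg]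
    simp
  simp only [sphereForm_apply, cj_smul, dot_smul_left, dot_smul_right, norm_mul, hg, one_mul, map_mul]
  congr 3
  · linear_combination dot (cj w) v * h
  · linear_combination conj (dot w w) * (2 * dot w v) * (conj g * g + 1) * h

end OpenBookData

theorem contMDiff_circle_smul (g : Circle) :
    ContMDiff (𝓡 (2 * n + 1)) (𝓡 (2 * n + 1)) ∞ (fun z : OddSphere n => g • z) :=
  ContMDiff.codRestrict_sphere (f := fun z : OddSphere n => (g : ℂ) • (z : Cx n))
    (((ContinuousLinearMap.lsmul ℝ ℂ (g : ℂ)).contDiff.contMDiff).comp (contMDiff_coe_sphere)) _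

theorem tderiv_circle_smul (g : Circle) (z : OddSphere n) (v : EuclideanSpace ℝ (Fin (2 * n + 1))) :
    tderiv (V := Cx n) (𝓡 (2 * n + 1)) (fun w : OddSphere n => (w : Cx n)) (g • z)
      (mfderiv (𝓡 (2 * n + 1)) (𝓡 (2 * n + 1)) (fun z : OddSphere n => g • z) z v :
        EuclideanSpace ℝ (Fin (2 * n + 1))) =
    (g : ℂ) • tderiv (V := Cx n) (𝓡 (2 * n + 1)) (fun w : OddSphere n => (w : Cx n)) z v := by
  have h1 := DFunLike.congr_fun (mfderiv_comp z (mdifferentiable_coe_sphere (g • z))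
    ((contMDiff_circle_smul g).mdifferentiable (by simp) z)) v
  have h2 := (((ContinuousLinearMap.lsmul ℝ ℂ (g : ℂ)).hasFDerivAt (x := (z : Cx n))).hasMFDerivAt.comp z
    (hasMFDerivAt_tderiv (mdifferentiable_coe_sphere z))).mfderiv
  exact h1.symm.trans (DFunLike.congr_fun h2 v)

theorem contMDiff_circle_orbit (z : OddSphere n) :
    ContMDiff 𝓘(ℝ, ℝ) (𝓡 (2 * n + 1)) ∞ (fun t : ℝ => Circle.exp t • z) := by
  refine ContMDiff.codRestrict_sphere (f := fun t : ℝ => rot t • (z : Cx n)) ?_ _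
  exact (contDiff_rot.smul contDiff_const).contMDiff

/-- The circle field is multiplication by `i`. -/
theorem tderiv_circleField (z : OddSphere n) :
    tderiv (V := Cx n) (𝓡 (2 * n + 1)) (fun w : OddSphere n => (w : Cx n)) z
      (circleField z : EuclideanSpace ℝ (Fin (2 * n + 1))) = Complex.I • (z : Cx n) := by
  have hz : Circle.exp 0 • z = z := by rw [Circle.exp_zero, one_smul]
  have h1 := DFunLike.congr_fun (mfderiv_comp (0 : ℝ) (mdifferentiable_coe_sphere (Circle.exp 0 • z))
    ((contMDiff_circle_orbit z).mdifferentiable (by simp) 0)) (1 : ℝ)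
  have h2 : HasDerivAt (fun t : ℝ => rot t • (z : Cx n)) (Complex.I • (z : Cx n)) 0 := by
    have := (hasDerivAt_rot 0).smul_const (z : Cx n)
    simpa using this
  have h3 : mfderiv 𝓘(ℝ, ℝ) 𝓘(ℝ, Cx n) (fun t : ℝ => rot t • (z : Cx n)) 0 (1 : ℝ) =
      Complex.I • (z : Cx n) := by
    rw [h2.hasFDerivAt.hasMFDerivAt.mfderiv]
    exact one_smul ℝ _
  have h4 := h1.symm.trans h3
  rw [hz] at h4
  exact h4

namespace OpenBookData
variable (D : OpenBookData)

theorem isCircleInvariant_alpha (n : ℕ) : IsCircleInvariant (D.alpha n) := by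
  intro g
  funext z
  ext v
  refine (congrArg (D.sphereForm _) (tderiv_circle_smul g z v)).trans ?_
  exact D.sphereForm_smul (Circle.norm_coe g) _ _

/-! ### The level on which the circle field is tangent to the contact structure -/

/-- The contact form on the circle field, as a function of `|Q|`. -/
theorem alpha_circleField (z : OddSphere n) : D.alpha n z (circleField z) =
    D.coefF ‖dot z.1 z.1‖ + 2 * ‖dot z.1 z.1‖ ^ 2 * D.coefG ‖dot z.1 z.1‖ := by
  have h : dot (cj (z : Cx n)) z = 1 := by
    rw [dot_cj_self, norm_coe_sphere]
    simp
  refine (congrArg (D.sphereForm z.1) (tderiv_circleField z)).trans ?_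
  rw [sphereForm_apply, dot_smul_right, dot_smul_right, h]
  have h2 : conj (dot z.1 z.1) * (2 * (Complex.I * dot z.1 z.1)) =
      ((2 * ‖dot z.1 z.1‖ ^ 2 : ℝ) : ℂ) * Complex.I := by
    push_cast
    rw [← Complex.conj_mul']
    ring
  rw [h2, Complex.im_ofReal_mul]
  simp
  ring

/-- The circle field turns the frame once and Q twice, which accounts for the coefficients -1 and 2.
At Q = 0 the formula survives division by zero because H₂ vanishes at the binding. -/
theorem alpha_circleField_of_lt {z : OddSphere n} (h : ‖dot z.1 z.1‖ < 1) :
    D.alpha n z (circleField z) =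
      -D.H₁ (D.tinv ‖dot z.1 z.1‖) + 2 * D.H₂ (D.tinv ‖dot z.1 z.1‖) := by
  rw [alpha_circleField, coefF, coefG, if_pos h, if_pos h]
  set s := ‖dot z.1 z.1‖ with hs
  have hs0 : 0 ≤ s := norm_nonneg _
  have hc : 0 < √(1 - s ^ 2) := Real.sqrt_pos.2 (by nlinarith)
  have hc2 : √(1 - s ^ 2) ^ 2 = 1 - s ^ 2 := Real.sq_sqrt (by nlinarith)
  rcases hs0.eq_or_lt with h0 | h0
  · rw [← h0, D.tinv_zero, D.H₂_binding (by linarith [D.δ_pos, D.r₀_pos])]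
    simp
  · generalize √(1 - s ^ 2) = c at *
    have h1 : s ^ 2 = (1 - c) * (1 + c) := by linarith
    have h2 : s ^ 2 * (D.H₁ (D.tinv s) / (2 * c * (1 + c))) = D.H₁ (D.tinv s) * (1 - c) / (2 * c) := by
      rw [h1]; field_simp
    have h3 : s ^ 2 * (D.H₂ (D.tinv s) / s ^ 2) = D.H₂ (D.tinv s) := by field_simp
    have h4 : -(D.H₁ (D.tinv s) / c) + D.H₁ (D.tinv s) * (1 - c) / c = -D.H₁ (D.tinv s) := by
      field_simp; ring
    linear_combination h4 + 2 * h3 + 2 * h2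

theorem alpha_circleField_of_eq {z : OddSphere n} (h : ‖dot z.1 z.1‖ = 1) :
    D.alpha n z (circleField z) = D.C / Real.pi := by
  rw [alpha_circleField, coefF, coefG, h, if_neg (lt_irrefl _), if_neg (lt_irrefl _)]
  have := Real.pi_pos
  field_simp
  ring

/-- The dividing level of the contact form. -/
theorem exists_dividing_level : ∃ s₀, 0 < s₀ ∧ s₀ < 1 ∧
    ∀ n, almostDividingSet (D.alpha n) = {x | ∀ z : OddSphere n, hopf z = x → ‖dot z.1 z.1‖ = s₀} := by
  obtain ⟨t₀, ht₀, h⟩ := D.exists_level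
  refine ⟨D.sig t₀, ?_, D.sig_lt_one _, fun n => ?_⟩
  · rw [← D.sig_zero]
    exact D.strictAnti_sig ht₀
  · ext x
    refine forall_congr' fun z => imp_congr_right fun _ => ?_
    rcases (norm_dot_le_one z).lt_or_eq with h1 | h1
    · rw [D.alpha_circleField_of_lt h1]
      have h2 : D.tinv ‖dot z.1 z.1‖ ≤ 1 + D.r₀ := by
        by_contra! h3
        have h4 := D.strictAnti_sig h3
        rw [D.sig_tinv h1, D.sig_zero] at h4
        exact absurd (norm_nonneg _) (not_le.2 h4)
      have h3 := h _ h2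
      constructor
      · intro h4
        rw [← h3.1 (by linarith), D.sig_tinv h1]
      · intro h4
        rw [h4, D.tinv_sig] at h3
        rw [h4, D.tinv_sig]
        linarith [h3.2 rfl]
    · rw [D.alpha_circleField_of_eq h1, h1]
      constructor
      · intro h2
        exact absurd h2 (div_pos D.C_pos Real.pi_pos).ne'
      · intro h2
        exact absurd h2 (D.sig_lt_one t₀).ne'

end OpenBookData

/-! ### Quotients by deck transformations -/

section Deck
variable {E X Y : Type*} [NormedAddCommGroup E] [NormedSpace ℝ E]
  [TopologicalSpace X] [ChartedSpace E X] [TopologicalSpace Y] {p : X → Y}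

/-- The fibres of `p` are locally exchanged by smooth maps. -/
def HasSmoothDeck (p : X → Y) : Prop :=
  ∀ a b, p a = p b → ∃ k : X → X, k a = b ∧ ContMDiffAt 𝓘(ℝ, E) 𝓘(ℝ, E) ∞ k a ∧
    ∀ᶠ x in 𝓝 a, p (k x) = p x

theorem HasSmoothDeck.contMDiff (hk : HasSmoothDeck (E := E) p) (hp : IsLocalHomeomorph p)
    (hs : Function.Surjective p) :
    letI := hp.chartedSpace (H := E) hs
    ContMDiff 𝓘(ℝ, E) 𝓘(ℝ, E) ∞ p := fun a =>
  IsLocalHomeomorph.contMDiffAt_of_lift hp hs fun x hx => hk a x hx.symm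

variable [IsManifold 𝓘(ℝ, E) ∞ X]

/-- A change of charts of the quotient passes from one sheet of `p` to another. Near each point it
is a deck map `k` read in charts of `X`. -/
theorem HasSmoothDeck.isManifold (hk : HasSmoothDeck (E := E) p) (hp : IsLocalHomeomorph p)
    (hs : Function.Surjective p) :
    letI := hp.chartedSpace (H := E) hs
    IsManifold 𝓘(ℝ, E) ∞ Y := by
  let := hp.chartedSpace (H := E) hs
  apply isManifold_of_contDiffOn
  rintro _ _ ⟨y, rfl⟩ ⟨y', rfl⟩ u hu
  set x := hs.hasRightInverse.choose y
  set x' := hs.hasRightInverse.choose y'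
  have hu : (u ∈ (chartAt E x).target ∧ (chartAt E x).symm u ∈ (hp.localInverseAt x).target) ∧
      p ((chartAt E x).symm u) ∈ (hp.localInverseAt x').source ∧
      hp.localInverseAt x' (p ((chartAt E x).symm u)) ∈ (chartAt E x').source := by
    have := hu.1
    simp only [modelWithCornersSelf_coe_symm, Set.preimage_id] at this
    simpa [OpenPartialHomeomorph.trans_source] using this
  obtain ⟨⟨hu1, hu2⟩, hu3, hu4⟩ := hu
  set a := (chartAt E x).symm u with ha
  have hb : p (hp.localInverseAt x' (p a)) = p a := hp.apply_localInverseAt_of_mem hu3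
  obtain ⟨k, hka, hks, hkp⟩ := hk a _ hb.symm
  have h1 : ContMDiffAt 𝓘(ℝ, E) 𝓘(ℝ, E) ∞ (chartAt E x).symm u :=
    contMDiffAt_symm_of_mem_maximalAtlas (IsManifold.chart_mem_maximalAtlas x) hu1
  have h3 : ContMDiffAt 𝓘(ℝ, E) 𝓘(ℝ, E) ∞ (chartAt E x') (k a) :=
    contMDiffAt_of_mem_maximalAtlas (IsManifold.chart_mem_maximalAtlas x') (by rwa [hka])
  have h4 := h3.comp a hks
  have h5 : ContMDiffAt 𝓘(ℝ, E) 𝓘(ℝ, E) ∞ ((chartAt E x' ∘ k) ∘ (chartAt E x).symm) u := h4.comp u h1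
  refine (h5.contDiffAt.congr_of_eventuallyEq ?_).contDiffWithinAt
  have hcont : ContinuousAt (chartAt E x).symm u := h1.continuousAt
  have e1 : ∀ᶠ u' in 𝓝 u, p (k ((chartAt E x).symm u')) = p ((chartAt E x).symm u') :=
    hcont.eventually hkp
  have e2 : ∀ᶠ u' in 𝓝 u, k ((chartAt E x).symm u') ∈ (hp.localInverseAt x').target := by
    have h6 : ContinuousAt (fun u' => k ((chartAt E x).symm u')) u := hks.continuousAt.comp hcont
    refine h6.eventually_mem ((hp.localInverseAt x').open_target.mem_nhds ?_)
    change k a ∈ _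
    rw [hka]
    exact (hp.localInverseAt x').map_source hu3
  filter_upwards [e1, e2] with u' h7 h8
  change chartAt E x' (hp.localInverseAt x' ((hp.localInverseAt x).symm ((chartAt E x).symm u'))) =
    chartAt E x' (k ((chartAt E x).symm u'))
  rw [hp.localInverseAt_symm, ← h7]
  congr 1
  have := (hp.localInverseAt x').right_inv h8
  rwa [IsLocalHomeomorph.localInverseAt_symm] at this

/-- The local inverse used to define the chart at `y` is itself a smooth section: in the charts at
`y` and at the chosen preimage it is the identity. -/
theorem HasSmoothDeck.exists_section (hk : HasSmoothDeck (E := E) p) (hp : IsLocalHomeomorph p)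
    (hs : Function.Surjective p) (y : Y) :
    letI := hp.chartedSpace (H := E) hs
    ∃ j : Y → X, ContMDiffAt 𝓘(ℝ, E) 𝓘(ℝ, E) ∞ j y ∧ ∀ᶠ w in 𝓝 y, p (j w) = w := by
  let := hp.chartedSpace (H := E) hs
  have := hk.isManifold hp hs
  set x := hs.hasRightInverse.choose y
  have hx : p x = y := hs.hasRightInverse.choose_spec y
  have hy : y ∈ (hp.localInverseAt x).source := by rw [← hx]; simp
  have hyx : hp.localInverseAt x y = x := by rw [← hx]; simp
  refine ⟨hp.localInverseAt x, ?_, ?_⟩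
  · have h1 : ContMDiffAt 𝓘(ℝ, E) 𝓘(ℝ, E) ∞ (chartAt E y) y :=
      contMDiffAt_of_mem_maximalAtlas (IsManifold.chart_mem_maximalAtlas y) (mem_chart_source E y)
    have h2 : ContMDiffAt 𝓘(ℝ, E) 𝓘(ℝ, E) ∞ (chartAt E x).symm (chartAt E y y) := by
      refine contMDiffAt_symm_of_mem_maximalAtlas (IsManifold.chart_mem_maximalAtlas x) ?_
      change chartAt E x (hp.localInverseAt x y) ∈ _
      rw [hyx]
      exact mem_chart_target E x
    refine (h2.comp y h1).congr_of_eventuallyEq ?_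
    have h3 : ∀ᶠ w in 𝓝 y, hp.localInverseAt x w ∈ (chartAt E x).source :=
      ((hp.localInverseAt x).continuousAt hy).eventually_mem
        ((chartAt E x).open_source.mem_nhds (by rw [hyx]; exact mem_chart_source E x))
    filter_upwards [h3] with w hw
    exact ((chartAt E x).left_inv hw).symm
  · filter_upwards [(hp.localInverseAt x).open_source.mem_nhds hy] with w hw
    exact hp.apply_localInverseAt_of_mem hw

end Deck

/-- A chart of the level set is a linear map restricted to it, so the invertible differential of the
chart factors through that of the inclusion. -/
theorem IsRegularLevel.tderiv_val_injective {V F : Type*} [NormedAddCommGroup V] [NormedSpace ℝ V]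
    [FiniteDimensional ℝ V] [NormedAddCommGroup F] [NormedSpace ℝ F] [FiniteDimensional ℝ F]
    {S Ω : Set V} {f : V → F} {d : ℕ} (hS : IsRegularLevel S Ω f d) (x : S) :
    letI := levelChartedSpace hS
    Function.Injective (tderiv (𝓡 d) (Subtype.val : S → V) x) := by
  let := levelChartedSpace hS
  have := levelIsManifold hS
  obtain ⟨B, g, hB, -⟩ := hS.exists_param x
  have h1 := (B.hasFDerivAt (x := (x : V))).hasMFDerivAt.comp x
    (hasMFDerivAt_tderiv (hS.contMDiff_val.mdifferentiable (by simp) x))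
  have h2 : B ∘ (Subtype.val : S → V) = extChartAt (𝓡 d) x := by
    funext y
    exact (hB y).symm
  rw [h2] at h1
  have h3 := (isInvertible_mfderiv_extChartAt (I := 𝓡 d) (mem_extChartAt_source (I := 𝓡 d) x)).injective
  rw [h1.mfderiv] at h3
  exact Function.Injective.of_comp (f := B) h3

/-! ### The Hopf fibration -/

theorem contDiffAt_affineCoord (i : Fin (n + 1)) {z : Cx n} (hz : z i ≠ 0) :
    ContDiffAt ℝ ∞ (affineCoord i) z := by
  have hv : ∀ k, ContDiffAt ℝ ∞ (fun w : Cx n => w k) z := fun k =>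
    ((EuclideanSpace.proj k : Cx n →L[ℂ] ℂ).restrictScalars ℝ).contDiff.contDiffAt
  refine (PiLp.contDiff_toLp (𝕜 := ℝ)).contDiffAt.comp z (contDiffAt_pi.2 fun l => ?_)
  simp only [div_eq_mul_inv]
  exact (hv (i.succAbove l)).mul ((hv i).inv hz)

/-- By the quotient rule, vanishing of the differential says Wₖ zᵢ = Wᵢ zₖ for all k: the fibres of
the affine coordinates lie in complex lines. -/
theorem fderiv_affineCoord_eq_zero {i : Fin (n + 1)} {z W : Cx n} (hz : z i ≠ 0)
    (h : fderiv ℝ (affineCoord i) z W = 0) : W = (W i / z i) • z := by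
  ext k
  have h1 := ((contDiffAt_affineCoord i hz).differentiableAt (by simp)).hasFDerivAt.hasLineDerivAt W
  have h1 : HasDerivAt (fun τ : ℝ => affineCoord i (z + τ • W)) 0 0 := h ▸ h1
  rcases Fin.eq_self_or_eq_succAbove i k with rfl | ⟨l, rfl⟩
  · simp [hz]
  · have hp : ∀ k, HasDerivAt (fun τ : ℝ => (z + τ • W) k) (W k) 0 := fun k =>
      ((EuclideanSpace.proj k : Cx n →L[ℂ] ℂ).restrictScalars ℝ).hasFDerivAt.comp_hasDerivAt 0
        (hasDerivAt_line z W)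
    have h2 : HasDerivAt (fun τ : ℝ => affineCoord i (z + τ • W) l) 0 0 :=
      ((EuclideanSpace.proj l : EuclideanSpace ℂ (Fin n) →L[ℂ] ℂ).restrictScalars ℝ).hasFDerivAt.comp_hasDerivAt 0 h1
    have h3 := h2.unique ((hp (i.succAbove l)).div (hp i) (by simpa using hz))
    simp only [zero_smul, add_zero] at h3
    rw [eq_comm, div_eq_zero_iff] at h3
    have h4 := h3.resolve_right (pow_ne_zero _ hz)
    simp only [PiLp.smul_apply, smul_eq_mul]
    field_simp
    linear_combination h4

theorem continuous_hopf : Continuous (hopf (n := n)) := continuous_quotient_mk'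

theorem extChartAt_hopf (z : OddSphere n) : ∃ i, (z : Cx n) i ≠ 0 ∧
    ∀ w : OddSphere n, extChartAt 𝓘(ℝ, EuclideanSpace ℂ (Fin n)) (hopf z) (hopf w) = affineCoord i w :=
  ⟨_, (exists_affineChart (hopf z)).choose_spec, fun _ => rfl⟩

theorem contMDiff_hopf :
    ContMDiff (𝓡 (2 * n + 1)) 𝓘(ℝ, EuclideanSpace ℂ (Fin n)) ∞ (hopf (n := n)) := by
  intro z
  refine contMDiffAt_iff_target.2 ⟨continuous_hopf.continuousAt, ?_⟩
  obtain ⟨i, hi, h⟩ := extChartAt_hopf z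
  have e : extChartAt 𝓘(ℝ, EuclideanSpace ℂ (Fin n)) (hopf z) ∘ hopf =
      fun w : OddSphere n => affineCoord i w := funext h
  rw [e]
  exact (contDiffAt_affineCoord i hi).contMDiffAt.comp z contMDiff_coe_sphere.contMDiffAt

/-- The differential of the Hopf fibration. -/
def hopfDeriv (z : OddSphere n) :
    EuclideanSpace ℝ (Fin (2 * n + 1)) →L[ℝ] EuclideanSpace ℂ (Fin n) :=
  mfderiv (𝓡 (2 * n + 1)) 𝓘(ℝ, EuclideanSpace ℂ (Fin n)) hopf z

theorem tderiv_sphere_re (z : OddSphere n) (w : EuclideanSpace ℝ (Fin (2 * n + 1))) :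
    (dot (cj (z : Cx n))
      (tderiv (V := Cx n) (𝓡 (2 * n + 1)) (fun w : OddSphere n => (w : Cx n)) z w)).re = 0 := by
  obtain ⟨c, hc⟩ := exists_hasVelocity (I := 𝓡 (2 * n + 1)) z w
  have hx := hc.hasDerivAt_comp (mdifferentiable_coe_sphere z)
  have h0 : c 0 = z := hc.zero
  have h1 := hx.norm_sq
  simp only [norm_coe_sphere] at h1
  have h2 := h1.unique (hasDerivAt_const (0 : ℝ) ((1 : ℝ) ^ 2))
  rw [h0] at h2
  rw [← inner_eq_dot]
  have h3 : ⟪(z : Cx n), tderiv (V := Cx n) (𝓡 (2 * n + 1)) (fun w : OddSphere n => (w : Cx n)) z w⟫_ℝ = 0 := by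
    linarith
  refine Eq.trans ?_ h3
  simp [PiLp.inner_apply, Complex.inner]

/-- The kernel of the differential of the Hopf fibration is spanned by the circle field. -/
theorem hopfDeriv_eq_zero {z : OddSphere n} {w : EuclideanSpace ℝ (Fin (2 * n + 1))}
    (h : hopfDeriv z w = 0) : ∃ a : ℝ, w = a • (circleField z : EuclideanSpace ℝ (Fin (2 * n + 1))) := by
  obtain ⟨i, hi, hc⟩ := extChartAt_hopf z
  have h1 := mfderiv_comp z (I'' := 𝓘(ℝ, EuclideanSpace ℂ (Fin n)))
    (mdifferentiableAt_extChartAt (I := 𝓘(ℝ, EuclideanSpace ℂ (Fin n))) (mem_chart_source _ (hopf z)))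
    (contMDiff_hopf.mdifferentiable (by simp) z)
  have e : extChartAt 𝓘(ℝ, EuclideanSpace ℂ (Fin n)) (hopf z) ∘ hopf =
      fun w : OddSphere n => affineCoord i w := funext hc
  rw [e] at h1
  have h2 := (((contDiffAt_affineCoord i hi).differentiableAt (by simp)).hasFDerivAt.hasMFDerivAt.comp z
    (hasMFDerivAt_tderiv (mdifferentiable_coe_sphere z))).mfderiv
  set W := tderiv (V := Cx n) (𝓡 (2 * n + 1)) (fun w : OddSphere n => (w : Cx n)) z w with hW
  have h3 : fderiv ℝ (affineCoord i) z W = 0 := by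
    refine ((DFunLike.congr_fun h2 w).symm.trans (DFunLike.congr_fun h1 w)).trans ?_
    refine (congrArg (mfderiv 𝓘(ℝ, EuclideanSpace ℂ (Fin n)) 𝓘(ℝ, EuclideanSpace ℂ (Fin n))
      (extChartAt 𝓘(ℝ, EuclideanSpace ℂ (Fin n)) (hopf z)) (hopf z)) h).trans (map_zero _)
  have h4 := fderiv_affineCoord_eq_zero hi h3
  -- The ambient vector is μz, and tangency to the sphere makes μ purely imaginary.
  set μ := W i / (z : Cx n) i
  have h5 := tderiv_sphere_re z w
  rw [← hW, h4, dot_smul_right, dot_cj_self, norm_coe_sphere] at h5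
  have h5 : μ.re = 0 := by simpa using h5
  refine ⟨μ.im, tderiv_coe_sphere_injective z ?_⟩
  refine Eq.trans h4 (Eq.trans ?_ (((tderiv (V := Cx n) (𝓡 (2 * n + 1)) (fun w : OddSphere n => (w : Cx n))
    z).map_smul μ.im _).trans (congrArg (μ.im • ·) (tderiv_circleField z))).symm)
  have h6 : μ = μ.im * Complex.I := by
    apply Complex.ext <;> simp [h5]
  conv_lhs => rw [h6, mul_smul]
  rfl

theorem hopf_smul (g : Circle) (z : OddSphere n) : hopf (g • z) = hopf z := hopf_eq_iff.2 ⟨g, rfl⟩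

theorem hopfDeriv_smul (g : Circle) (z : OddSphere n) (w : EuclideanSpace ℝ (Fin (2 * n + 1))) :
    hopfDeriv (g • z) (mfderiv (𝓡 (2 * n + 1)) (𝓡 (2 * n + 1)) (fun z : OddSphere n => g • z) z w :
      EuclideanSpace ℝ (Fin (2 * n + 1))) = hopfDeriv z w := by
  have h1 := DFunLike.congr_fun (mfderiv_comp z (contMDiff_hopf.mdifferentiable (by simp) (g • z))
    ((contMDiff_circle_smul g).mdifferentiable (by simp) z)) w
  have e : hopf ∘ (fun z : OddSphere n => g • z) = hopf := funext (hopf_smul g)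
  rw [e] at h1
  exact h1.symm

/-- Properness of the action makes ℂPⁿ Hausdorff, which is needed for injective continuous maps from
compact spaces to be embeddings. -/
instance (n : ℕ) : ProperSMul Circle (OddSphere n) where
  isProperMap_smul_pair := by
    refine Continuous.isProperMap ?_
    refine Continuous.prodMk (Continuous.subtype_mk ?_ _) continuous_snd
    exact (continuous_subtype_val.comp continuous_fst).smul
      (continuous_subtype_val.comp continuous_snd)

/-! ### The unit cotangent bundle of real projective space -/

theorem contMDiff_units_smul (u : ℤˣ) :
    ContMDiff (𝓡 (2 * n - 1)) (𝓡 (2 * n - 1)) ∞ (fun x : unitCotangentSphere n => u • x) := by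
  intro x
  refine (unitCotangentSphere_regular n).contMDiffAt_of_val ?_
  have h : ContDiff ℝ ∞ fun y : Euc n × Euc n => (((u : ℤ) : ℝ) • y.1, ((u : ℤ) : ℝ) • y.2) :=
    (contDiff_fst.const_smul _).prodMk (contDiff_snd.const_smul _)
  exact h.contMDiff.contMDiffAt.comp x ((unitCotangentSphere_regular n).contMDiff_val x)

theorem toUnitCotangentRP_eq_iff {x y : unitCotangentSphere n} :
    toUnitCotangentRP x = toUnitCotangentRP y ↔ ∃ u : ℤˣ, u • y = x := by
  rw [toUnitCotangentRP, toUnitCotangentRP, Quotient.eq]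
  exact Iff.rfl

theorem toUnitCotangentRP_surjective : Function.Surjective (toUnitCotangentRP (n := n)) :=
  Quotient.mk_surjective

theorem isLocalHomeomorph_toUnitCotangentRP : IsLocalHomeomorph (toUnitCotangentRP (n := n)) :=
  isQuotientCoveringMap_quotientMk_of_properlyDiscontinuousSMul.isCoveringMap.isLocalHomeomorph

theorem hasSmoothDeck_toUnitCotangentRP :
    HasSmoothDeck (E := EuclideanSpace ℝ (Fin (2 * n - 1))) (toUnitCotangentRP (n := n)) := by
  intro a b h
  obtain ⟨u, rfl⟩ := toUnitCotangentRP_eq_iff.1 h.symm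
  exact ⟨fun x => u • x, rfl, contMDiff_units_smul u a,
    .of_forall fun x => toUnitCotangentRP_eq_iff.2 ⟨u, rfl⟩⟩

instance (n : ℕ) : IsManifold (𝓡 (2 * n - 1)) ∞ (UnitCotangentRP n) :=
  hasSmoothDeck_toUnitCotangentRP.isManifold isLocalHomeomorph_toUnitCotangentRP
    toUnitCotangentRP_surjective

theorem contMDiff_toUnitCotangentRP :
    ContMDiff (𝓡 (2 * n - 1)) (𝓡 (2 * n - 1)) ∞ (toUnitCotangentRP (n := n)) :=
  hasSmoothDeck_toUnitCotangentRP.contMDiff isLocalHomeomorph_toUnitCotangentRP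
    toUnitCotangentRP_surjective

theorem isCompact_unitCotangentSphere (n : ℕ) : IsCompact (unitCotangentSphere n) := by
  refine Metric.isCompact_of_isClosed_isBounded ?_ ?_
  · exact (isClosed_eq (by fun_prop) continuous_const).inter
      ((isClosed_eq (by fun_prop) continuous_const).inter (isClosed_eq (by fun_prop) continuous_const))
  · refine (Metric.isBounded_closedBall (x := (0 : Euc n × Euc n)) (r := 1)).subset fun x hx => ?_
    rw [mem_closedBall_zero_iff, Prod.norm_def, hx.1, hx.2.1, max_self]

instance (n : ℕ) : CompactSpace (unitCotangentSphere n) :=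
  isCompact_iff_compactSpace.1 (isCompact_unitCotangentSphere n)

theorem unitCotangentSphere_nonempty (hn : 1 ≤ n) : (unitCotangentSphere n).Nonempty := by
  obtain ⟨m, rfl⟩ := Nat.exists_eq_add_of_le' hn
  refine ⟨(EuclideanSpace.single 0 1, EuclideanSpace.single 1 1), ?_, ?_, ?_⟩
  · simp
  · simp
  · simp [EuclideanSpace.inner_single_left]

/-! ### The embedding of the unit cotangent bundle of `ℝPⁿ` -/

/-- A level `s` with `0 < s < 1` of the function `|Q|` on the sphere. -/
structure Level where
  /-- the value of the level -/
  val : ℝ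
  pos : 0 < val
  lt_one : val < 1

namespace Level
variable (s : Level)

theorem norm_coe : ‖(s.val : ℂ)‖ = s.val := by
  rw [Complex.norm_real, Real.norm_of_nonneg s.pos.le]

theorem norm_lt : ‖(s.val : ℂ)‖ < 1 := s.norm_coe.trans_lt s.lt_one

theorem ne_zero : (s.val : ℂ) ≠ 0 := by exact_mod_cast s.pos.ne'

/-- The section of the Hopf fibration over the level set, parametrized by `ST*Sⁿ`. -/
def lift (x : unitCotangentSphere n) : OddSphere n :=
  ⟨theta (cplx n x) s.val, mem_sphere_zero_iff_norm.2 (norm_theta (isFrame_cplx.2 x.2) s.norm_lt.le)⟩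

theorem coe_lift (x : unitCotangentSphere n) : (s.lift x : Cx n) = theta (cplx n x) s.val := rfl

theorem dot_lift (x : unitCotangentSphere n) : dot (s.lift x).1 (s.lift x).1 = s.val :=
  dot_theta (isFrame_cplx.2 x.2) _

theorem frame_lift (x : unitCotangentSphere n) : frame (s.lift x).1 = cplx n x :=
  frame_theta (isFrame_cplx.2 x.2) s.norm_lt

theorem exists_lift_eq {z : OddSphere n} (hz : dot z.1 z.1 = s.val) : ∃ x, s.lift x = z := by
  have h : ‖dot z.1 z.1‖ < 1 := hz ▸ s.norm_lt
  have hf := isFrame_frame (norm_coe_sphere z) h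
  rw [← (cplx n).apply_symm_apply (frame z.1), isFrame_cplx] at hf
  refine ⟨⟨_, hf⟩, Subtype.ext ?_⟩
  rw [coe_lift, (cplx n).apply_symm_apply, ← hz, theta_frame h]

/-- On the image of `lift` the square Q has the fixed nonzero value s, while g multiplies Q by g².
So two lifts in one Hopf fibre differ by g = ±1, and `lift` commutes with signs by `theta_smul`. -/
theorem hopf_lift_eq_iff {x y : unitCotangentSphere n} :
    hopf (s.lift x) = hopf (s.lift y) ↔ toUnitCotangentRP x = toUnitCotangentRP y := by
  have hu : ∀ u : ℤˣ, ((((u : ℤ) : ℝ) : ℂ)) ^ 2 = 1 ∧ ‖(((u : ℤ) : ℝ) : ℂ)‖ = 1 := fun u => by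
    rcases Int.units_eq_one_or u with rfl | rfl <;> simp
  have hsm : ∀ (u : ℤˣ) (y : unitCotangentSphere n), (s.lift (u • y) : Cx n) =
      (((u : ℤ) : ℝ) : ℂ) • (s.lift y : Cx n) := fun u y => by
    have h1 : cplx n (u • y : unitCotangentSphere n) = (((u : ℤ) : ℝ) : ℂ) • cplx n y := by
      rw [coe_units_smul, Complex.coe_smul, ← map_smul]
      rfl
    rw [coe_lift, coe_lift, h1, ← theta_smul (hu u).2, (hu u).1, one_mul]
  rw [hopf_eq_iff, toUnitCotangentRP_eq_iff]
  constructor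
  · rintro ⟨g, hg⟩
    have h1 : (g : ℂ) • (s.lift y : Cx n) = s.lift x := congrArg Subtype.val hg
    have h2 := s.dot_lift x
    rw [← h1, dot_smul_left, dot_smul_right, s.dot_lift y] at h2
    have h3 : ((g : ℂ) - 1) * ((g : ℂ) + 1) = 0 := by
      apply mul_right_cancel₀ s.ne_zero
      linear_combination h2
    obtain ⟨u, hug⟩ : ∃ u : ℤˣ, (((u : ℤ) : ℝ) : ℂ) = g := by
      rcases mul_eq_zero.1 h3 with h | h
      · exact ⟨1, by simpa using (sub_eq_zero.1 h).symm⟩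
      · exact ⟨-1, by simpa using (eq_neg_of_add_eq_zero_left h).symm⟩
    refine ⟨u, ?_⟩
    rw [← hug, ← hsm] at h1
    have h4 := congrArg frame h1
    rw [frame_lift, frame_lift] at h4
    exact Subtype.ext ((cplx n).injective h4)
  · rintro ⟨u, rfl⟩
    exact ⟨⟨_, mem_sphere_zero_iff_norm.2 (hu u).2⟩, Subtype.ext (hsm u y).symm⟩

/-- The map `ST*ℝPⁿ → ℂPⁿ` onto the level set. -/
def toCP (x : UnitCotangentRP n) : CP n :=
  Quotient.lift (fun x => hopf (s.lift x)) (fun _ _ h => s.hopf_lift_eq_iff.2 (Quotient.sound h)) x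

theorem toCP_toUnitCotangentRP (x : unitCotangentSphere n) :
    s.toCP (toUnitCotangentRP x) = hopf (s.lift x) := rfl

theorem toCP_injective : Function.Injective (s.toCP (n := n)) := by
  intro x y
  obtain ⟨x, rfl⟩ := toUnitCotangentRP_surjective x
  obtain ⟨y, rfl⟩ := toUnitCotangentRP_surjective y
  exact s.hopf_lift_eq_iff.1

theorem range_toCP : Set.range (s.toCP (n := n)) =
    {x | ∀ z : OddSphere n, hopf z = x → ‖dot z.1 z.1‖ = s.val} := by
  ext x
  constructor
  · rintro ⟨y, rfl⟩ z hz
    obtain ⟨y, rfl⟩ := toUnitCotangentRP_surjective y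
    obtain ⟨g, rfl⟩ := hopf_eq_iff.1 hz
    rw [coe_circle_smul, dot_smul_left, dot_smul_right, s.dot_lift, norm_mul, norm_mul, Circle.norm_coe,
      one_mul, one_mul, s.norm_coe]
  · intro hx
    obtain ⟨z, rfl⟩ := Quotient.mk_surjective x
    have h1 := hx z rfl
    obtain ⟨θ, hθ⟩ := OpenBookData.exists_arg z
    rw [h1] at hθ
    -- Rotation by -θ/2 makes Q = s e^{iθ} real and positive.
    let g : Circle := ⟨rot (-(θ / 2)), mem_sphere_zero_iff_norm.2 (norm_rot _)⟩
    have h2 : dot (g • z).1 (g • z).1 = s.val := by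
      rw [coe_circle_smul, dot_smul_left, dot_smul_right, hθ]
      change rot (-(θ / 2)) * (rot (-(θ / 2)) * _) = _
      have h3 := rot_half_sq θ
      have h4 := rot_neg_mul (θ / 2)
      rw [← h3]
      linear_combination (s.val : ℂ) * (rot (-(θ / 2)) * rot (θ / 2) + 1) * h4
    obtain ⟨y, hy⟩ := s.exists_lift_eq h2
    exact ⟨toUnitCotangentRP y, by rw [toCP_toUnitCotangentRP, hy, hopf_smul]; rfl⟩

theorem contMDiff_lift : ContMDiff (𝓡 (2 * n - 1)) (𝓡 (2 * n + 1)) ∞ (s.lift (n := n)) := by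
  refine ContMDiff.codRestrict_sphere (f := fun x : unitCotangentSphere n => theta (cplx n x) s.val) ?_ _
  intro x
  have h : ContDiffAt ℝ ∞ (fun y : Euc n × Euc n => theta (cplx n y) s.val) x :=
    contDiffAt_theta_comp (cplx n).contDiff.contDiffAt contDiffAt_const s.norm_lt
  exact h.contMDiffAt.comp x ((unitCotangentSphere_regular n).contMDiff_val x)

theorem contMDiff_toCP :
    ContMDiff (𝓡 (2 * n - 1)) 𝓘(ℝ, EuclideanSpace ℂ (Fin n)) ∞ (s.toCP (n := n)) :=
  IsLocalHomeomorph.contMDiff_of_comp isLocalHomeomorph_toUnitCotangentRP toUnitCotangentRP_surjective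
    (contMDiff_hopf.comp s.contMDiff_lift)

/-- The differential of `lift`. -/
def liftDeriv (x : unitCotangentSphere n) :
    EuclideanSpace ℝ (Fin (2 * n - 1)) →L[ℝ] EuclideanSpace ℝ (Fin (2 * n + 1)) :=
  mfderiv (𝓡 (2 * n - 1)) (𝓡 (2 * n + 1)) s.lift x

theorem tderiv_liftDeriv (x : unitCotangentSphere n) (v : EuclideanSpace ℝ (Fin (2 * n - 1))) :
    tderiv (V := Cx n) (𝓡 (2 * n + 1)) (fun w : OddSphere n => (w : Cx n)) (s.lift x) (s.liftDeriv x v) =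
      tderiv (𝓡 (2 * n - 1)) (fun x : unitCotangentSphere n => theta (cplx n x) s.val) x v :=
  (DFunLike.congr_fun (mfderiv_comp x (mdifferentiable_coe_sphere (s.lift x))
    (s.contMDiff_lift.mdifferentiable (by simp) x)) v).symm

theorem hasDerivAt_lift (x : unitCotangentSphere n) (v : EuclideanSpace ℝ (Fin (2 * n - 1))) :
    ∃ c : ℝ → unitCotangentSphere n, c 0 = x ∧
      HasDerivAt (fun τ => (c τ).1) (tderiv (𝓡 (2 * n - 1)) (Subtype.val : unitCotangentSphere n → _) x v) 0 ∧
      HasDerivAt (fun τ => theta (cplx n (c τ)) s.val)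
        (tderiv (𝓡 (2 * n - 1)) (fun x : unitCotangentSphere n => theta (cplx n x) s.val) x v) 0 := by
  obtain ⟨c, hc⟩ := exists_hasVelocity (I := 𝓡 (2 * n - 1)) x v
  refine ⟨c, hc.zero, hc.hasDerivAt_comp ((unitCotangentSphere_regular n).contMDiff_val.mdifferentiable
    (by simp) x), hc.hasDerivAt_comp (F := fun x : unitCotangentSphere n => theta (cplx n x) s.val) ?_⟩
  exact (mdifferentiable_coe_sphere (s.lift x)).comp x (s.contMDiff_lift.mdifferentiable (by simp) x)

theorem hasDerivAt_cplx {c : ℝ → Euc n × Euc n} {c' : Euc n × Euc n} (hc : HasDerivAt c c' 0) :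
    HasDerivAt (fun τ => cplx n (c τ)) (cplx n c') 0 :=
  (cplx n).toContinuousLinearMap.hasFDerivAt.comp_hasDerivAt 0 hc

/-- The section `lift` is transverse to the fibres of the Hopf fibration. -/
theorem hopfDeriv_liftDeriv_injective (x : unitCotangentSphere n) :
    Function.Injective fun v => hopfDeriv (s.lift x) (s.liftDeriv x v) := by
  suffices h : ∀ v, hopfDeriv (s.lift x) (s.liftDeriv x v) = 0 → v = 0 by
    intro v w hvw
    have : hopfDeriv (s.lift x) (s.liftDeriv x (v - w)) = 0 := by
      rw [map_sub, map_sub]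
      exact sub_eq_zero.2 hvw
    exact sub_eq_zero.1 (h _ this)
  intro v hv
  obtain ⟨a, ha⟩ := hopfDeriv_eq_zero hv
  obtain ⟨c, hc0, hc, hw⟩ := s.hasDerivAt_lift x v
  have hu := hasDerivAt_cplx hc
  have h1 := (hasDerivAt_theta hu (hasDerivAt_const 0 (s.val : ℂ))
    (.of_forall fun τ => isFrame_cplx.2 (c τ).2) s.norm_lt hw).1
  have h2 : tderiv (𝓡 (2 * n - 1)) (fun x : unitCotangentSphere n => theta (cplx n x) s.val) x v =
      a • (Complex.I • (s.lift x : Cx n)) := by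
    rw [← s.tderiv_liftDeriv, ha]
    exact ((tderiv (V := Cx n) (𝓡 (2 * n + 1)) (fun w : OddSphere n => (w : Cx n)) (s.lift x)).map_smul a
      _).trans (congrArg (a • ·) (tderiv_circleField _))
  rw [hc0, h2, ← Complex.coe_smul, dot_smul_right, dot_smul_right] at h1
  have h3 := s.dot_lift x
  rw [coe_lift] at h3
  rw [coe_lift, h3] at h1
  -- Q is constant along `lift`, whereas a times the circle field changes it at the rate 2iaQ, and Q
  -- is nonzero.
  have h4 : a = 0 := by
    have := s.ne_zero
    simpa [this] using h1
  rw [h4, zero_smul] at h2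
  rw [h2] at hw
  -- Zero velocity on the sphere means zero velocity of the frame, since `frame` is a smooth left
  -- inverse of `theta` here.
  have h5 : HasDerivAt (fun τ => cplx n (c τ)) 0 0 := by
    have h6 : ‖dot (theta (cplx n (c 0)) (s.val : ℂ)) (theta (cplx n (c 0)) (s.val : ℂ))‖ < 1 := by
      rw [dot_theta (isFrame_cplx.2 (c 0).2)]
      exact s.norm_lt
    have h7 := ((contDiffAt_frame h6).differentiableAt (by simp)).hasFDerivAt.comp_hasDerivAt (0 : ℝ) hw
    rw [map_zero] at h7
    exact h7.congr_of_eventuallyEq (.of_forall fun τ =>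
      (frame_theta (isFrame_cplx.2 (c τ).2) s.norm_lt).symm)
  have h8 : tderiv (𝓡 (2 * n - 1)) (Subtype.val : unitCotangentSphere n → _) x v = 0 :=
    (cplx n).injective ((hu.unique h5).trans (map_zero _).symm)
  exact (unitCotangentSphere_regular n).tderiv_val_injective x (h8.trans (map_zero _).symm)

theorem mfderiv_hopf_lift (x : unitCotangentSphere n) (v : EuclideanSpace ℝ (Fin (2 * n - 1))) :
    mfderiv (𝓡 (2 * n - 1)) 𝓘(ℝ, EuclideanSpace ℂ (Fin n)) (fun x => hopf (s.lift x)) x v =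
      hopfDeriv (s.lift x) (s.liftDeriv x v) :=
  DFunLike.congr_fun (mfderiv_comp x (contMDiff_hopf.mdifferentiable (by simp) (s.lift x))
    (s.contMDiff_lift.mdifferentiable (by simp) x)) v

/-- Near `y` the map is the composite of a local section `j` of the double cover, `lift` and the
Hopf fibration. The section is immersive, having a smooth left inverse, and the rest is immersive by
transversality of `lift`. -/
theorem mfderiv_toCP_injective (y : UnitCotangentRP n) : Function.Injective
    (mfderiv (𝓡 (2 * n - 1)) 𝓘(ℝ, EuclideanSpace ℂ (Fin n)) s.toCP y) := by
  obtain ⟨j, hj, hpj⟩ := hasSmoothDeck_toUnitCotangentRP.exists_section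
    isLocalHomeomorph_toUnitCotangentRP toUnitCotangentRP_surjective y
  have hjd : MDifferentiableAt (𝓡 (2 * n - 1)) (𝓡 (2 * n - 1)) j y := hj.mdifferentiableAt (by simp)
  have h1 := mfderiv_comp y (contMDiff_toUnitCotangentRP.mdifferentiable (by simp) (j y)) hjd
  have h2 : mfderiv (𝓡 (2 * n - 1)) (𝓡 (2 * n - 1)) (toUnitCotangentRP ∘ j) y =
      mfderiv (𝓡 (2 * n - 1)) (𝓡 (2 * n - 1)) id y := Filter.EventuallyEq.mfderiv_eq hpj
  rw [h1, mfderiv_id] at h2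
  have hinj : Function.Injective (mfderiv (𝓡 (2 * n - 1)) (𝓡 (2 * n - 1)) j y) := by
    intro v w hvw
    have h3 := DFunLike.congr_fun h2 v
    have h4 := DFunLike.congr_fun h2 w
    simp only [ContinuousLinearMap.comp_apply, hvw] at h3 h4
    exact h3.symm.trans h4
  have he : s.toCP =ᶠ[𝓝 y] (fun x => hopf (s.lift x)) ∘ j :=
    hpj.mono fun w hw => (congrArg s.toCP hw).symm
  have h5 : (mfderiv (𝓡 (2 * n - 1)) 𝓘(ℝ, EuclideanSpace ℂ (Fin n)) s.toCP y :
      EuclideanSpace ℝ (Fin (2 * n - 1)) →L[ℝ] EuclideanSpace ℂ (Fin n)) =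
      mfderiv (𝓡 (2 * n - 1)) 𝓘(ℝ, EuclideanSpace ℂ (Fin n)) ((fun x => hopf (s.lift x)) ∘ j) y :=
    Filter.EventuallyEq.mfderiv_eq he
  have h6 := mfderiv_comp y ((contMDiff_hopf.comp s.contMDiff_lift).mdifferentiable (by simp) (j y)) hjd
  intro v w hvw
  have hvw := (DFunLike.congr_fun h5 v).symm.trans (hvw.trans (DFunLike.congr_fun h5 w))
  apply hinj
  apply s.hopfDeriv_liftDeriv_injective (j y)
  have e1 := DFunLike.congr_fun h6 v
  have e2 := DFunLike.congr_fun h6 w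
  exact ((s.mfderiv_hopf_lift (j y) _).symm.trans (e1.symm.trans (hvw.trans e2))).trans
    (s.mfderiv_hopf_lift (j y) _)

theorem isSmoothEmbedding_toCP (hn : 1 ≤ n) :
    Manifold.IsSmoothEmbedding (𝓡 (2 * n - 1)) 𝓘(ℝ, EuclideanSpace ℂ (Fin n)) ∞ (s.toCP (n := n)) := by
  -- The complement is one-dimensional, (2n - 1) + 1 = 2n; the truncated subtraction requires n ≥ 1.
  refine ⟨isImmersion_of_injective_mfderiv (F := ℝ) ?_ s.contMDiff_toCP s.mfderiv_toCP_injective, ?_⟩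
  · rw [finrank_euclideanSpace_fin, finrank_self, finrank_real_of_complex, finrank_euclideanSpace_fin]
    omega
  · exact (s.contMDiff_toCP.continuous.isClosedEmbedding s.toCP_injective).isEmbedding

end Level

/-! ### The contactomorphism onto the dividing set -/

namespace OpenBookData
variable (D : OpenBookData) (s : Level)

/-- Q is constant along `lift`, so only -½ H₁ Im⟨u, du⟩ = H₁ p dq is left of the contact form. -/
theorem alpha_liftDeriv (x : unitCotangentSphere n) (v : EuclideanSpace ℝ (Fin (2 * n - 1))) :
    D.alpha n (s.lift x) (s.liftDeriv x v) = D.H₁ (D.tinv s.val) * canonicalForm n x v := by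
  refine (congrArg (D.sphereForm (s.lift x).1) (s.tderiv_liftDeriv x v)).trans ?_
  obtain ⟨c, hc0, hc, hw⟩ := s.hasDerivAt_lift x v
  have hu := Level.hasDerivAt_cplx hc
  have key := D.sphereForm_theta hu (hasDerivAt_const 0 (s.val : ℂ))
    (.of_forall fun τ => isFrame_cplx.2 (c τ).2) s.norm_lt hw
  have hqp := (hasDerivAt_fst hc).inner ℝ (hasDerivAt_snd hc)
  simp only [(c _).2.2.2] at hqp
  have hqp0 := hqp.unique (hasDerivAt_const (0 : ℝ) (0 : ℝ))
  rw [im_dot_cj_cplx hqp0, hc0, s.norm_coe] at key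
  refine key.trans ?_
  have e : canonicalForm n x v =
      ⟪x.1.2, (tderiv (𝓡 (2 * n - 1)) (Subtype.val : unitCotangentSphere n → _) x v).1⟫_ℝ := rfl
  rw [e]
  simp
  ring

theorem isContactomorphism {s : Level} (hn : 1 ≤ n)
    (hlevel : almostDividingSet (D.alpha n) = {x | ∀ z : OddSphere n, hopf z = x → ‖dot z.1 z.1‖ = s.val}) :
    IsContactomorphismToDividingSet (D.alpha n) (s.toCP (n := n)) where
  embedding := s.isSmoothEmbedding_toCP hn
  range_eq := by rw [hlevel, s.range_toCP]
  contact x z hz := by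
    refine ⟨D.H₁ (D.tinv s.val), D.H₁_pos ?_, fun v w hvw => ?_⟩
    · by_contra! h
      have h1 := D.strictAnti_sig h
      rw [D.sig_tinv s.lt_one, D.sig_zero] at h1
      exact absurd s.pos h1.not_gt
    have hX : D.alpha n z (circleField z) = 0 := by
      have h1 : hopf z ∈ almostDividingSet (D.alpha n) := by
        rw [hlevel, ← s.range_toCP, hz]
        exact ⟨_, rfl⟩
      exact h1 z rfl
    -- The vector `w` and the translate by `g` of the velocity of `lift` have the same image in ℂPⁿ.
    -- They differ by a multiple of the circle field, which the form kills over the dividing set,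
    -- and invariance carries the value back to `lift x`.
    obtain ⟨g, rfl⟩ := hopf_eq_iff.1 hz
    let w' : EuclideanSpace ℝ (Fin (2 * n + 1)) :=
      mfderiv (𝓡 (2 * n + 1)) (𝓡 (2 * n + 1)) (fun z : OddSphere n => g • z) (s.lift x) (s.liftDeriv x v)
    have h2 : hopfDeriv (g • s.lift x) w' = hopfDeriv (g • s.lift x) w :=
      ((hopfDeriv_smul g _ _).trans (s.mfderiv_hopf_lift x v).symm).trans hvw.symm
    let w₁ : EuclideanSpace ℝ (Fin (2 * n + 1)) := w
    obtain ⟨a, ha⟩ := hopfDeriv_eq_zero (z := g • s.lift x) (w := w₁ - w')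
      (((hopfDeriv (g • s.lift x)).map_sub w₁ w').trans (sub_eq_zero.2 h2.symm))
    have h3 : D.alpha n (g • s.lift x) w' = D.alpha n (s.lift x) (s.liftDeriv x v) :=
      DFunLike.congr_fun (congrFun (D.isCircleInvariant_alpha n g) (s.lift x)) (s.liftDeriv x v)
    have h4 : D.alpha n (g • s.lift x) w - D.alpha n (g • s.lift x) w' = 0 :=
      ((D.alpha n (g • s.lift x)).map_sub w w').symm.trans ((congrArg (D.alpha n (g • s.lift x)) ha).trans
        (((D.alpha n (g • s.lift x)).map_smul a _).trans (by rw [hX, smul_zero])))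
    exact ((sub_eq_zero.1 h4).trans h3).trans (D.alpha_liftDeriv s x v)

end OpenBookData

end LeftStabilization

end

open LeftStabilization

theorem proposition3p5 (n : ℕ) (hn : 1 ≤ n) (D : OpenBookData) :
    ∃ (Φ : D.OB n ≃ₘ⟮𝓡 (2 * n + 1), 𝓡 (2 * n + 1)⟯ OddSphere n)
      (α : OneForm (𝓡 (2 * n + 1)) (OddSphere n)),
      IsContactForm α ∧ IsCircleInvariant α ∧
      D.DefinesContactStructure (pullback (𝓡 (2 * n + 1)) Φ α) ∧
      (almostDividingSet α).Nonempty ∧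
      ∃ e : UnitCotangentRP n → CP n, IsContactomorphismToDividingSet α e := by
  obtain ⟨s₀, h0, h1, h⟩ := D.exists_dividing_level
  let s : Level := ⟨s₀, h0, h1⟩
  have he := D.isContactomorphism (s := s) hn (h n)
  obtain ⟨x, hx⟩ := unitCotangentSphere_nonempty hn
  exact ⟨D.obDiffeo n, D.alpha n, D.isContactForm_alpha n, D.isCircleInvariant_alpha n,
    D.definesContactStructure n, he.range_eq ▸ ⟨_, toUnitCotangentRP ⟨x, hx⟩, rfl⟩, s.toCP, he⟩
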